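/- Let $\mathbf k$ be a field, $A$ an abelian group, and let $S=\mathbf k[x_0,\dots,x_n]$ be positively $A$-graded: there is a homomorphism $\theta\colon A\to\mathbb Z$ with $\theta(\deg x_i)>0$ for all $i$ (so $S_0=\mathbf k$). Let $E=\Lambda_{\mathbf k}(e_0,\dots,e_n)$, with the $A\oplus\mathbb Z$-grading $\deg e_i=(-\deg x_i;-1)$. A differential $E$-module is an $A\oplus\mathbb Z$-graded right $E$-module $D$ with a square-zero $E$-linear endomorphism $\partial_D$ of degree $(0;-1)$; we put $e_i d=(-1)^{j}d e_i$ for $d\in D_{(a;j)}$, and $H(D)=\ker\partial_D/\operatorname{im}\partial_D$ is a differential $E$-module with zero differential. Let $\mathbf L(D)$ be the complex of $A$-graded $S$-modules with $$\mathbf L(D)_j=\bigoplus_{a\in A}S(-a)\otimes_{\mathbf k}D_{(a;j)},\qquad s\otimes d\mapsto\Big(\sum_i x_is\otimes e_id\Big)-s\otimes\partial_D(d),$$ and let $\overline{\mathbf L(D)}$ be the complex with the same terms and with differential $s\otimes d\mapsto -s\otimes\partial_D(d)$ only. With $\omega_E=\operatorname{Hom}_{\mathbf k}(E,\mathbf k)$,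 a complex $C$ of $A$-graded $S$-modules gives the differential $E$-module $$\mathbf R(C)=\bigoplus_{j\in\mathbb Z}\bigoplus_{a\in A}(C_j)_a\otimes_{\mathbf k}\omega_E(-a;-j),\qquad c\otimes f\mapsto(-1)^j\Big(\sum_i x_ic\otimes e_if\Big)+\partial_C(c)\otimes f\quad(c\in C_j).$$ The terms of a complex $C$ are bounded below in $A$-degrees if there is a homomorphism $\theta\colon A\to\mathbb Z$ with $\theta(\deg x_i)>0$ for all $i$ such that, for each $j$, $(C_j)_a=0$ whenever $\theta(a)\ll 0$; and $C$ is homologically bounded below if $H_j(C)=0$ for $j\ll0$. A minimal free resolution of a complex $G$ is a quasi-isomorphism $F\to G$ of complexes of $A$-graded $S$-modules, where $F$ is a homologically bounded below complex of free graded modules, with terms bounded below in $A$-degrees, that is minimal: $\partial_F(F)\subseteq(x_0,\dots,x_n)F$. A degree-preserving map of free $A$-graded $S$-modules is strongly linear if there are homogeneous bases of its source and target in which its matrix has entries that are $\mathbf k$-linear combinations of $x_0,\dots,x_n$. Let $G$ be a homologically bounded below complex of $A$-graded $S$-modules whose terms are bounded below in $A$-degrees. Let $(\pi,\iota,h)$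 be a contraction of $\overline{\mathbf L\mathbf R(G)}$ onto $\overline{\mathbf L(H(\mathbf R(G)))}$ in the category of complexes of $A$-graded $S$-modules: $\pi,\iota$ are chain maps with $\pi\iota=\mathrm{id}$, $h$ is a null homotopy of $\mathrm{id}-\iota\pi$, and $\pi h=0$, $h\iota=0$, $h^2=0$. Assume that $\pi$ induces on homology the canonical identification $H(\overline{\mathbf L\mathbf R(G)})=S\otimes_{\mathbf k}H(\mathbf R(G))$, that is, $\pi(1\otimes z)=1\otimes[z]$ for all cycles $z$ of $\mathbf R(G)$. Let $\partial'$ be the endomorphism $s\otimes d\mapsto\sum_i x_is\otimes e_id$ of $\mathbf L\mathbf R(G)$, and put $$\delta_i=(-1)^{i-1}\pi(\partial'h)^{i-1}\partial'\iota\qquad(i\ge1).$$ Then for each $x\in\mathbf L(H(\mathbf R(G)))$ only finitely many $\delta_i(x)$ are nonzero. Let $\delta$ be the differential of $\mathbf L(H(\mathbf R(G)))$, and let $F$ have the same underlying module as $\mathbf L(H(\mathbf R(G)))$ and the differential $\delta+\sum_{i\ge2}\delta_i$. Then $F$ is a complex, and it is the minimal free resolution of $G$. If $G_j=0$ for all $j<m$,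 then $F_j=0$ for all $j<m$; if $\theta\colon A\to\mathbb Z$ is a homomorphism with $\theta(\deg x_i)>0$ for all $i$, $N\in\mathbb Z$, and $(G_j)_a=0$ for all $j$ and all $a$ with $\theta(a)<N$, then the same holds for $F$. Moreover, each $\delta_i$, $i\ge1$, is an $i$-fold composition of strongly linear maps. If $\pi,\iota,h$ are obtained from $\mathbf k$-linear maps by extension of scalars to $S$, then the $i$ maps can moreover be chosen to have matrices of linear forms with respect to one homogeneous basis of each module occurring, where the basis of $F$, as source and as target, is the same for all $i$. -/

import Mathlib

open scoped TensorProduct DirectSum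

namespace MultigradedBGG

universe u uk uA

noncomputable section

section Gradings

variable {k : Type*} [Field k] {ι κ l : Type*} [DecidableEq ι]
variable {M N : Type*} [AddCommGroup M] [Module k M] [AddCommGroup N] [Module k N]

/-- The decomposition of a graded vector space into its components. -/
def decomp {gr : ι → Submodule k M} (h : DirectSum.IsInternal gr) : M ≃ₗ[k] ⨁ i, gr i :=
  (LinearEquiv.ofBijective (DirectSum.coeLinearMap gr) (by exact h)).symm

theorem decomp_of_mem {gr : ι → Submodule k M} (h : DirectSum.IsInternal gr) {i : ι} {m : M}
    (hm : m ∈ gr i) : decomp h m = DirectSum.lof k ι (fun i => gr i) i ⟨m, hm⟩ := by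
  rw [decomp, LinearEquiv.symm_apply_eq]
  exact (DirectSum.coeLinearMap_lof gr i ⟨m, hm⟩).symm

/-- The projection of a graded vector space onto its component of degree `i`. -/
def component {gr : ι → Submodule k M} (h : DirectSum.IsInternal gr) (i : ι) : M →ₗ[k] M :=
  (gr i).subtype ∘ₗ DirectSum.component k ι (fun i => gr i) i ∘ₗ (decomp h).toLinearMap

theorem component_of_mem {gr : ι → Submodule k M} (h : DirectSum.IsInternal gr) {i : ι} {m : M}
    (hm : m ∈ gr i) : component h i m = m := by
  simp [component, decomp_of_mem h hm, DirectSum.component.lof_self]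

theorem component_of_mem_ne {gr : ι → Submodule k M} (h : DirectSum.IsInternal gr) {i j : ι}
    (hij : i ≠ j) {m : M} (hm : m ∈ gr j) : component h i m = 0 := by
  simp [component, decomp_of_mem h hm, DirectSum.component.of, hij.symm]

theorem component_mem {gr : ι → Submodule k M} (h : DirectSum.IsInternal gr) (i : ι) (m : M) :
    component h i m ∈ gr i := by
  simp [component]

theorem exists_sum_component {gr : ι → Submodule k M} (h : DirectSum.IsInternal gr) (m : M) :
    ∃ s : Finset ι, m = ∑ i ∈ s, component h i m := by
  classical
  refine ⟨DFinsupp.support (decomp h m), ?_⟩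
  have h1 : DirectSum.coeLinearMap gr (decomp h m) = m :=
    (LinearEquiv.ofBijective (DirectSum.coeLinearMap gr) (by exact h)).apply_symm_apply m
  refine h1.symm.trans ?_
  rw [DirectSum.coeLinearMap_eq_dfinsuppSum]
  rfl

theorem grading_induction {gr : ι → Submodule k M} (h : DirectSum.IsInternal gr)
    {P : M → Prop} (h0 : P 0) (ha : ∀ x y, P x → P y → P (x + y))
    (hm : ∀ i, ∀ m ∈ gr i, P m) (m : M) : P m := by
  have : m ∈ iSup gr := by rw [h.submodule_iSup_eq_top]; trivial
  exact Submodule.iSup_induction gr (motive := P) this hm h0 ha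

theorem linearMap_ext_grading {gr : ι → Submodule k M} (h : DirectSum.IsInternal gr)
    {f g : M →ₗ[k] N} (hfg : ∀ i, ∀ m ∈ gr i, f m = g m) : f = g := by
  ext m
  refine grading_induction h (P := fun m => f m = g m) (by simp) ?_ hfg m
  intro x y hx hy
  simp [hx, hy]

theorem isInternal_of_proj {gr : ι → Submodule k M} (pr : ι → M →ₗ[k] M)
    (h1 : ∀ i, ∀ m ∈ gr i, pr i m = m) (h2 : ∀ i j, i ≠ j → ∀ m ∈ gr j, pr i m = 0)
    (h3 : ∀ m, m ∈ iSup gr) : DirectSum.IsInternal gr := by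
  rw [DirectSum.isInternal_submodule_iff_iSupIndep_and_iSup_eq_top]
  refine ⟨?_, eq_top_iff.2 fun m _ => h3 m⟩
  intro i
  rw [Submodule.disjoint_def]
  intro x hx hx'
  rw [← h1 i x hx]
  have : (⨆ j, ⨆ (_ : j ≠ i), gr j) ≤ LinearMap.ker (pr i) :=
    iSup_le fun j => iSup_le fun hj m hm => h2 i j hj.symm m hm
  exact this hx'

/-- The `k`-linear endomorphism acting on the component of degree `i` as multiplication by
`(-1) ^ s i`. -/
def signOp {gr : ι → Submodule k M} (h : DirectSum.IsInternal gr) (s : ι → ℤ) : M →ₗ[k] M :=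
  DirectSum.toModule k ι M (fun i => ((s i).negOnePow : ℤ) • (gr i).subtype) ∘ₗ
    (decomp h).toLinearMap

theorem signOp_of_mem {gr : ι → Submodule k M} (h : DirectSum.IsInternal gr) (s : ι → ℤ)
    {i : ι} {m : M} (hm : m ∈ gr i) : signOp h s m = ((s i).negOnePow : ℤ) • m := by
  simp [signOp, decomp_of_mem h hm]

/-- The grading of `M ⊗ N` in which `m ⊗ n` has degree `f i j` for `m` of degree `i` and `n` of
degree `j`. -/
def tensorGr (f : ι → κ → l) (V : ι → Submodule k M) (W : κ → Submodule k N) (c : l) :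
    Submodule k (M ⊗[k] N) :=
  ⨆ (i : ι) (j : κ) (_ : f i j = c), Submodule.map₂ (TensorProduct.mk k M N) (V i) (W j)

theorem tmul_mem_tensorGr (f : ι → κ → l) {V : ι → Submodule k M} {W : κ → Submodule k N}
    {i : ι} {j : κ} {m : M} {x : N} (hm : m ∈ V i) (hx : x ∈ W j) {c : l} (hc : f i j = c) :
    m ⊗ₜ[k] x ∈ tensorGr f V W c :=
  le_iSup_of_le (f := fun i => ⨆ (j : κ) (_ : f i j = c),
      Submodule.map₂ (TensorProduct.mk k M N) (V i) (W j)) i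
    (le_iSup_of_le (f := fun j => ⨆ (_ : f i j = c),
      Submodule.map₂ (TensorProduct.mk k M N) (V i) (W j)) j
      (le_iSup_of_le hc le_rfl)) (Submodule.apply_mem_map₂ (TensorProduct.mk k M N) hm hx)

theorem tensorGr_le {f : ι → κ → l} {V : ι → Submodule k M} {W : κ → Submodule k N} {c : l}
    {P : Submodule k (M ⊗[k] N)}
    (h : ∀ i j, f i j = c → ∀ m ∈ V i, ∀ x ∈ W j, m ⊗ₜ[k] x ∈ P) : tensorGr f V W c ≤ P :=
  iSup_le fun i => iSup_le fun j => iSup_le fun hc => Submodule.map₂_le.2 fun m hm x hx =>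
    h i j hc m hm x hx

theorem isInternal_tensorGr [DecidableEq κ] [DecidableEq l] (f : ι → κ → l) {V : ι → Submodule k M} {W : κ → Submodule k N}
    (hV : DirectSum.IsInternal V) (hW : DirectSum.IsInternal W) :
    DirectSum.IsInternal (tensorGr f V W) := by
  classical
  let T := tensorGr f V W
  let eV := decomp hV
  let eW := decomp hW
  let g : ∀ i j, V i →ₗ[k] W j →ₗ[k] ⨁ c, T c := fun i j =>
    LinearMap.mk₂ k (fun m x => DirectSum.lof k l (fun c => T c) (f i j)
      ⟨(m : M) ⊗ₜ[k] (x : N), tmul_mem_tensorGr f m.2 x.2 rfl⟩)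
      (fun _ _ _ => by rw [← map_add]; congr 1; ext; simp [TensorProduct.add_tmul])
      (fun _ _ _ => by rw [← map_smul]; congr 1)
      (fun _ _ _ => by rw [← map_add]; congr 1; ext; simp [TensorProduct.tmul_add])
      (fun _ _ _ => by rw [← map_smul]; congr 1; ext; simp)
  let dec : M ⊗[k] N →ₗ[k] ⨁ c, T c := TensorProduct.lift
    ((DirectSum.toModule k ι _ (fun i => LinearMap.flip
      ((DirectSum.toModule k κ _ (fun j => (g i j).flip)) ∘ₗ eW.toLinearMap))) ∘ₗ eV.toLinearMap)
  have hdec : ∀ i j m x (hm : m ∈ V i) (hx : x ∈ W j), dec (m ⊗ₜ x) =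
      DirectSum.lof k l (fun c => T c) (f i j) ⟨m ⊗ₜ x, tmul_mem_tensorGr f hm hx rfl⟩ := by
    intro i j m x hm hx
    simp [dec, eV, eW, decomp_of_mem hV hm, decomp_of_mem hW hx, g]
  refine (DirectSum.Decomposition.ofLinearMap T dec ?_ ?_).isInternal
  · apply TensorProduct.ext
    refine linearMap_ext_grading hV fun i m hm => ?_
    refine linearMap_ext_grading hW fun j x hx => ?_
    simp [hdec i j m x hm hx]
  · refine DirectSum.linearMap_ext k fun c => ?_
    ext ⟨t, ht⟩ : 1
    simp only [LinearMap.comp_apply, DirectSum.coeLinearMap_lof, LinearMap.id_apply]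
    have key : T c ≤ LinearMap.ker ((LinearMap.id : M ⊗[k] N →ₗ[k] M ⊗[k] N) -
        (T c).subtype ∘ₗ DirectSum.component k l (fun c => T c) c ∘ₗ dec) ⊓
        ⨅ (c') (_ : c' ≠ c), LinearMap.ker (DirectSum.component k l (fun c => T c) c' ∘ₗ dec) := by
      refine tensorGr_le ?_
      rintro i j rfl m hm x hx
      simp only [Submodule.mem_inf, Submodule.mem_iInf, LinearMap.mem_ker, LinearMap.sub_apply,
        LinearMap.comp_apply, hdec i j m x hm hx]
      refine ⟨by simp [DirectSum.component.lof_self], fun c' hc' => ?_⟩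
      rw [DirectSum.component.of, dif_neg hc'.symm]
    obtain ⟨k1, k2⟩ := key ht
    refine DirectSum.ext_component k fun c' => ?_
    by_cases hc : c' = c
    · subst hc
      rw [DirectSum.component.lof_self]
      apply Subtype.ext
      simp only [SetLike.mem_coe, LinearMap.mem_ker, LinearMap.sub_apply, sub_eq_zero] at k1
      exact k1.symm
    · simp only [SetLike.mem_coe, Submodule.mem_iInf, LinearMap.mem_ker] at k2
      rw [DirectSum.component.of, dif_neg (Ne.symm hc)]
      exact k2 c' hc

theorem sum_sum_eq_zero_of_antisymm {m : ℕ} (T : Fin m → Fin m → M) (h0 : ∀ i, T i i = 0)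
    (h1 : ∀ i j, T i j = - T j i) : ∑ i, ∑ j, T i j = 0 := by
  rw [← Finset.sum_product']
  refine Finset.sum_involution (fun p _ => p.swap) ?_ ?_ ?_ ?_
  · rintro ⟨i, j⟩ _
    simp [h1 i j]
  · rintro ⟨i, j⟩ _ h h'
    simp only [Prod.swap_prod_mk, Prod.mk.injEq] at h'
    obtain ⟨rfl, -⟩ := h'
    exact h (h0 _)
  · simp
  · simp

theorem linearCombination_sq {m : ℕ} {B : Type*} [Ring B] [Algebra k B] (t : Fin m → B)
    (h0 : ∀ i, t i * t i = 0) (h1 : ∀ i j, t i * t j = - (t j * t i)) (v : Fin m → k) :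
    Fintype.linearCombination k t v * Fintype.linearCombination k t v = 0 := by
  simp only [Fintype.linearCombination_apply]
  rw [Finset.sum_mul_sum]
  refine sum_sum_eq_zero_of_antisymm _ (fun i => ?_) fun i j => ?_
  · rw [smul_mul_smul_comm, h0, smul_zero]
  · rw [smul_mul_smul_comm, smul_mul_smul_comm, h1 i j, smul_neg, mul_comm]

end Gradings

section Algebras

/-- The polynomial ring `S = k[x_0, …, x_n]`. -/
abbrev Poly (k : Type uk) [Field k] (n : ℕ) : Type uk := MvPolynomial (Fin (n + 1)) k

/-- The exterior algebra `E = Λ_k(e_0, …, e_n)`. -/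
abbrev Ext (k : Type uk) [Field k] (n : ℕ) : Type uk := ExteriorAlgebra k (Fin (n + 1) → k)

/-- The exterior variable `e_i`. -/
def extVar (k : Type uk) [Field k] (n : ℕ) (i : Fin (n + 1)) : Ext k n :=
  ExteriorAlgebra.ι k (Pi.single i 1)

variable {k : Type uk} [Field k] {n : ℕ} {A : Type uA} [AddCommGroup A] [DecidableEq A]

theorem extVar_sq (i : Fin (n + 1)) : extVar k n i * extVar k n i = 0 :=
  ExteriorAlgebra.ι_sq_zero _

theorem extVar_anticomm (i j : Fin (n + 1)) :
    extVar k n i * extVar k n j = - (extVar k n j * extVar k n i) :=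
  eq_neg_of_add_eq_zero_left (ExteriorAlgebra.ι_add_mul_swap _ _)

/-- The `A ⊕ ℤ`-grading of `E` with `deg e_i = (-deg x_i; -1)`: the component of degree `d` is
spanned by the products of the `e_i` of total degree `d`. -/
def extGr (w : Fin (n + 1) → A) (d : A × ℤ) : Submodule k (Ext k n) :=
  Submodule.span k {y | ∃ v : List (Fin (n + 1)), (v.map fun i => (-w i, (-1 : ℤ))).sum = d ∧
    (v.map (extVar k n)).prod = y}

theorem extVar_mem_extGr (w : Fin (n + 1) → A) (i : Fin (n + 1)) :
    extVar k n i ∈ extGr (k := k) w (-w i, -1) :=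
  Submodule.subset_span ⟨[i], by simp, by simp⟩

instance extGr_gradedMonoid (w : Fin (n + 1) → A) : SetLike.GradedMonoid (extGr (k := k) w) where
  one_mem := Submodule.subset_span ⟨[], by simp, by simp⟩
  mul_mem := by
    intro d d' x y hx hy
    have : extGr (k := k) w d * extGr (k := k) w d' ≤ extGr (k := k) w (d + d') := by
      rw [extGr, extGr, Submodule.span_mul_span]
      refine Submodule.span_le.2 ?_
      rintro _ ⟨_, ⟨v, hv, rfl⟩, _, ⟨v', hv', rfl⟩, rfl⟩
      exact Submodule.subset_span ⟨v ++ v', by simp [hv, hv'], by simp⟩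
    exact this (Submodule.mul_mem_mul hx hy)

theorem isInternal_extGr (w : Fin (n + 1) → A) : DirectSum.IsInternal (extGr (k := k) w) := by
  let 𝒜 := extGr (k := k) w
  let t : Fin (n + 1) → ⨁ d, 𝒜 d := fun i =>
    DirectSum.of (fun d => 𝒜 d) (-w i, -1) ⟨extVar k n i, extVar_mem_extGr w i⟩
  have ht0 : ∀ i, t i * t i = 0 := by
    intro i
    simp only [t]
    rw [DirectSum.of_mul_of]
    exact DFinsupp.single_eq_zero.mpr (Subtype.ext (extVar_sq i))
  have ht1 : ∀ i j, t i * t j = - (t j * t i) := by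
    intro i j
    simp only [t]
    rw [DirectSum.of_mul_of, DirectSum.of_mul_of, ← map_neg]
    refine DirectSum.of_eq_of_gradedMonoid_eq (Sigma.subtype_ext (add_comm _ _) ?_)
    exact extVar_anticomm i j
  let φ : (Fin (n + 1) → k) →ₗ[k] ⨁ d, 𝒜 d := Fintype.linearCombination k t
  have hφ : ∀ v, φ v * φ v = 0 := linearCombination_sq t ht0 ht1
  let Φ : Ext k n →ₐ[k] ⨁ d, 𝒜 d := ExteriorAlgebra.lift k ⟨φ, hφ⟩
  have hΦ : ∀ i, Φ (extVar k n i) = t i := by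
    intro i
    simp [Φ, extVar, φ, Fintype.linearCombination_apply_single]
  have hlist : ∀ v : List (Fin (n + 1)), ∀ h : (v.map (extVar k n)).prod ∈
      𝒜 (v.map fun i => (-w i, (-1 : ℤ))).sum, Φ (v.map (extVar k n)).prod =
      DirectSum.of (fun d => 𝒜 d) _ ⟨_, h⟩ := by
    intro v
    induction v with
    | nil =>
      intro h
      simp only [List.map_nil, List.prod_nil, map_one]
      rfl
    | cons i v ih =>
      intro h
      have h' : (v.map (extVar k n)).prod ∈ 𝒜 (v.map fun i => (-w i, (-1 : ℤ))).sum :=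
        Submodule.subset_span ⟨v, rfl, rfl⟩
      simp only [List.map_cons, List.prod_cons, map_mul, ih h', hΦ, t]
      rw [DirectSum.of_mul_of]
      exact DirectSum.of_eq_of_gradedMonoid_eq (Sigma.subtype_ext rfl rfl)
  refine (GradedAlgebra.ofAlgHom 𝒜 Φ ?_ ?_).isInternal
  · ext i
    simp only [LinearMap.comp_apply, AlgHom.toLinearMap_apply, AlgHom.comp_apply, AlgHom.id_apply,
      LinearMap.single_apply]
    have := hΦ i
    simp only [extVar] at this
    rw [this]
    simp [t, extVar]
  · rintro d ⟨x, hx⟩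
    have key : ∀ x (hx : x ∈ 𝒜 d), Φ x = DirectSum.lof k _ (fun d => 𝒜 d) d ⟨x, hx⟩ := by
      intro x hx
      refine Submodule.span_induction (p := fun x hx => Φ x =
        DirectSum.lof k _ (fun d => 𝒜 d) d ⟨x, hx⟩) ?_ ?_ ?_ ?_ hx
      · rintro _ ⟨v, rfl, rfl⟩
        exact hlist v _
      · rw [map_zero]
        exact (map_zero _).symm
      · intro x y hx hy h1 h2
        rw [map_add, h1, h2, ← map_add]
        rfl
      · intro a x hx h1
        rw [map_smul, h1, ← map_smul]
        rfl
    exact key x hx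

/-- `ω_E = Hom_k(E, k)`. -/
abbrev Omega (k : Type uk) [Field k] (n : ℕ) : Type uk := Module.Dual k (Ext k n)

/-- The right `E`-module structure `(f e)(y) = f (e y)` on `ω_E`, as an action of `Eᵐᵒᵖ`. -/
def omegaAct (k : Type uk) [Field k] (n : ℕ) : (Ext k n)ᵐᵒᵖ →ₐ[k] Module.End k (Omega k n) where
  toFun e := Module.Dual.transpose (R := k) (LinearMap.mulLeft k e.unop)
  map_one' := by ext; simp [Module.Dual.transpose_apply]
  map_mul' a b := by ext; simp [Module.Dual.transpose_apply]
  map_zero' := by ext; simp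
  map_add' a b := by ext; simp [Module.Dual.transpose_apply, add_mul]
  commutes' r := by
    ext; simp [Module.Dual.transpose_apply, Algebra.algebraMap_eq_smul_one]

theorem omegaAct_apply (e : Ext k n) (f : Omega k n) (y : Ext k n) :
    omegaAct k n (MulOpposite.op e) f y = f (e * y) := rfl

/-- The component `(ω_E)_d = Hom_k(E_{-d}, k)`: the functionals on `E` vanishing on all the
components of `E` of degree different from `-d`. -/
def omegaGr (w : Fin (n + 1) → A) (d : A × ℤ) : Submodule k (Omega k n) where
  carrier := {f | ∀ d', d' ≠ -d → ∀ y ∈ extGr (k := k) w d', f y = 0}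
  add_mem' hf hg d' hd y hy := by simp [hf d' hd y hy, hg d' hd y hy]
  zero_mem' _ _ _ _ := rfl
  smul_mem' a f hf d' hd y hy := by simp [hf d' hd y hy]

instance ext_finite (k : Type uk) [Field k] (n : ℕ) : Module.Finite k (Ext k n) :=
  Module.Finite.of_basis (Module.Basis.ExteriorAlgebra (Pi.basisFun k (Fin (n + 1))))

theorem isInternal_omegaGr (w : Fin (n + 1) → A) :
    DirectSum.IsInternal (omegaGr (k := k) w) := by
  have hE := isInternal_extGr (k := k) w
  refine isInternal_of_proj
    (fun d => Module.Dual.transpose (R := k) (component hE (-d))) ?_ ?_ ?_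
  · intro d f hf
    refine linearMap_ext_grading hE fun d' y hy => ?_
    rw [Module.Dual.transpose_apply, LinearMap.comp_apply]
    by_cases h : d' = -d
    · subst h
      rw [component_of_mem hE hy]
    · rw [component_of_mem_ne hE (Ne.symm h) hy, map_zero, hf d' h y hy]
  · intro d d₁ hd f hf
    refine linearMap_ext_grading hE fun d' y hy => ?_
    rw [Module.Dual.transpose_apply, LinearMap.comp_apply]
    exact hf (-d) (fun h => hd (neg_injective h)) _ (component_mem hE _ _)
  · intro f
    have hfin : {d | extGr (k := k) w d ≠ ⊥}.Finite :=
      WellFoundedGT.finite_ne_bot_of_iSupIndep hE.submodule_iSupIndep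
    have : f = ∑ d ∈ hfin.toFinset, f ∘ₗ component hE d := by
      refine linearMap_ext_grading hE fun d' y hy => ?_
      rw [LinearMap.sum_apply]
      by_cases hd : extGr (k := k) w d' = ⊥
      · rw [hd, Submodule.mem_bot] at hy
        simp [hy]
      · rw [Finset.sum_eq_single d']
        · rw [LinearMap.comp_apply, component_of_mem hE hy]
        · intro d _ hne
          rw [LinearMap.comp_apply, component_of_mem_ne hE hne hy, map_zero]
        · intro h
          exact absurd (hfin.mem_toFinset.2 hd) h
    rw [this]
    refine Submodule.sum_mem _ fun d _ => Submodule.mem_iSup_of_mem (-d) ?_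
    intro d' hd y hy
    rw [LinearMap.comp_apply, component_of_mem_ne hE _ hy, map_zero]
    rintro rfl
    exact hd (neg_neg _).symm

theorem omegaAct_mem (w : Fin (n + 1) → A) {d d' : A × ℤ} {f : Omega k n}
    (hf : f ∈ omegaGr (k := k) w d) {e : Ext k n} (he : e ∈ extGr (k := k) w d') :
    omegaAct k n (MulOpposite.op e) f ∈ omegaGr (k := k) w (d + d') := by
  intro d₁ hd y hy
  rw [omegaAct_apply]
  refine hf _ (fun h => hd ?_) _ (SetLike.GradedMul.mul_mem (A := extGr (k := k) w) he hy)
  rw [neg_add, ← h]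
  abel

/-- Left multiplication by `e_i` on `ω_E`: `e_i f = (-1) ^ aux(f) f e_i`. -/
def omegaLeft (w : Fin (n + 1) → A) (i : Fin (n + 1)) : Omega k n →ₗ[k] Omega k n :=
  omegaAct k n (MulOpposite.op (extVar k n i)) ∘ₗ signOp (isInternal_omegaGr (k := k) w) Prod.snd

end Algebras

section Objects

variable (k : Type uk) [Field k] {n : ℕ} {A : Type uA} [AddCommGroup A] [DecidableEq A]

/-- A sequence `(M_j)_{j ∈ ℤ}` of `A`-graded `S`-modules, where `deg x_i = w i`, presented by its
total module `⨁_j M_j`: the component `gr (a, j)` is the degree `a` part of `M_j`. -/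
structure GrMod (w : Fin (n + 1) → A) where
  carrier : Type u
  [addCommGroup : AddCommGroup carrier]
  [moduleK : Module k carrier]
  [moduleS : Module (Poly k n) carrier]
  [tower : IsScalarTower k (Poly k n) carrier]
  gr : A × ℤ → Submodule k carrier
  isInternal : DirectSum.IsInternal gr
  smul_mem : ∀ (b a : A) (j : ℤ), ∀ p ∈ MvPolynomial.weightedHomogeneousSubmodule k w b,
    ∀ m ∈ gr (a, j), p • m ∈ gr (b + a, j)

attribute [instance] GrMod.addCommGroup GrMod.moduleK GrMod.moduleS GrMod.tower

instance (w : Fin (n + 1) → A) : CoeSort (GrMod.{u} k w) (Type u) := ⟨GrMod.carrier⟩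

/-- A differential `E`-module: an `A ⊕ ℤ`-graded right `E`-module (that is, a module over `Eᵐᵒᵖ`)
with a square zero `E`-linear endomorphism of degree `(0; -1)`. -/
structure DiffMod (w : Fin (n + 1) → A) where
  carrier : Type u
  [addCommGroup : AddCommGroup carrier]
  [moduleK : Module k carrier]
  [moduleE : Module (Ext k n)ᵐᵒᵖ carrier]
  [tower : IsScalarTower k (Ext k n)ᵐᵒᵖ carrier]
  gr : A × ℤ → Submodule k carrier
  isInternal : DirectSum.IsInternal gr
  smul_mem : ∀ (d d' : A × ℤ), ∀ m ∈ gr d, ∀ e ∈ extGr (k := k) w d',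
    MulOpposite.op e • m ∈ gr (d + d')
  d : carrier →ₗ[(Ext k n)ᵐᵒᵖ] carrier
  d_mem : ∀ (a : A) (j : ℤ), ∀ m ∈ gr (a, j), d m ∈ gr (a, j - 1)
  d_sq : ∀ m, d (d m) = 0

attribute [instance] DiffMod.addCommGroup DiffMod.moduleK DiffMod.moduleE DiffMod.tower

instance (w : Fin (n + 1) → A) : CoeSort (DiffMod.{u} k w) (Type u) := ⟨DiffMod.carrier⟩

variable {k} {w : Fin (n + 1) → A}

/-- `f` preserves `A`-degrees and raises the homological degree by `r`. -/
def IsHomogeneousMap {M N : GrMod k w} (f : M →ₗ[Poly k n] N) (r : ℤ) : Prop :=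
  ∀ (a : A) (j : ℤ), ∀ m ∈ M.gr (a, j), f m ∈ N.gr (a, j + r)

/-- `d` is a differential: it lowers the homological degree by one, preserves `A`-degrees and
squares to zero. -/
structure IsDifferential (M : GrMod k w) (d : M →ₗ[Poly k n] M) : Prop where
  homogeneous : IsHomogeneousMap d (-1)
  sq : ∀ m, d (d m) = 0

variable (k w) in
/-- A complex of `A`-graded `S`-modules. -/
structure Cpx where
  toGrMod : GrMod.{u} k w
  d : toGrMod →ₗ[Poly k n] toGrMod
  isDifferential : IsDifferential toGrMod d

instance : CoeSort (Cpx.{u} k w) (Type u) := ⟨fun C => C.toGrMod.carrier⟩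

/-- Multiplication by the variable `x_i`. -/
def GrMod.mulVar (M : GrMod k w) (i : Fin (n + 1)) : M →ₗ[k] M :=
  (LinearMap.lsmul (Poly k n) M (MvPolynomial.X i)).restrictScalars k

/-- The homological sign `m ↦ (-1) ^ j m` for `m ∈ M_j`. -/
def GrMod.sign (M : GrMod k w) : M →ₗ[k] M := signOp M.isInternal Prod.snd

theorem GrMod.X_smul_mem (M : GrMod k w) (i : Fin (n + 1)) {a : A} {j : ℤ} {m : M}
    (hm : m ∈ M.gr (a, j)) : (MvPolynomial.X i : Poly k n) • m ∈ M.gr (w i + a, j) :=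
  M.smul_mem (w i) a j _ (MvPolynomial.isWeightedHomogeneous_X k w i) m hm

/-- Right multiplication `m ↦ m e_i`. -/
def DiffMod.rightVar (D : DiffMod k w) (i : Fin (n + 1)) : D →ₗ[k] D :=
  { toFun := fun m => MulOpposite.op (extVar k n i) • m
    map_add' := smul_add _
    map_smul' := fun r m => (smul_comm r (MulOpposite.op (extVar k n i)) m).symm }

/-- Left multiplication `e_i m = (-1) ^ aux(m) m e_i`. -/
def DiffMod.leftVar (D : DiffMod k w) (i : Fin (n + 1)) : D →ₗ[k] D :=
  D.rightVar i ∘ₗ signOp D.isInternal Prod.snd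

end Objects

section FunctorL

variable {k : Type uk} [Field k] {n : ℕ} {A : Type uA} [AddCommGroup A] [DecidableEq A]
variable {w : Fin (n + 1) → A}

theorem DiffMod.leftVar_of_mem (D : DiffMod k w) (i : Fin (n + 1)) {d : A × ℤ} {m : D}
    (hm : m ∈ D.gr d) :
    D.leftVar i m = (d.2.negOnePow : ℤ) • (MulOpposite.op (extVar k n i) • m) := by
  rw [leftVar, LinearMap.comp_apply, signOp_of_mem D.isInternal Prod.snd hm, map_zsmul]
  rfl

theorem DiffMod.rightVar_mem (D : DiffMod k w) (i : Fin (n + 1)) {a : A} {j : ℤ} {m : D}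
    (hm : m ∈ D.gr (a, j)) : MulOpposite.op (extVar k n i) • m ∈ D.gr (a - w i, j - 1) := by
  have := D.smul_mem _ _ m hm _ (extVar_mem_extGr w i)
  rwa [Prod.mk_add_mk, ← sub_eq_add_neg, ← sub_eq_add_neg] at this

theorem DiffMod.leftVar_mem (D : DiffMod k w) (i : Fin (n + 1)) {a : A} {j : ℤ} {m : D}
    (hm : m ∈ D.gr (a, j)) : D.leftVar i m ∈ D.gr (a - w i, j - 1) := by
  rw [D.leftVar_of_mem i hm]
  exact zsmul_mem (D.rightVar_mem i hm) _

theorem DiffMod.leftVar_leftVar (D : DiffMod k w) (i j : Fin (n + 1)) {d : A × ℤ} {m : D}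
    (hm : m ∈ D.gr d) :
    D.leftVar i (D.leftVar j m) = - (MulOpposite.op (extVar k n j * extVar k n i) • m) := by
  rw [D.leftVar_of_mem j hm, map_zsmul, D.leftVar_of_mem i (D.rightVar_mem j (a := d.1) hm),
    smul_smul, smul_smul, Int.negOnePow_sub, ← MulOpposite.op_mul]
  have : ((d.2.negOnePow : ℤ) * ((d.2.negOnePow * Int.negOnePow 1 : ℤˣ) : ℤ)) = -1 := by
    rw [← Units.val_mul, ← mul_assoc, Int.units_mul_self]
    simp
  rw [this, neg_one_zsmul]

theorem DiffMod.d_leftVar (D : DiffMod k w) (i : Fin (n + 1)) (m : D) :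
    D.d (D.leftVar i m) = - D.leftVar i (D.d m) := by
  have : (D.d.restrictScalars k) ∘ₗ D.leftVar i = - (D.leftVar i ∘ₗ D.d.restrictScalars k) := by
    refine linearMap_ext_grading D.isInternal ?_
    rintro ⟨a, j⟩ m hm
    simp only [LinearMap.comp_apply, LinearMap.neg_apply, LinearMap.restrictScalars_apply]
    rw [D.leftVar_of_mem i hm, D.leftVar_of_mem i (D.d_mem a j m hm), map_zsmul, map_smul,
      Int.negOnePow_sub]
    simp
  exact LinearMap.congr_fun this m

/-- The underlying module of `L(D)`: `L(D)_j = ⨁_a S(-a) ⊗ D_(a;j)`, so that the total module is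
`S ⊗ D` and `s ⊗ d` has degree `(b + a; j)` for `s ∈ S_b` and `d ∈ D_(a;j)`. -/
abbrev LMod (D : DiffMod.{u} k w) : GrMod.{max uk u} k w where
  carrier := Poly k n ⊗[k] D
  gr := tensorGr (fun (b : A) (d : A × ℤ) => (b + d.1, d.2))
    (MvPolynomial.weightedHomogeneousSubmodule k w) D.gr
  isInternal := isInternal_tensorGr _
    (MvPolynomial.weightedDecomposition k w).isInternal D.isInternal
  smul_mem := by
    intro b a j p hp m hm
    let μ : Poly k n ⊗[k] D →ₗ[k] Poly k n ⊗[k] D :=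
      (LinearMap.lsmul (Poly k n) (Poly k n ⊗[k] D) p).restrictScalars k
    change m ∈ (tensorGr _ _ _ (b + a, j)).comap μ
    refine tensorGr_le ?_ hm
    rintro c d hcd s hs x hx
    rw [Submodule.mem_comap]
    change p • (s ⊗ₜ[k] x) ∈ _
    rw [TensorProduct.smul_tmul']
    refine tmul_mem_tensorGr _ (i := b + c) (hp.mul hs) hx ?_
    rw [Prod.mk.injEq] at hcd ⊢
    exact ⟨by rw [add_assoc, hcd.1], hcd.2⟩

/-- The `S`-linear endomorphism `∂'` of `L(D)` given by left multiplication by `∑ x_i ⊗ e_i`. -/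
def dPrime (D : DiffMod k w) : Poly k n ⊗[k] D →ₗ[Poly k n] Poly k n ⊗[k] D :=
  ∑ i, (MvPolynomial.X i : Poly k n) • (D.leftVar i).baseChange (Poly k n)

/-- The `S`-linear endomorphism `-∂_D` of `L(D)`, that is `s ⊗ d ↦ - s ⊗ ∂_D(d)`. -/
def dInternal (D : DiffMod k w) : Poly k n ⊗[k] D →ₗ[Poly k n] Poly k n ⊗[k] D :=
  - (D.d.restrictScalars k).baseChange (Poly k n)

theorem dPrime_tmul (D : DiffMod k w) (s : Poly k n) (m : D) :
    dPrime D (s ⊗ₜ[k] m) = ∑ i, (MvPolynomial.X i * s) ⊗ₜ[k] D.leftVar i m := by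
  simp [dPrime, LinearMap.sum_apply, TensorProduct.smul_tmul']

theorem dInternal_tmul (D : DiffMod k w) (s : Poly k n) (m : D) :
    dInternal D (s ⊗ₜ[k] m) = -(s ⊗ₜ[k] D.d m) := by
  simp [dInternal]

theorem LMod.hom_ext {D : DiffMod k w} 
    {f g : Poly k n ⊗[k] D →ₗ[Poly k n] Poly k n ⊗[k] D}
    (h : ∀ d, ∀ m ∈ D.gr d, f (1 ⊗ₜ[k] m) = g (1 ⊗ₜ[k] m)) : f = g := by
  apply TensorProduct.AlgebraTensorModule.curry_injective
  ext : 1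
  exact linearMap_ext_grading D.isInternal h

theorem LMod.isHomogeneousMap {D D' : DiffMod k w} {f : LMod D →ₗ[Poly k n] LMod D'} {r : ℤ}
    (h : ∀ a j, ∀ m ∈ D.gr (a, j), f (1 ⊗ₜ[k] m) ∈ (LMod D').gr (a, j + r)) :
    IsHomogeneousMap f r := by
  intro a j m hm
  change m ∈ ((LMod D').gr (a, j + r)).comap (f.restrictScalars k)
  refine tensorGr_le ?_ hm
  rintro b ⟨a', j'⟩ hd s hs x hx
  rw [Prod.mk.injEq] at hd
  obtain ⟨rfl, rfl⟩ := hd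
  have := (LMod D').smul_mem b a' (j' + r) s hs _ (h a' j' x hx)
  rw [← map_smul, TensorProduct.smul_tmul', smul_eq_mul, mul_one] at this
  exact this

theorem dPrime_homogeneous (D : DiffMod k w) : 
    IsHomogeneousMap (M := LMod D) (N := LMod D) (dPrime D) (-1) := by
  refine LMod.isHomogeneousMap fun a j m hm => ?_
  rw [dPrime_tmul]
  refine Submodule.sum_mem _ fun i _ => ?_
  rw [mul_one]
  refine tmul_mem_tensorGr _ (MvPolynomial.isWeightedHomogeneous_X k w i) (D.leftVar_mem i hm) ?_
  simp [sub_eq_add_neg]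

theorem dInternal_homogeneous (D : DiffMod k w) : 
    IsHomogeneousMap (M := LMod D) (N := LMod D) (dInternal D) (-1) := by
  refine LMod.isHomogeneousMap fun a j m hm => ?_
  rw [dInternal_tmul]
  exact neg_mem (tmul_mem_tensorGr _ (MvPolynomial.isWeightedHomogeneous_one k w)
    (D.d_mem a j m hm) (by simp [sub_eq_add_neg]))

theorem dPrime_dPrime (D : DiffMod k w) : dPrime D ∘ₗ dPrime D = 0 := by
  refine LMod.hom_ext fun d m hm => ?_
  rw [LinearMap.comp_apply, dPrime_tmul, map_sum, LinearMap.zero_apply]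
  simp_rw [dPrime_tmul]
  refine sum_sum_eq_zero_of_antisymm _ (fun i => ?_) fun i j => ?_
  · rw [D.leftVar_leftVar i i hm, extVar_sq]
    simp
  · rw [D.leftVar_leftVar j i hm, D.leftVar_leftVar i j hm, extVar_anticomm i j, mul_left_comm]
    simp [TensorProduct.tmul_neg]

theorem dInternal_dInternal (D : DiffMod k w) : dInternal D ∘ₗ dInternal D = 0 := by
  refine LMod.hom_ext fun d m hm => ?_
  simp [dInternal_tmul, D.d_sq]

theorem dPrime_dInternal (D : DiffMod k w) :
    dPrime D ∘ₗ dInternal D + dInternal D ∘ₗ dPrime D = 0 := by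
  refine LMod.hom_ext fun d m hm => ?_
  simp only [LinearMap.add_apply, LinearMap.comp_apply, dInternal_tmul, dPrime_tmul, map_sum,
    LinearMap.zero_apply, D.d_leftVar, map_neg, TensorProduct.tmul_neg, neg_neg]
  exact neg_add_cancel _

/-- The complex `L(D)`, with differential `s ⊗ d ↦ (∑ x_i s ⊗ e_i d) - s ⊗ ∂_D(d)`. -/
abbrev L (D : DiffMod.{u} k w) : Cpx.{max uk u} k w where
  toGrMod := LMod D
  d := dPrime D + dInternal D
  isDifferential := by
    refine ⟨fun a j m hm => add_mem (dPrime_homogeneous D a j m hm)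
      (dInternal_homogeneous D a j m hm), fun m => ?_⟩
    have h1 := LinearMap.congr_fun (dPrime_dPrime D) m
    have h2 := LinearMap.congr_fun (dInternal_dInternal D) m
    have h3 := LinearMap.congr_fun (dPrime_dInternal D) m
    simp only [LinearMap.comp_apply, LinearMap.zero_apply, LinearMap.add_apply] at h1 h2 h3 ⊢
    rw [map_add, map_add, h1, h2, zero_add, add_zero]
    exact h3

/-- The complex with the same underlying module as `L(D)` and with differential induced by
`-∂_D` only. -/
abbrev Lbar (D : DiffMod.{u} k w) : Cpx.{max uk u} k w where
  toGrMod := LMod D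
  d := dInternal D
  isDifferential := ⟨dInternal_homogeneous D, LinearMap.congr_fun (dInternal_dInternal D)⟩

end FunctorL

section Homology

variable {k : Type uk} [Field k] {n : ℕ} {A : Type uA} [AddCommGroup A] [DecidableEq A]
variable {w : Fin (n + 1) → A}

/-- The underlying `E`-module `ker ∂_D / im ∂_D` of `H(D)`. -/
abbrev DiffMod.HCarrier (D : DiffMod k w) : Type _ :=
  LinearMap.ker D.d ⧸ (LinearMap.range D.d).submoduleOf (LinearMap.ker D.d)

/-- The homology class of a cycle. -/
def DiffMod.cls (D : DiffMod k w) : LinearMap.ker D.d →ₗ[(Ext k n)ᵐᵒᵖ] D.HCarrier :=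
  Submodule.mkQ _

/-- The classes of the cycles of degree `d`. -/
def DiffMod.homologyGr (D : DiffMod k w) (d : A × ℤ) : Submodule k D.HCarrier :=
  ((D.gr d).comap ((LinearMap.ker D.d).subtype.restrictScalars k)).map
    (D.cls.restrictScalars k)

theorem DiffMod.mem_homologyGr (D : DiffMod k w) (d : A × ℤ) (x : D.HCarrier) :
    x ∈ D.homologyGr d ↔ ∃ z : LinearMap.ker D.d, (z : D) ∈ D.gr d ∧ D.cls z = x := Iff.rfl

theorem DiffMod.d_component (D : DiffMod k w) (a : A) (j : ℤ) (m : D) :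
    D.d (component D.isInternal (a, j) m) = component D.isInternal (a, j - 1) (D.d m) := by
  have : (D.d.restrictScalars k) ∘ₗ component D.isInternal (a, j) =
      component D.isInternal (a, j - 1) ∘ₗ (D.d.restrictScalars k) := by
    refine linearMap_ext_grading D.isInternal ?_
    rintro ⟨a', j'⟩ m hm
    have hd := D.d_mem a' j' m hm
    simp only [LinearMap.comp_apply, LinearMap.restrictScalars_apply]
    by_cases h : (a, j) = (a', j')
    · obtain ⟨rfl, rfl⟩ := Prod.mk.inj h
      rw [component_of_mem _ hm, component_of_mem _ hd]
    · rw [component_of_mem_ne _ h hm, component_of_mem_ne _ _ hd, map_zero]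
      simpa using h
  exact LinearMap.congr_fun this m

theorem DiffMod.isInternal_homologyGr (D : DiffMod k w) :
    DirectSum.IsInternal D.homologyGr := by
  have hker : ∀ d, ∀ z : LinearMap.ker D.d, component D.isInternal d (z : D) ∈
      LinearMap.ker D.d := by
    rintro ⟨a, j⟩ z
    rw [LinearMap.mem_ker, D.d_component, LinearMap.mem_ker.1 z.2, map_zero]
  let c : ∀ d, LinearMap.ker D.d →ₗ[k] LinearMap.ker D.d := fun d =>
    { toFun := fun z => ⟨component D.isInternal d z, hker d z⟩
      map_add' := fun x y => by ext; simp
      map_smul' := fun r x => by ext; simp }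
  let B := (LinearMap.range D.d).submoduleOf (LinearMap.ker D.d)
  have hB : ∀ d, B.restrictScalars k ≤
      LinearMap.ker (D.cls.restrictScalars k ∘ₗ c d) := by
    rintro ⟨a, j⟩ z ⟨y, hy⟩
    rw [LinearMap.mem_ker]
    refine (Submodule.Quotient.mk_eq_zero _).2 ?_
    refine ⟨component D.isInternal (a, j + 1) y, ?_⟩
    rw [D.d_component, hy, add_sub_cancel_right]
    rfl
  let pr : ∀ _ : A × ℤ, D.HCarrier →ₗ[k] D.HCarrier := fun d =>
    (B.restrictScalars k).liftQ (D.cls.restrictScalars k ∘ₗ c d) (hB d) ∘ₗ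
      (Submodule.Quotient.restrictScalarsEquiv k B).symm.toLinearMap
  have hpr : ∀ d z, pr d (D.cls z) = D.cls (c d z) := fun d z => rfl
  refine isInternal_of_proj pr ?_ ?_ ?_
  · rintro d _ ⟨z, hz, rfl⟩
    refine (hpr d z).trans (congrArg D.cls (Subtype.ext ?_))
    exact component_of_mem _ hz
  · rintro d d' hd _ ⟨z, hz, rfl⟩
    refine (hpr d z).trans ?_
    rw [← map_zero D.cls]
    exact congrArg D.cls (Subtype.ext (component_of_mem_ne _ hd hz))
  · intro x
    obtain ⟨z, rfl⟩ := Submodule.mkQ_surjective _ x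
    obtain ⟨s, hs⟩ := exists_sum_component D.isInternal (z : D)
    have hz : z = ∑ d ∈ s, c d z := by
      apply Subtype.ext
      rw [AddSubmonoidClass.coe_finsetSum]
      exact hs
    change D.cls z ∈ _
    rw [hz, map_sum]
    refine Submodule.sum_mem _ fun d _ => Submodule.mem_iSup_of_mem d ?_
    exact ⟨c d z, component_mem _ _ _, rfl⟩

/-- The homology `H(D)`, a differential `E`-module with trivial differential. -/
abbrev H (D : DiffMod.{u} k w) : DiffMod.{u} k w where
  carrier := D.HCarrier
  gr := D.homologyGr
  isInternal := D.isInternal_homologyGr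
  smul_mem := by
    rintro d d' _ ⟨z, hz, rfl⟩ e he
    exact ⟨MulOpposite.op e • z, D.smul_mem d d' z hz e he, map_smul D.cls _ _⟩
  d := 0
  d_mem := fun _ _ _ _ => zero_mem _
  d_sq := fun _ => rfl

end Homology

section FunctorR

variable {k : Type uk} [Field k] {n : ℕ} {A : Type uA} [AddCommGroup A] [DecidableEq A]
variable {w : Fin (n + 1) → A}

theorem omegaLeft_of_mem (i : Fin (n + 1)) {d : A × ℤ} {f : Omega k n}
    (hf : f ∈ omegaGr (k := k) w d) : omegaLeft w i f =
      (d.2.negOnePow : ℤ) • omegaAct k n (MulOpposite.op (extVar k n i)) f := by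
  rw [omegaLeft, LinearMap.comp_apply, signOp_of_mem _ Prod.snd hf, map_zsmul]

theorem omegaAct_var_mem (i : Fin (n + 1)) {d : A × ℤ} {f : Omega k n}
    (hf : f ∈ omegaGr (k := k) w d) :
    omegaAct k n (MulOpposite.op (extVar k n i)) f ∈ omegaGr (k := k) w (d.1 - w i, d.2 - 1) := by
  have := omegaAct_mem w hf (extVar_mem_extGr w i)
  obtain ⟨a, j⟩ := d
  rwa [Prod.mk_add_mk, ← sub_eq_add_neg, ← sub_eq_add_neg] at this

theorem omegaLeft_mem (i : Fin (n + 1)) {d : A × ℤ} {f : Omega k n}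
    (hf : f ∈ omegaGr (k := k) w d) :
    omegaLeft w i f ∈ omegaGr (k := k) w (d.1 - w i, d.2 - 1) := by
  rw [omegaLeft_of_mem i hf]
  exact zsmul_mem (omegaAct_var_mem i hf) _

theorem omegaAct_omegaAct (e e' : Ext k n) (f : Omega k n) :
    omegaAct k n (MulOpposite.op e) (omegaAct k n (MulOpposite.op e') f) =
      omegaAct k n (MulOpposite.op (e' * e)) f := by
  rw [MulOpposite.op_mul, map_mul]
  rfl

theorem omegaLeft_omegaLeft (i j : Fin (n + 1)) {d : A × ℤ} {f : Omega k n}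
    (hf : f ∈ omegaGr (k := k) w d) : omegaLeft w i (omegaLeft w j f) =
      - omegaAct k n (MulOpposite.op (extVar k n j * extVar k n i)) f := by
  rw [omegaLeft_of_mem j hf, map_zsmul, omegaLeft_of_mem i (omegaAct_var_mem j hf),
    smul_smul, omegaAct_omegaAct, Int.negOnePow_sub]
  have : ((d.2.negOnePow : ℤ) * ((d.2.negOnePow * Int.negOnePow 1 : ℤˣ) : ℤ)) = -1 := by
    rw [← Units.val_mul, ← mul_assoc, Int.units_mul_self]
    simp
  rw [this, neg_one_zsmul]

/-- Left and right multiplication on `ω_E` commute. -/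
theorem omegaLeft_omegaAct (i : Fin (n + 1)) (e : Ext k n) :
    omegaLeft w i ∘ₗ omegaAct k n (MulOpposite.op e) =
      omegaAct k n (MulOpposite.op e) ∘ₗ omegaLeft w i := by
  induction e using ExteriorAlgebra.induction with
  | algebraMap r =>
    rw [← MulOpposite.algebraMap_apply, AlgHom.commutes]
    ext f : 1
    simp [Module.algebraMap_end_apply]
  | ι v =>
    have hv : ExteriorAlgebra.ι k v = ∑ l, v l • extVar k n l := by
      conv_lhs => rw [pi_eq_sum_univ' v]
      rw [map_sum]
      refine Finset.sum_congr rfl fun l _ => ?_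
      rw [extVar, ← map_smul]
    have hl : ∀ l, omegaLeft w i ∘ₗ omegaAct k n (MulOpposite.op (extVar k n l)) =
        omegaAct k n (MulOpposite.op (extVar k n l)) ∘ₗ omegaLeft w i := by
      intro l
      refine linearMap_ext_grading (isInternal_omegaGr (k := k) w) fun d f hf => ?_
      rw [LinearMap.comp_apply, LinearMap.comp_apply, omegaLeft_of_mem i hf,
        omegaLeft_of_mem i (omegaAct_var_mem l hf), map_zsmul, omegaAct_omegaAct,
        omegaAct_omegaAct, extVar_anticomm, Int.negOnePow_sub]
      simp
    rw [hv, Finset.op_sum, map_sum]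
    ext f : 1
    simp only [LinearMap.comp_apply, LinearMap.sum_apply, map_sum]
    refine Finset.sum_congr rfl fun l _ => ?_
    rw [MulOpposite.op_smul, map_smul, LinearMap.smul_apply, LinearMap.smul_apply, map_smul]
    congr 1
    exact LinearMap.congr_fun (hl l) f
  | mul a b ha hb =>
    ext f : 1
    simp only [LinearMap.comp_apply]
    rw [← omegaAct_omegaAct, ← omegaAct_omegaAct]
    have h1 := LinearMap.congr_fun hb (omegaAct k n (MulOpposite.op a) f)
    have h2 := LinearMap.congr_fun ha f
    simp only [LinearMap.comp_apply] at h1 h2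
    rw [h1, h2]
  | add a b ha hb =>
    rw [MulOpposite.op_add, map_add, LinearMap.comp_add, LinearMap.add_comp, ha, hb]

/-- The differential of `R(C)` on `C ⊗ ω_E`: for `c ∈ C_j`,
`c ⊗ f ↦ (-1) ^ j (∑ x_i c ⊗ e_i f) + ∂_C(c) ⊗ f`. -/
def dR (C : Cpx k w) : C.toGrMod.carrier ⊗[k] Omega k n →ₗ[k] C.toGrMod.carrier ⊗[k] Omega k n :=
  ∑ i, TensorProduct.map (C.toGrMod.mulVar i ∘ₗ C.toGrMod.sign) (omegaLeft w i) +
    TensorProduct.map (C.d.restrictScalars k) LinearMap.id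

theorem dR_tmul (C : Cpx k w) {a : A} {j : ℤ} {c : C.toGrMod.carrier}
    (hc : c ∈ C.toGrMod.gr (a, j)) (f : Omega k n) :
    dR C (c ⊗ₜ[k] f) = (j.negOnePow : ℤ) •
      (∑ i, ((MvPolynomial.X i : Poly k n) • c) ⊗ₜ[k] omegaLeft w i f) + C.d c ⊗ₜ[k] f := by
  simp only [dR, LinearMap.add_apply, LinearMap.sum_apply, TensorProduct.map_tmul,
    LinearMap.comp_apply, GrMod.sign, signOp_of_mem _ Prod.snd hc, Finset.smul_sum,
    LinearMap.restrictScalars_apply, LinearMap.id_apply, map_zsmul]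
  congr 1

theorem dR_mem (C : Cpx k w) (a : A) (j : ℤ) {m : C.toGrMod.carrier ⊗[k] Omega k n}
    (hm : m ∈ tensorGr (fun d d' : A × ℤ => d + d') C.toGrMod.gr (omegaGr (k := k) w) (a, j)) :
    dR C m ∈ tensorGr (fun d d' : A × ℤ => d + d') C.toGrMod.gr (omegaGr (k := k) w)
      (a, j - 1) := by
  change m ∈ (tensorGr _ _ _ _).comap (dR C)
  refine tensorGr_le ?_ hm
  rintro ⟨a', j'⟩ ⟨b, p⟩ hd c hc f hf
  rw [Prod.mk_add_mk, Prod.mk.injEq] at hd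
  obtain ⟨rfl, rfl⟩ := hd
  rw [Submodule.mem_comap, dR_tmul C hc]
  refine add_mem (zsmul_mem (Submodule.sum_mem _ fun i _ => ?_) _) ?_
  · refine tmul_mem_tensorGr _ (C.toGrMod.X_smul_mem i hc) (omegaLeft_mem i hf) ?_
    ext
    · simp only [Prod.mk_add_mk]
      abel
    · simp only [Prod.mk_add_mk]
      ring
  · refine tmul_mem_tensorGr _ (C.isDifferential.homogeneous a' j' c hc) hf ?_
    ext
    · rfl
    · simp only [Prod.mk_add_mk]
      ring

theorem tensor_ext (M : GrMod k w) {N : Type*} [AddCommGroup N] [Module k N]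
    {f g : M ⊗[k] Omega k n →ₗ[k] N}
    (h : ∀ d, ∀ c ∈ M.gr d, ∀ d', ∀ y ∈ omegaGr (k := k) w d', f (c ⊗ₜ y) = g (c ⊗ₜ y)) :
    f = g := by
  apply TensorProduct.ext
  refine linearMap_ext_grading M.isInternal fun d c hc => ?_
  exact linearMap_ext_grading (isInternal_omegaGr (k := k) w) fun d' y hy => h d c hc d' y hy

theorem dR_dR (C : Cpx k w) : dR C ∘ₗ dR C = 0 := by
  refine tensor_ext C.toGrMod ?_
  rintro ⟨a, j⟩ c hc d' f hf
  rw [LinearMap.comp_apply, dR_tmul C hc, map_add, map_zsmul, map_sum,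
    dR_tmul C (C.isDifferential.homogeneous a j c hc), C.isDifferential.sq c,
    TensorProduct.zero_tmul, add_zero, LinearMap.zero_apply]
  simp_rw [dR_tmul C (C.toGrMod.X_smul_mem _ hc)]
  rw [Finset.sum_add_distrib, ← Finset.smul_sum, sum_sum_eq_zero_of_antisymm, smul_zero, zero_add]
  · simp_rw [map_smul]
    rw [← sub_eq_add_neg, Int.negOnePow_sub]
    simp
  · intro i
    rw [omegaLeft_omegaLeft i i hf, extVar_sq]
    simp
  · intro i l
    rw [omegaLeft_omegaLeft l i hf, omegaLeft_omegaLeft i l hf, extVar_anticomm i l, smul_smul,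
      smul_smul, mul_comm]
    simp [TensorProduct.tmul_neg]

/-- The right action of `E` on `C ⊗ ω_E`, through the second factor. -/
def RAct (M : GrMod k w) : (Ext k n)ᵐᵒᵖ →ₐ[k] Module.End k (M ⊗[k] Omega k n) :=
  (Module.End.lTensorAlgHom k (Omega k n) M).comp (omegaAct k n)

theorem RAct_tmul (M : GrMod k w) (e : (Ext k n)ᵐᵒᵖ) (c : M) (f : Omega k n) :
    RAct M e (c ⊗ₜ[k] f) = c ⊗ₜ[k] omegaAct k n e f := rfl

/-- The functor `R`: the underlying `E`-module of `R(C)` is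
`⨁_j ⨁_a (C_j)_a ⊗ ω_E(-a; -j)`, so that the total module is `C ⊗ ω_E`, and `c ⊗ f` has degree
`(a; j) + deg f` for `c ∈ (C_j)_a`. -/
abbrev R (C : Cpx.{u} k w) : DiffMod.{max uk u} k w :=
  letI : Module (Ext k n)ᵐᵒᵖ (C.toGrMod.carrier ⊗[k] Omega k n) :=
    Module.compHom _ (RAct C.toGrMod).toRingHom
  { carrier := C.toGrMod.carrier ⊗[k] Omega k n
    tower := ⟨fun r e m => by
      change RAct C.toGrMod (r • e) m = r • RAct C.toGrMod e m
      rw [map_smul, LinearMap.smul_apply]⟩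
    gr := tensorGr (fun d d' : A × ℤ => d + d') C.toGrMod.gr (omegaGr (k := k) w)
    isInternal := isInternal_tensorGr _ C.toGrMod.isInternal (isInternal_omegaGr w)
    smul_mem := by
      intro d d' m hm e he
      change RAct C.toGrMod (MulOpposite.op e) m ∈ _
      change m ∈ (tensorGr _ _ _ _).comap (RAct C.toGrMod (MulOpposite.op e))
      refine tensorGr_le ?_ hm
      rintro d₁ d₂ rfl c hc f hf
      exact tmul_mem_tensorGr _ hc (omegaAct_mem w hf he) (add_assoc _ _ _).symm
    d :=
      { toFun := dR C
        map_add' := map_add _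
        map_smul' := by
          intro e m
          change dR C (RAct C.toGrMod e m) = RAct C.toGrMod e (dR C m)
          have : dR C ∘ₗ RAct C.toGrMod e = RAct C.toGrMod e ∘ₗ dR C := by
            refine tensor_ext C.toGrMod ?_
            rintro ⟨a, j⟩ c hc d' f hf
            rw [LinearMap.comp_apply, LinearMap.comp_apply, RAct_tmul, dR_tmul C hc,
              dR_tmul C hc, map_add, map_zsmul, map_sum]
            congr 2
            refine Finset.sum_congr rfl fun i _ => ?_
            rw [RAct_tmul]
            congr 1
            exact LinearMap.congr_fun (omegaLeft_omegaAct i e.unop) f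
          exact LinearMap.congr_fun this m }
    d_mem := fun a j m hm => dR_mem C a j hm
    d_sq := LinearMap.congr_fun (dR_dR C) }

end FunctorR

section Resolutions

universe u₁ u₂

variable {k : Type uk} [Field k] {n : ℕ} {A : Type uA} [AddCommGroup A] [DecidableEq A]
variable {w : Fin (n + 1) → A}

/-- `θ` makes the grading of `S` with `deg x_i = w i` positive: `θ(deg x_i) > 0` for all `i`. (The
condition `S_0 = k` is then automatic.) -/
def IsPositive (w : Fin (n + 1) → A) (θ : A →+ ℤ) : Prop := ∀ i, 0 < θ (w i)

/-- The term `M_j`. -/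
def GrMod.term (M : GrMod.{u} k w) (j : ℤ) : Submodule k M := ⨆ a, M.gr (a, j)

/-- The terms `M_j` are bounded below in `A`-degrees: for some `θ : A → ℤ` that makes the grading
of `S` positive, each `M_j` is bounded below in the `ℤ`-grading induced by `θ`. -/
def GrMod.TermsBoundedBelow (M : GrMod.{u} k w) : Prop :=
  ∃ θ : A →+ ℤ, IsPositive w θ ∧ ∀ j : ℤ, ∃ N : ℤ, ∀ a, θ a < N → M.gr (a, j) = ⊥

/-- `H_j(C) = 0` for all `j ≪ 0`. -/
def Cpx.HomologicallyBoundedBelow (C : Cpx.{u} k w) : Prop :=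
  ∃ m : ℤ, ∀ j < m, ∀ x ∈ C.toGrMod.term j, C.d x = 0 → ∃ y ∈ C.toGrMod.term (j + 1), C.d y = x

/-- A quasi-isomorphism: a morphism of complexes of `A`-graded `S`-modules that is injective and
surjective on homology. -/
structure IsQuasiIso {C : Cpx.{u₁} k w} {C' : Cpx.{u₂} k w}
    (φ : C.toGrMod →ₗ[Poly k n] C'.toGrMod) : Prop where
  homogeneous : IsHomogeneousMap φ 0
  comm : ∀ x, φ (C.d x) = C'.d (φ x)
  injective : ∀ x, C.d x = 0 → φ x ∈ LinearMap.range C'.d → x ∈ LinearMap.range C.d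
  surjective : ∀ y, C'.d y = 0 → ∃ x, C.d x = 0 ∧ y - φ x ∈ LinearMap.range C'.d

/-- The basis `b` consists of homogeneous elements. -/
def IsHomogeneousBasis {M : GrMod.{u} k w} {I : Type u₁} (b : Module.Basis I (Poly k n) M) :
    Prop :=
  ∀ i, ∃ d, b i ∈ M.gr d

/-- `M` is a free graded module: it has a homogeneous basis. -/
def GrMod.IsGradedFree (M : GrMod.{u} k w) : Prop :=
  ∃ (I : Type u) (b : Module.Basis I (Poly k n) M), IsHomogeneousBasis b

/-- `C` is minimal: `∂(C) ⊆ (x_0, …, x_n) C`. -/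
def Cpx.IsMinimal (C : Cpx.{u} k w) : Prop :=
  ∀ x, C.d x ∈ Ideal.span (Set.range (MvPolynomial.X : Fin (n + 1) → Poly k n)) •
    (⊤ : Submodule (Poly k n) C.toGrMod)

/-- `F` is a minimal free resolution of `G`: a minimal, homologically bounded below complex of
free `A`-graded `S`-modules with terms bounded below in `A`-degrees, that has a quasi-isomorphism
to `G`. -/
structure IsMinimalFreeResolution (F : Cpx.{u₁} k w) (G : Cpx.{u₂} k w) : Prop where
  free : F.toGrMod.IsGradedFree
  minimal : F.IsMinimal
  homologicallyBoundedBelow : F.HomologicallyBoundedBelow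
  termsBoundedBelow : F.toGrMod.TermsBoundedBelow
  quasiIso : ∃ φ : F.toGrMod →ₗ[Poly k n] G.toGrMod, IsQuasiIso φ

/-- With respect to the bases `b` and `b'`, the matrix of `f` has entries that are `k`-linear
combinations of the variables. -/
def HasLinearEntries {P Q : GrMod.{u} k w} {I J : Type u} (b : Module.Basis I (Poly k n) P)
    (b' : Module.Basis J (Poly k n) Q) (f : P →ₗ[Poly k n] Q) : Prop :=
  ∀ i j, b'.repr (f (b i)) j ∈
    Submodule.span k (Set.range (MvPolynomial.X : Fin (n + 1) → Poly k n))

/-- A strongly linear map of free graded modules. Maps that shift the homological degree are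
allowed, so that this applies to the components `P_j → Q_{j+r}`. -/
def IsStronglyLinear {P Q : GrMod.{u} k w} (f : P →ₗ[Poly k n] Q) : Prop :=
  (∃ r, IsHomogeneousMap f r) ∧ ∃ (I J : Type u) (b : Module.Basis I (Poly k n) P)
    (b' : Module.Basis J (Poly k n) Q), IsHomogeneousBasis b ∧ IsHomogeneousBasis b' ∧
      HasLinearEntries b b' f

/-- `f` is an `i`-fold composition of strongly linear maps (`i ≥ 1`). -/
inductive IsStronglyLinearComp : ℕ → ∀ {P Q : GrMod.{u} k w}, (P →ₗ[Poly k n] Q) → Prop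
  | single {P Q : GrMod.{u} k w} (f : P →ₗ[Poly k n] Q) :
      IsStronglyLinear f → IsStronglyLinearComp 1 f
  | comp {i : ℕ} {P Q T : GrMod.{u} k w} (f : P →ₗ[Poly k n] Q) (g : Q →ₗ[Poly k n] T) :
      IsStronglyLinearComp i f → IsStronglyLinear g → IsStronglyLinearComp (i + 1) (g ∘ₗ f)

/-- `f` is an `i`-fold composition of maps of free graded modules (`i ≥ 1`), where the source of
`f`, its target and the intermediate modules have homogeneous bases, `b` and `b'` in the case of
the source and the target, in which all the maps have matrices whose entries are `k`-linear
combinations of the variables. -/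
inductive IsLinearChain : ℕ → ∀ {P Q : GrMod.{u} k w} {I J : Type u},
    Module.Basis I (Poly k n) P → Module.Basis J (Poly k n) Q → (P →ₗ[Poly k n] Q) → Prop
  | single {P Q : GrMod.{u} k w} {I J : Type u} (b : Module.Basis I (Poly k n) P)
      (b' : Module.Basis J (Poly k n) Q) (f : P →ₗ[Poly k n] Q) :
      IsHomogeneousBasis b → IsHomogeneousBasis b' → (∃ r, IsHomogeneousMap f r) →
      HasLinearEntries b b' f → IsLinearChain 1 b b' f
  | comp {i : ℕ} {P Q T : GrMod.{u} k w} {I J K : Type u} (b : Module.Basis I (Poly k n) P)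
      (b' : Module.Basis J (Poly k n) Q) (b'' : Module.Basis K (Poly k n) T)
      (f : P →ₗ[Poly k n] Q) (g : Q →ₗ[Poly k n] T) :
      IsLinearChain i b b' f → IsHomogeneousBasis b'' → (∃ r, IsHomogeneousMap g r) →
      HasLinearEntries b' b'' g → IsLinearChain (i + 1) b b'' (g ∘ₗ f)

/-- A contraction of the complex `C` onto the complex `C'`. -/
structure Contraction (C : Cpx.{u₁} k w) (C' : Cpx.{u₂} k w) where
  π : C.toGrMod →ₗ[Poly k n] C'.toGrMod
  ι : C'.toGrMod →ₗ[Poly k n] C.toGrMod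
  h : C.toGrMod →ₗ[Poly k n] C.toGrMod
  π_homogeneous : IsHomogeneousMap π 0
  ι_homogeneous : IsHomogeneousMap ι 0
  h_homogeneous : IsHomogeneousMap h 1
  π_comm : ∀ x, π (C.d x) = C'.d (π x)
  ι_comm : ∀ x, ι (C'.d x) = C.d (ι x)
  π_ι : ∀ x, π (ι x) = x
  homotopy : ∀ x, x - ι (π x) = C.d (h x) + h (C.d x)
  π_h : ∀ x, π (h x) = 0
  h_ι : ∀ x, h (ι x) = 0
  h_h : ∀ x, h (h x) = 0

variable {D : DiffMod.{u} k w}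

/-- The contraction is compatible with the identification `H(Lbar(D)) = S ⊗ H(D) = L(H(D))`: the
map `π` sends `1 ⊗ z` to `1 ⊗ [z]` for each cycle `z` of `D`. (Then `ι` is compatible with it too,
since `π ∘ ι = id`.) -/
def Contraction.IsCanonical (c : Contraction (Lbar D) (Lbar (H D))) : Prop :=
  ∀ z : LinearMap.ker D.d, c.π ((1 : Poly k n) ⊗ₜ[k] (z : D)) = (1 : Poly k n) ⊗ₜ[k] D.cls z

/-- The contraction is obtained from `k`-linear maps by extension of scalars from `k` to `S`. -/
def Contraction.IsExtended (c : Contraction (Lbar D) (Lbar (H D))) : Prop :=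
  ∃ (π₀ : D →ₗ[k] H D) (ι₀ : H D →ₗ[k] D) (h₀ : D →ₗ[k] D),
    c.π = π₀.baseChange (Poly k n) ∧ c.ι = ι₀.baseChange (Poly k n) ∧
      c.h = h₀.baseChange (Poly k n)

/-- `δ_i = (-1) ^ (i - 1) π (∂' h) ^ (i - 1) ∂' ι`, for `i ≥ 1`. -/
def Contraction.delta (c : Contraction (Lbar D) (Lbar (H D))) (i : ℕ) :
    LMod (H D) →ₗ[Poly k n] LMod (H D) :=
  (-1 : ℤ) ^ (i - 1) •
    (c.π ∘ₗ ((dPrime D ∘ₗ c.h) ^ (i - 1) : Module.End (Poly k n) (LMod D)) ∘ₗ dPrime D ∘ₗ c.ι)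

end Resolutions

end

end MultigradedBGG

open MultigradedBGG

/-!
Passing from `L̄R(G)` to `LR(G)` perturbs the differential `-∂_R` by `∂' = ∑ x_i ⊗ e_i`. Since the
Koszul dual of the exterior algebra is positively graded, `∂' h` lowers the `θ`-degree of the
generators of `LR(G)`, which is bounded below; so `∂' h` is locally nilpotent, and the homological
perturbation lemma transfers `LR(G)` onto `S ⊗ H(R(G))` with the differential `∑ δ_i`, in which
`δ_1` is the differential of `L(H(R(G)))` because `π` is canonical. Every `δ_i` factors through
`∂'`, whence minimality.

The resolution is the composite of this transfer with the counit `LR(G) → G`. The latter is a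
quasi-isomorphism because `LR(G)` is the Koszul complex of the elements `x_i ⊗ 1 - 1 ⊗ x_i` on
`S ⊗ G`: a shearing automorphism turns them into `x_i ⊗ 1`, and division by `x_i` gives a
contracting homotopy for one variable at a time.

Strong linearity comes from factoring `∂'` as multiplication by the variables between
`⨁ P(±deg x_i)` and `P`; the maps in between, which need not be linear, are absorbed into changes
of homogeneous bases.
-/

namespace MultigradedBGG

universe u uk uA

noncomputable section

section LocallyNilpotent

variable {R M : Type*} [Ring R] [AddCommGroup M] [Module R M]

/-- Every element is killed by some power of `f`. This is the finiteness condition under which the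
geometric series of `f` makes sense. -/
def IsLocallyNilpotent (f : Module.End R M) : Prop := ∀ x, ∃ m : ℕ, (f ^ m) x = 0

variable {f : Module.End R M}

theorem isLocallyNilpotent_of_iSup_eq_top {ι : Sort*} {F : ι → Submodule R M} (hF : ⨆ i, F i = ⊤)
    (h : ∀ i, ∀ x ∈ F i, ∃ m : ℕ, (f ^ m) x = 0) : IsLocallyNilpotent f := by
  intro x
  refine Submodule.iSup_induction F (motive := fun x => ∃ m : ℕ, (f ^ m) x = 0)
    (hF ▸ Submodule.mem_top : x ∈ ⨆ i, F i) h ⟨0, map_zero _⟩ ?_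
  rintro x y ⟨l, hl⟩ ⟨m, hm⟩
  refine ⟨max l m, ?_⟩
  rw [map_add, Module.End.pow_map_zero_of_le (le_max_left l m) hl,
    Module.End.pow_map_zero_of_le (le_max_right l m) hm, add_zero]

theorem IsLocallyNilpotent.neg (hf : IsLocallyNilpotent f) : IsLocallyNilpotent (-f) := by
  intro x
  obtain ⟨m, hm⟩ := hf x
  exact ⟨m, by rw [neg_pow, Module.End.mul_apply, hm, map_zero]⟩

theorem neg_pow_apply (f : Module.End R M) (i : ℕ) (x : M) :
    ((-f) ^ i) x = (-1 : ℤ) ^ i • (f ^ i) x := by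
  rw [← neg_one_zsmul, smul_pow, LinearMap.smul_apply]

theorem finsum_pow_apply_eq_sum {x : M} {m : ℕ} (h : (f ^ m) x = 0) :
    ∑ᶠ i : ℕ, (f ^ i) x = (∑ i ∈ Finset.range m, f ^ i) x := by
  rw [LinearMap.sum_apply]
  refine finsum_eq_sum_of_support_subset _ fun i hi => ?_
  rw [Finset.coe_range, Set.mem_Iio]
  by_contra! hmi
  exact hi (Module.End.pow_map_zero_of_le hmi h)

/-- The geometric series `∑ f ^ i` of a locally nilpotent endomorphism `f`, the inverse of
`1 - f`. -/
def geomSeries (f : Module.End R M) (hf : IsLocallyNilpotent f) : Module.End R M where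
  toFun x := ∑ᶠ i : ℕ, (f ^ i) x
  map_add' x y := by
    obtain ⟨l, hl⟩ := hf x
    obtain ⟨m, hm⟩ := hf y
    have hx := Module.End.pow_map_zero_of_le (le_max_left l m) hl
    have hy := Module.End.pow_map_zero_of_le (le_max_right l m) hm
    have hxy : (f ^ max l m) (x + y) = 0 := by rw [map_add, hx, hy, add_zero]
    rw [finsum_pow_apply_eq_sum hx, finsum_pow_apply_eq_sum hy, finsum_pow_apply_eq_sum hxy,
      map_add]
  map_smul' r x := by
    obtain ⟨m, hm⟩ := hf x
    have hrx : (f ^ m) (r • x) = 0 := by rw [map_smul, hm, smul_zero]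
    rw [finsum_pow_apply_eq_sum hm, finsum_pow_apply_eq_sum hrx, map_smul, RingHom.id_apply]

variable (hf : IsLocallyNilpotent f)

theorem geomSeries_apply_eq_sum {x : M} {m : ℕ} (h : (f ^ m) x = 0) :
    geomSeries f hf x = (∑ i ∈ Finset.range m, f ^ i) x :=
  finsum_pow_apply_eq_sum h

theorem one_sub_mul_geomSeries : (1 - f) * geomSeries f hf = 1 := by
  ext x
  obtain ⟨m, hm⟩ := hf x
  rw [Module.End.mul_apply, geomSeries_apply_eq_sum hf hm, ← Module.End.mul_apply,
    mul_neg_geom_sum, LinearMap.sub_apply, hm, sub_zero]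

theorem geomSeries_mul_one_sub : geomSeries f hf * (1 - f) = 1 := by
  ext x
  obtain ⟨m, hm⟩ := hf x
  have hm' : (f ^ m) ((1 - f) x) = 0 := by
    rw [← Module.End.mul_apply, ((Commute.one_right _).sub_right (Commute.pow_self f m)).eq,
      Module.End.mul_apply, hm, map_zero]
  rw [Module.End.mul_apply, geomSeries_apply_eq_sum hf hm', ← Module.End.mul_apply,
    geom_sum_mul_neg, LinearMap.sub_apply, hm, sub_zero]

theorem geomSeries_neg_add_apply (x : M) :
    geomSeries (-f) hf.neg x + f (geomSeries (-f) hf.neg x) = x := by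
  have mul_geomSeries := LinearMap.congr_fun (one_sub_mul_geomSeries hf.neg) x
  rwa [sub_neg_eq_add] at mul_geomSeries

theorem geomSeries_neg_apply_add (x : M) :
    geomSeries (-f) hf.neg x + geomSeries (-f) hf.neg (f x) = x := by
  have geomSeries_mul := LinearMap.congr_fun (geomSeries_mul_one_sub hf.neg) x
  rwa [sub_neg_eq_add, Module.End.mul_apply, LinearMap.add_apply, map_add] at geomSeries_mul

theorem geomSeries_mem {p : AddSubmonoid M} (hp : ∀ x ∈ p, f x ∈ p) {x : M} (hx : x ∈ p) :
    geomSeries f hf x ∈ p := by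
  have pow_mem : ∀ i : ℕ, (f ^ i) x ∈ p := by
    intro i
    induction i with
    | zero => exact hx
    | succ i ih =>
      rw [pow_succ', Module.End.mul_apply]
      exact hp _ ih
  obtain ⟨m, hm⟩ := hf x
  rw [geomSeries_apply_eq_sum hf hm, LinearMap.sum_apply]
  exact sum_mem fun i _ => pow_mem i

end LocallyNilpotent

section PerturbationLemma

variable {R M N : Type*} [Ring R] [AddCommGroup M] [Module R M] [AddCommGroup N] [Module R N]

/-- The data of the homological perturbation lemma: a contraction `(π, ι, h)` of `(M, d)` onto
`(N, d')`, a perturbation `t` of `d`, and `T = (1 + t h)⁻¹ t`, which is encoded by the two equations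
`T + t h T = t = T + T h t`. -/
structure IsPerturbation (d t h T : M →ₗ[R] M) (d' : N →ₗ[R] N) (π : M →ₗ[R] N) (ι : N →ₗ[R] M) :
    Prop where
  perturbed_sq : ∀ x, t (t x) + d (t x) + t (d x) = 0
  d'_d' : ∀ y, d' (d' y) = 0
  π_d : ∀ x, π (d x) = d' (π x)
  ι_d' : ∀ y, ι (d' y) = d (ι y)
  π_ι : ∀ y, π (ι y) = y
  homotopy : ∀ x, x - ι (π x) = d (h x) + h (d x)
  π_h : ∀ x, π (h x) = 0
  h_ι : ∀ y, h (ι y) = 0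
  h_h : ∀ x, h (h x) = 0
  T_add_t_h_T : ∀ x, T x + t (h (T x)) = t x
  T_add_T_h_t : ∀ x, T x + T (h (t x)) = t x

namespace IsPerturbation

variable {d t h T : M →ₗ[R] M} {d' : N →ₗ[R] N} {π : M →ₗ[R] N} {ι : N →ₗ[R] M}

theorem one_add_t_h_injective (P : IsPerturbation d t h T d' π ι) {x : M}
    (hx : x + t (h x) = 0) : x = 0 := by
  have hT : T (h x) + T (h (t (h x))) = 0 := by rw [← map_add, ← map_add, hx, map_zero, map_zero]
  rwa [← P.T_add_T_h_t, hT, add_zero] at hx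

theorem one_add_h_t_surjective (P : IsPerturbation d t h T d' π ι) (x : M) :
    ∃ y, y + h (t y) = x := by
  refine ⟨x - h (T x), ?_⟩
  rw [map_sub, map_sub, ← P.T_add_t_h_T x, map_add]
  abel

theorem maurerCartan (P : IsPerturbation d t h T d' π ι) (x : M) :
    T (ι (π (T x))) + d (T x) + T (d x) = 0 := by
  -- Both `1 + t h` on the left and `1 + h t` on the right turn `T` into `t`.
  obtain ⟨y, rfl⟩ := P.one_add_h_t_surjective x
  have T_y : T (y + h (t y)) = t y := by rw [map_add, P.T_add_T_h_t]
  apply P.one_add_t_h_injective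
  have T_ιπ := P.T_add_t_h_T (ι (π (t y)))
  have T_d := P.T_add_t_h_T (d (y + h (t y)))
  have t_homotopy := congrArg t (P.homotopy (t y))
  rw [T_y]
  simp only [map_add, map_sub] at T_ιπ T_d t_homotopy ⊢
  linear_combination (norm := abel) T_ιπ + T_d + P.perturbed_sq y - t_homotopy

theorem perturbedDiff_sq (P : IsPerturbation d t h T d' π ι) (y : N) :
    (d' + π ∘ₗ T ∘ₗ ι) ((d' + π ∘ₗ T ∘ₗ ι) y) = 0 := by
  have mc := congrArg π (P.maurerCartan (ι y))
  simp only [LinearMap.add_apply, LinearMap.comp_apply, map_add, P.π_d, P.ι_d', P.d'_d',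
    map_zero] at mc ⊢
  linear_combination (norm := abel) mc

theorem perturbedInclusion_comm (P : IsPerturbation d t h T d' π ι) (y : N) :
    (ι - h ∘ₗ T ∘ₗ ι) ((d' + π ∘ₗ T ∘ₗ ι) y) = (d + t) ((ι - h ∘ₗ T ∘ₗ ι) y) := by
  have mc := congrArg h (P.maurerCartan (ι y))
  have homotopy := P.homotopy (T (ι y))
  have T_ι := P.T_add_t_h_T (ι y)
  simp only [LinearMap.add_apply, LinearMap.sub_apply, LinearMap.comp_apply, map_sub, map_add,
    P.ι_d', map_zero] at mc homotopy T_ι ⊢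
  linear_combination (norm := abel) T_ι - homotopy - mc

theorem perturbedProjection_comm (P : IsPerturbation d t h T d' π ι) (x : M) :
    (π - π ∘ₗ T ∘ₗ h) ((d + t) x) = (d' + π ∘ₗ T ∘ₗ ι) ((π - π ∘ₗ T ∘ₗ h) x) := by
  have mc := congrArg π (P.maurerCartan (h x))
  have homotopy := congrArg (fun y => π (T y)) (P.homotopy x)
  have π_T := congrArg π (P.T_add_T_h_t x)
  simp only [LinearMap.add_apply, LinearMap.sub_apply, LinearMap.comp_apply, map_sub, map_add,
    P.π_d, map_zero] at mc homotopy π_T ⊢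
  linear_combination (norm := abel) homotopy - π_T + mc

theorem perturbedProjection_perturbedInclusion (P : IsPerturbation d t h T d' π ι) (y : N) :
    (π - π ∘ₗ T ∘ₗ h) ((ι - h ∘ₗ T ∘ₗ ι) y) = y := by
  simp [P.π_h, P.h_ι, P.h_h, P.π_ι]

theorem perturbedHomotopy (P : IsPerturbation d t h T d' π ι) (x : M) :
    x - (ι - h ∘ₗ T ∘ₗ ι) ((π - π ∘ₗ T ∘ₗ h) x) =
      (d + t) ((h - h ∘ₗ T ∘ₗ h) x) + (h - h ∘ₗ T ∘ₗ h) ((d + t) x) := by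
  have homotopy := P.homotopy x
  have homotopy_T := P.homotopy (T (h x))
  have h_T_homotopy := congrArg (fun y => h (T y)) (P.homotopy x)
  have mc := congrArg h (P.maurerCartan (h x))
  have T_h := P.T_add_t_h_T (h x)
  have h_T := congrArg h (P.T_add_T_h_t x)
  simp only [LinearMap.add_apply, LinearMap.sub_apply, LinearMap.comp_apply, map_sub, map_add,
    map_zero] at homotopy homotopy_T h_T_homotopy mc T_h h_T ⊢
  linear_combination (norm := abel) homotopy - homotopy_T - h_T_homotopy - mc + T_h + h_T

end IsPerturbation

end PerturbationLemma

section Bounds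

variable {k : Type uk} [Field k] {n : ℕ} {A : Type uA} [AddCommGroup A]
variable {w : Fin (n + 1) → A} {θ : A →+ ℤ}

theorem nonneg_of_mem_weightedHomogeneousSubmodule (hθ : IsPositive w θ) {b : A} {s : Poly k n}
    (hs : s ∈ MvPolynomial.weightedHomogeneousSubmodule k w b) (hs0 : s ≠ 0) : 0 ≤ θ b := by
  obtain ⟨m, hm⟩ := MvPolynomial.ne_zero_iff.1 hs0
  rw [← hs hm, Finsupp.weight_apply, Finsupp.sum, map_sum]
  refine Finset.sum_nonneg fun i _ => ?_
  rw [map_nsmul]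
  exact nsmul_nonneg (hθ i).le _

theorem exists_list_of_extGr_ne_bot {d : A × ℤ} (hd : extGr (k := k) w d ≠ ⊥) :
    ∃ v : List (Fin (n + 1)), (v.map fun i => (-w i, (-1 : ℤ))).sum = d := by
  by_contra! h
  exact hd (Submodule.span_eq_bot.2 fun _ ⟨v, hv, _⟩ => absurd hv (h v))

theorem snd_nonpos_of_extGr_ne_bot {d : A × ℤ} (hd : extGr (k := k) w d ≠ ⊥) : d.2 ≤ 0 := by
  obtain ⟨v, rfl⟩ := exists_list_of_extGr_ne_bot hd
  change AddMonoidHom.snd A ℤ _ ≤ 0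
  rw [map_list_sum]
  exact (List.sum_le_card_nsmul _ 0 (by simp)).trans_eq (smul_zero _)

theorem apply_fst_nonpos_of_extGr_ne_bot (hθ : IsPositive w θ) {d : A × ℤ}
    (hd : extGr (k := k) w d ≠ ⊥) : θ d.1 ≤ 0 := by
  obtain ⟨v, rfl⟩ := exists_list_of_extGr_ne_bot hd
  change θ.comp (AddMonoidHom.fst A ℤ) _ ≤ 0
  rw [map_list_sum]
  exact (List.sum_le_card_nsmul _ 0 (by simp [fun i => (hθ i).le])).trans_eq (smul_zero _)

theorem extGr_neg_ne_bot {d : A × ℤ} (hd : omegaGr (k := k) w d ≠ ⊥) :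
    extGr (k := k) w (-d) ≠ ⊥ := by
  classical
  refine fun h => hd ((Submodule.eq_bot_iff _).2 fun f hf => ?_)
  refine linearMap_ext_grading (isInternal_extGr (k := k) w) fun d' y hy => ?_
  by_cases hd' : d' = -d
  · rw [hd', h, Submodule.mem_bot] at hy
    rw [hy, map_zero, map_zero]
  · exact hf d' hd' y hy

theorem snd_nonneg_of_omegaGr_ne_bot {d : A × ℤ} (hd : omegaGr (k := k) w d ≠ ⊥) : 0 ≤ d.2 :=
  neg_nonpos.1 (snd_nonpos_of_extGr_ne_bot (extGr_neg_ne_bot hd))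

theorem apply_fst_nonneg_of_omegaGr_ne_bot (hθ : IsPositive w θ) {d : A × ℤ}
    (hd : omegaGr (k := k) w d ≠ ⊥) : 0 ≤ θ d.1 := by
  have h := apply_fst_nonpos_of_extGr_ne_bot hθ (extGr_neg_ne_bot hd)
  rwa [Prod.fst_neg, map_neg, neg_nonpos] at h

theorem finite_omegaGr_ne_bot (w : Fin (n + 1) → A) : {d | omegaGr (k := k) w d ≠ ⊥}.Finite := by
  classical
  have finite_extGr : {d | extGr (k := k) w d ≠ ⊥}.Finite :=
    WellFoundedGT.finite_ne_bot_of_iSupIndep (isInternal_extGr w).submodule_iSupIndep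
  exact (finite_extGr.preimage neg_injective.injOn).subset fun d hd => extGr_neg_ne_bot hd

/-- Each of the `A`-graded modules `⨁ₐ gr (a, j)` is bounded below in the `ℤ`-grading induced by
`θ`. -/
def IsBoundedBelow {M : Type*} [AddCommGroup M] [Module k M] (θ : A →+ ℤ)
    (gr : A × ℤ → Submodule k M) : Prop :=
  ∀ j : ℤ, ∃ N : ℤ, ∀ a, θ a < N → gr (a, j) = ⊥

variable [DecidableEq A]

theorem R_gr_eq_bot (G : Cpx.{u} k w) {d : A × ℤ}
    (h : ∀ q, omegaGr (k := k) w q ≠ ⊥ → G.toGrMod.gr (d - q) = ⊥) : (R G).gr d = ⊥ := by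
  refine eq_bot_iff.2 (tensorGr_le ?_)
  rintro p q rfl m hm f hf
  rw [Submodule.mem_bot]
  by_cases hq : omegaGr (k := k) w q = ⊥
  · rw [hq, Submodule.mem_bot] at hf
    rw [hf, TensorProduct.tmul_zero]
  · have hp := h q hq
    rw [add_sub_cancel_right] at hp
    rw [hp, Submodule.mem_bot] at hm
    rw [hm, TensorProduct.zero_tmul]

theorem H_gr_eq_bot (D : DiffMod.{u} k w) {d : A × ℤ} (h : D.gr d = ⊥) : (H D).gr d = ⊥ := by
  rw [Submodule.eq_bot_iff]
  rintro _ ⟨z, hz : (z : D) ∈ D.gr d, rfl⟩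
  rw [h, Submodule.mem_bot] at hz
  have z_eq_zero : z = 0 := Subtype.ext hz
  rw [z_eq_zero, map_zero]

theorem LMod_gr_eq_bot (D : DiffMod.{u} k w) (hθ : IsPositive w θ) {a : A} {j : ℤ}
    (h : ∀ a', θ a' ≤ θ a → D.gr (a', j) = ⊥) : (LMod D).gr (a, j) = ⊥ := by
  refine eq_bot_iff.2 (tensorGr_le ?_)
  rintro b ⟨a', j'⟩ hd s hs x hx
  obtain ⟨rfl, rfl⟩ := Prod.mk.inj hd
  rw [Submodule.mem_bot]
  rcases eq_or_ne s 0 with rfl | hs0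
  · exact TensorProduct.zero_tmul _ _
  · have hb := nonneg_of_mem_weightedHomogeneousSubmodule hθ hs hs0
    rw [h a' (by rw [map_add]; linarith), Submodule.mem_bot] at hx
    rw [hx, TensorProduct.tmul_zero]

theorem LMod_term_eq_bot (D : DiffMod.{u} k w) {j : ℤ} (h : ∀ a, D.gr (a, j) = ⊥) :
    (LMod D).term j = ⊥ := by
  refine eq_bot_iff.2 (iSup_le fun a => tensorGr_le ?_)
  rintro b ⟨a', j'⟩ hd s - x hx
  obtain ⟨rfl, rfl⟩ := Prod.mk.inj hd
  rw [h a', Submodule.mem_bot] at hx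
  rw [Submodule.mem_bot, hx, TensorProduct.tmul_zero]

theorem LMod_H_R_term_eq_bot (G : Cpx.{u} k w) {m : ℤ} (hm : ∀ j < m, G.toGrMod.term j = ⊥)
    {j : ℤ} (hj : j < m) : (LMod (H (R G))).term j = ⊥ := by
  refine LMod_term_eq_bot _ fun a => H_gr_eq_bot _ (R_gr_eq_bot G fun q hq => ?_)
  have term_eq_bot := hm (j - q.2) (by linarith [snd_nonneg_of_omegaGr_ne_bot hq])
  exact iSup_eq_bot.1 term_eq_bot (a - q.1)

theorem LMod_H_R_gr_eq_bot (G : Cpx.{u} k w) (hθ : IsPositive w θ) {N : ℤ}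
    (hN : ∀ a j, θ a < N → G.toGrMod.gr (a, j) = ⊥) {a : A} (ha : θ a < N) (j : ℤ) :
    (LMod (H (R G))).gr (a, j) = ⊥ := by
  refine LMod_gr_eq_bot _ hθ fun a' ha' => H_gr_eq_bot _ (R_gr_eq_bot G fun q hq => ?_)
  refine hN (a' - q.1) (j - q.2) ?_
  rw [map_sub]
  linarith [apply_fst_nonneg_of_omegaGr_ne_bot hθ hq]

theorem IsBoundedBelow.R {G : Cpx.{u} k w} (hθ : IsPositive w θ)
    (hG : IsBoundedBelow θ G.toGrMod.gr) : IsBoundedBelow θ (R G).gr := by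
  intro j
  choose N hN using hG
  obtain ⟨B, hB⟩ := ((finite_omegaGr_ne_bot (k := k) w).image fun q => N (j - q.2)).bddBelow
  refine ⟨B, fun a ha => R_gr_eq_bot G fun q hq => hN (j - q.2) _ ?_⟩
  have B_le : B ≤ N (j - q.2) := hB (Set.mem_image_of_mem _ hq)
  change θ (a - q.1) < N (j - q.2)
  rw [map_sub]
  linarith [apply_fst_nonneg_of_omegaGr_ne_bot hθ hq]

theorem IsBoundedBelow.H {D : DiffMod.{u} k w} (hD : IsBoundedBelow θ D.gr) :
    IsBoundedBelow θ (H D).gr := fun j =>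
  (hD j).imp fun _ hN a ha => H_gr_eq_bot D (hN a ha)

theorem IsBoundedBelow.LMod {D : DiffMod.{u} k w} (hθ : IsPositive w θ)
    (hD : IsBoundedBelow θ D.gr) : IsBoundedBelow θ (LMod D).gr := fun j =>
  (hD j).imp fun _ hN _ ha => LMod_gr_eq_bot D hθ fun a' ha' => hN a' (ha'.trans_lt ha)

end Bounds

section DegreeFiltration

variable {k : Type uk} [Field k] {n : ℕ} {A : Type uA} [AddCommGroup A] [DecidableEq A]
variable {w : Fin (n + 1) → A}

/-- The submodule of `L(D)` generated by the components `D_(a;j)` with `θ(a) ≤ p`. Multiplication by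
`∑ x_i ⊗ e_i` lowers `p`, while homogeneous maps preserve it. -/
def degreeFiltration (D : DiffMod.{u} k w) (θ : A →+ ℤ) (j p : ℤ) :
    Submodule (Poly k n) (LMod D) :=
  Submodule.span (Poly k n) {y | ∃ a, θ a ≤ p ∧ ∃ m ∈ D.gr (a, j), (1 : Poly k n) ⊗ₜ[k] m = y}

variable {D D' : DiffMod.{u} k w} {θ : A →+ ℤ} {j p : ℤ}

theorem tmul_mem_degreeFiltration {a : A} (ha : θ a ≤ p) {m : D} (hm : m ∈ D.gr (a, j))
    (s : Poly k n) : s ⊗ₜ[k] m ∈ degreeFiltration D θ j p := by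
  rw [TensorProduct.tmul_eq_smul_one_tmul]
  exact Submodule.smul_mem _ _ (Submodule.subset_span ⟨a, ha, m, hm, rfl⟩)

theorem dPrime_mem_degreeFiltration (hθ : IsPositive w θ) {x : LMod D}
    (hx : x ∈ degreeFiltration D θ j p) :
    dPrime D x ∈ degreeFiltration D θ (j - 1) (p - 1) := by
  suffices degreeFiltration D θ j p ≤ (degreeFiltration D θ (j - 1) (p - 1)).comap (dPrime D) from
    this hx
  refine Submodule.span_le.2 ?_
  rintro _ ⟨a, ha, m, hm, rfl⟩
  rw [SetLike.mem_coe, Submodule.mem_comap, dPrime_tmul]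
  refine Submodule.sum_mem _ fun i _ => tmul_mem_degreeFiltration ?_ (D.leftVar_mem i hm) _
  rw [map_sub]
  linarith [hθ i]

theorem gr_le_degreeFiltration (hθ : IsPositive w θ) {a : A} (ha : θ a ≤ p) :
    (LMod D).gr (a, j) ≤ (degreeFiltration D θ j p).restrictScalars k := by
  refine tensorGr_le ?_
  rintro b ⟨a', j'⟩ hd s hs x hx
  obtain ⟨rfl, rfl⟩ := Prod.mk.inj hd
  rcases eq_or_ne s 0 with rfl | hs0
  · rw [TensorProduct.zero_tmul]
    exact zero_mem _
  · have hb := nonneg_of_mem_weightedHomogeneousSubmodule hθ hs hs0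
    rw [map_add] at ha
    exact tmul_mem_degreeFiltration (by linarith) hx s

theorem IsHomogeneousMap.mem_degreeFiltration (hθ : IsPositive w θ)
    {f : LMod D →ₗ[Poly k n] LMod D'} {r : ℤ} (hf : IsHomogeneousMap f r) {x : LMod D}
    (hx : x ∈ degreeFiltration D θ j p) : f x ∈ degreeFiltration D' θ (j + r) p := by
  suffices degreeFiltration D θ j p ≤ (degreeFiltration D' θ (j + r) p).comap f from this hx
  refine Submodule.span_le.2 ?_
  rintro _ ⟨a, ha, m, hm, rfl⟩
  refine gr_le_degreeFiltration hθ ha (hf a j _ ?_)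
  exact tmul_mem_tensorGr _ (MvPolynomial.isWeightedHomogeneous_one k w) hm (by simp)

theorem exists_degreeFiltration_eq_bot (hD : IsBoundedBelow θ D.gr) (j : ℤ) :
    ∃ N : ℤ, ∀ p < N, degreeFiltration D θ j p = ⊥ := by
  obtain ⟨N, hN⟩ := hD j
  refine ⟨N, fun p hp => Submodule.span_eq_bot.2 ?_⟩
  rintro _ ⟨a, ha, m, hm, rfl⟩
  rw [hN a (ha.trans_lt hp), Submodule.mem_bot] at hm
  rw [hm, TensorProduct.tmul_zero]

theorem iSup_degreeFiltration (D : DiffMod.{u} k w) (θ : A →+ ℤ) :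
    ⨆ q : ℤ × ℤ, degreeFiltration D θ q.1 q.2 = ⊤ := by
  refine Submodule.eq_top_iff'.2 fun x => ?_
  induction x using TensorProduct.induction_on with
  | zero => exact zero_mem _
  | add x y hx hy => exact add_mem hx hy
  | tmul s m =>
    induction m using grading_induction D.isInternal with
    | h0 =>
      rw [TensorProduct.tmul_zero]
      exact zero_mem _
    | ha x y hx hy =>
      rw [TensorProduct.tmul_add]
      exact add_mem hx hy
    | hm d m hm =>
      exact Submodule.mem_iSup_of_mem (d.2, θ d.1) (tmul_mem_degreeFiltration le_rfl hm s)

theorem pow_mem_degreeFiltration {f : Module.End (Poly k n) (LMod D)}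
    (hf : ∀ p, ∀ x ∈ degreeFiltration D θ j p, f x ∈ degreeFiltration D θ j (p - 1)) (m : ℕ)
    {x : LMod D} (hx : x ∈ degreeFiltration D θ j p) :
    (f ^ m) x ∈ degreeFiltration D θ j (p - m) := by
  induction m with
  | zero => simpa using hx
  | succ m ih =>
    rw [pow_succ', Module.End.mul_apply, Nat.cast_succ, ← sub_sub]
    exact hf _ _ ih

theorem isLocallyNilpotent_dPrime_mul (hθ : IsPositive w θ) (hD : IsBoundedBelow θ D.gr)
    {h : Module.End (Poly k n) (LMod D)} (hh : IsHomogeneousMap (M := LMod D) (N := LMod D) h 1) :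
    IsLocallyNilpotent ((dPrime D : Module.End (Poly k n) (LMod D)) * h) := by
  refine isLocallyNilpotent_of_iSup_eq_top (iSup_degreeFiltration D θ) ?_
  rintro ⟨j, p⟩ x hx
  obtain ⟨N, hN⟩ := exists_degreeFiltration_eq_bot hD j
  refine ⟨(p - N + 1).toNat, ?_⟩
  have pow_mem := pow_mem_degreeFiltration (f := dPrime D * h) (fun p x hx => by
    simpa using dPrime_mem_degreeFiltration hθ (hh.mem_degreeFiltration hθ hx))
    (p - N + 1).toNat hx
  rwa [hN _ (by linarith [Int.self_le_toNat (p - N + 1)]), Submodule.mem_bot] at pow_mem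

end DegreeFiltration

section DeltaOne

variable {k : Type uk} [Field k] {n : ℕ} {A : Type uA} [AddCommGroup A] [DecidableEq A]
variable {w : Fin (n + 1) → A}

theorem DiffMod.leftVar_mem_ker (D : DiffMod.{u} k w) (i : Fin (n + 1)) {z : D}
    (hz : z ∈ LinearMap.ker D.d) : D.leftVar i z ∈ LinearMap.ker D.d := by
  rw [LinearMap.mem_ker, D.d_leftVar, LinearMap.mem_ker.1 hz, map_zero, neg_zero]

theorem DiffMod.leftVar_cls (D : DiffMod.{u} k w) (i : Fin (n + 1)) {d : A × ℤ}
    (z : LinearMap.ker D.d) (hz : (z : D) ∈ D.gr d) :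
    (H D).leftVar i (D.cls z) = D.cls ⟨D.leftVar i z, D.leftVar_mem_ker i z.2⟩ := by
  have cls_mem : D.cls z ∈ (H D).gr d := ⟨z, hz, rfl⟩
  rw [(H D).leftVar_of_mem i cls_mem, ← map_smul, ← map_zsmul]
  exact congrArg D.cls (Subtype.ext (D.leftVar_of_mem i hz).symm)

theorem dInternal_H (D : DiffMod.{u} k w) : dInternal (H D) = 0 := by
  refine LMod.hom_ext fun d m _ => ?_
  rw [dInternal_tmul, LinearMap.zero_apply]
  change -((1 : Poly k n) ⊗ₜ[k] (0 : H D)) = 0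
  rw [TensorProduct.tmul_zero, neg_zero]

namespace Contraction

variable {D : DiffMod.{u} k w} (c : Contraction (Lbar D) (Lbar (H D)))

theorem π_dInternal (x : LMod D) : c.π (dInternal D x) = 0 := by
  have h : c.π (dInternal D x) = dInternal (H D) (c.π x) := c.π_comm x
  rwa [dInternal_H] at h

theorem π_dPrime_dInternal (x : LMod D) : c.π (dPrime D (dInternal D x)) = 0 := by
  have anticomm := LinearMap.congr_fun (dPrime_dInternal D) x
  rw [LinearMap.add_apply, LinearMap.zero_apply] at anticomm
  rw [← LinearMap.comp_apply (dPrime D), eq_neg_of_add_eq_zero_left anticomm, map_neg,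
    LinearMap.comp_apply, c.π_dInternal, neg_zero]

variable {c} (hc : c.IsCanonical)
include hc

theorem IsCanonical.ι_one_tmul_cls (z : LinearMap.ker D.d) :
    c.ι ((1 : Poly k n) ⊗ₜ[k] D.cls z) = (1 : Poly k n) ⊗ₜ[k] (z : D) -
      dInternal D (c.h ((1 : Poly k n) ⊗ₜ[k] (z : D))) := by
  have one_tmul_cycle : dInternal D ((1 : Poly k n) ⊗ₜ[k] (z : D)) = 0 := by
    rw [dInternal_tmul, LinearMap.mem_ker.1 z.2, TensorProduct.tmul_zero, neg_zero]
  have homotopy : _ = dInternal D _ + c.h (dInternal D _) := c.homotopy (1 ⊗ₜ[k] (z : D))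
  rw [one_tmul_cycle, map_zero, add_zero, hc z] at homotopy
  rw [← homotopy, sub_sub_cancel]

theorem IsCanonical.delta_one : c.delta 1 = dPrime (H D) := by
  refine LMod.hom_ext ?_
  rintro d _ ⟨z, hz : (z : D) ∈ D.gr d, rfl⟩
  change ((-1 : ℤ) ^ 0) • c.π (dPrime D (c.ι ((1 : Poly k n) ⊗ₜ[k] D.cls z))) =
    dPrime (H D) ((1 : Poly k n) ⊗ₜ[k] D.cls z)
  rw [pow_zero, one_smul, hc.ι_one_tmul_cls, map_sub, map_sub, c.π_dPrime_dInternal, sub_zero,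
    dPrime_tmul, dPrime_tmul, map_sum]
  refine Finset.sum_congr rfl fun i _ => ?_
  rw [D.leftVar_cls i z hz, mul_one, TensorProduct.tmul_eq_smul_one_tmul, map_smul,
    hc ⟨_, D.leftVar_mem_ker i z.2⟩, ← TensorProduct.tmul_eq_smul_one_tmul]

end Contraction

end DeltaOne

section Shear

open MvPolynomial

variable (R : Type*) [CommRing R] {σ : Type*} (G : Type*) [AddCommGroup G] [Module R G]

/-- A shortcut: unification does not find this instance when rewriting with the ring axioms. -/
local instance : Ring (Module.End R (MvPolynomial σ R ⊗[R] G)) := Module.End.instRing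

/-- Multiplication by `x_i ⊗ 1` on `S ⊗ G`. -/
def leftVarAct (i : σ) : Module.End R (MvPolynomial σ R ⊗[R] G) :=
  (LinearMap.mulLeft R (X i)).rTensor G

variable {R G}

theorem leftVarAct_tmul (i : σ) (s : MvPolynomial σ R) (c : G) :
    leftVarAct R G i (s ⊗ₜ c) = (X i * s) ⊗ₜ c := rfl

theorem tensor_hom_ext_of_leftVarAct {N : Type*} [AddCommGroup N] [Module R N]
    {f g : MvPolynomial σ R ⊗[R] G →ₗ[R] N} (one : ∀ c, f (1 ⊗ₜ c) = g (1 ⊗ₜ c))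
    (leftVarAct : ∀ i x, f x = g x → f (leftVarAct R G i x) = g (leftVarAct R G i x)) : f = g := by
  refine TensorProduct.ext' fun s c => ?_
  induction s using MvPolynomial.induction_on with
  | C a => rw [C_eq_smul_one, ← TensorProduct.smul_tmul', map_smul, map_smul, one]
  | add p q hp hq => rw [TensorProduct.add_tmul, map_add, map_add, hp, hq]
  | mul_X p i hp =>
    rw [mul_comm]
    exact leftVarAct i _ hp

theorem commute_leftVarAct (i j : σ) : Commute (leftVarAct R G i) (leftVarAct R G j) :=
  ((Commute.all (X i : MvPolynomial σ R) (X j)).map (Algebra.lmul R (MvPolynomial σ R))).map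
    (Module.End.rTensorAlgHom R (MvPolynomial σ R) G)

theorem commute_leftVarAct_lTensor (i : σ) (v : Module.End R G) :
    Commute (leftVarAct R G i) (v.lTensor (MvPolynomial σ R)) :=
  (LinearMap.rTensor_comp_lTensor _ _ _).trans (LinearMap.lTensor_comp_rTensor _ _ _).symm

variable (R G) [Module (MvPolynomial σ R) G] [IsScalarTower R (MvPolynomial σ R) G]

/-- Multiplication by `x_i` on `G`, as an endomorphism over the coefficients. -/
def varAct (i : σ) : Module.End R G := Algebra.lsmul R R G (X i : MvPolynomial σ R)

/-- Multiplication by `1 ⊗ x_i` on `S ⊗ G`. -/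
def rightVarAct (i : σ) : Module.End R (MvPolynomial σ R ⊗[R] G) :=
  (varAct R G i).lTensor (MvPolynomial σ R)

/-- The action of `S ⊗ S` on `S ⊗ G`. -/
def tensorAct :
    MvPolynomial σ R ⊗[R] MvPolynomial σ R →ₐ[R] Module.End R (MvPolynomial σ R ⊗[R] G) :=
  Module.endTensorEndAlgHom.comp
    (Algebra.TensorProduct.map (Algebra.lmul R (MvPolynomial σ R)) (Algebra.lsmul R R G))

/-- The homomorphism `S → S ⊗ S` with `x_i ↦ x_i ⊗ 1 + a (1 ⊗ x_i)`. -/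
def shearHom (σ : Type*) (a : R) :
    MvPolynomial σ R →ₐ[R] MvPolynomial σ R ⊗[R] MvPolynomial σ R :=
  aeval fun i => X i ⊗ₜ 1 + a • (1 ⊗ₜ X i)

/-- The endomorphism `s ⊗ c ↦ s(x ⊗ 1 + a (1 ⊗ x)) (1 ⊗ c)` of `S ⊗ G`. -/
def shear (a : R) : Module.End R (MvPolynomial σ R ⊗[R] G) :=
  TensorProduct.lift <| (LinearMap.lcomp R (MvPolynomial σ R ⊗[R] G)
    (TensorProduct.mk R (MvPolynomial σ R) G 1)) ∘ₗ
      ((tensorAct R G).comp (shearHom R σ a)).toLinearMap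

variable {R G}

theorem shear_tmul (a : R) (s : MvPolynomial σ R) (c : G) :
    shear R G a (s ⊗ₜ c) = tensorAct R G (shearHom R σ a s) (1 ⊗ₜ c) := rfl

theorem shear_one_tmul (a : R) (c : G) :
    shear R G a ((1 : MvPolynomial σ R) ⊗ₜ c) = 1 ⊗ₜ c := by
  rw [shear_tmul, map_one, map_one, Module.End.one_apply]

theorem tensorAct_shearHom_X (a : R) (i : σ) :
    tensorAct R G (shearHom R σ a (X i)) = leftVarAct R G i + a • rightVarAct R G i := by
  rw [shearHom, aeval_X, map_add, map_smul]
  congr 1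
  · exact TensorProduct.ext' fun s c => congrArg (_ ⊗ₜ[R] ·) (one_smul (MvPolynomial σ R) c)
  · exact congrArg (a • ·) (TensorProduct.ext' fun s c => congrArg (· ⊗ₜ[R] _) (one_mul s))

theorem shear_mul_leftVarAct (a : R) (i : σ) :
    shear R G a * leftVarAct R G i = (leftVarAct R G i + a • rightVarAct R G i) * shear R G a := by
  refine TensorProduct.ext' fun s c => ?_
  rw [Module.End.mul_apply, leftVarAct_tmul, shear_tmul, map_mul, map_mul, tensorAct_shearHom_X,
    Module.End.mul_apply, Module.End.mul_apply, shear_tmul]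

theorem commute_rightVarAct_lTensor {i : σ} {v : Module.End R G} (hv : Commute (varAct R G i) v) :
    Commute (rightVarAct R G i) (v.lTensor (MvPolynomial σ R)) :=
  hv.map (Module.End.lTensorAlgHom R G (MvPolynomial σ R))

theorem commute_shear_lTensor (a : R) {v : Module.End R G}
    (hv : ∀ i : σ, Commute (varAct R G i) v) :
    Commute (shear R G a) (v.lTensor (MvPolynomial σ R)) := by
  refine tensor_hom_ext_of_leftVarAct (fun c => ?_) fun i x hx => ?_
  · simp only [Module.End.mul_apply, LinearMap.lTensor_tmul, shear_one_tmul]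
  · have comm : Commute (leftVarAct R G i + a • rightVarAct R G i)
        (v.lTensor (MvPolynomial σ R)) :=
      (commute_leftVarAct_lTensor i v).add_left
        ((commute_rightVarAct_lTensor (hv i)).smul_left a)
    simp only [← Module.End.mul_apply] at hx ⊢
    rw [mul_assoc, ← (commute_leftVarAct_lTensor i v).eq, ← mul_assoc, shear_mul_leftVarAct,
      mul_assoc, Module.End.mul_apply, hx, mul_assoc, shear_mul_leftVarAct, ← mul_assoc, ← comm.eq]
    rfl

theorem commute_varAct (i j : σ) : Commute (varAct R G i) (varAct R G j) :=
  (Commute.all (X i : MvPolynomial σ R) (X j)).map (Algebra.lsmul R R G)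

theorem shear_mul_shear {a b : R} (hab : a + b = 0) :
    shear R G a * shear R G b = (1 : Module.End R (MvPolynomial σ R ⊗[R] G)) := by
  refine tensor_hom_ext_of_leftVarAct (fun c => ?_) fun i x hx => ?_
  · rw [Module.End.mul_apply, shear_one_tmul, shear_one_tmul, Module.End.one_apply]
  · have comm : shear R G a * rightVarAct R G i = rightVarAct R G i * shear R G a :=
      commute_shear_lTensor a fun j => commute_varAct j i
    have conj : shear R G a * shear R G b * leftVarAct R G i =
        leftVarAct R G i * (shear R G a * shear R G b) := by
      rw [mul_assoc, shear_mul_leftVarAct, ← mul_assoc, mul_add, shear_mul_leftVarAct,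
        mul_smul_comm, comm, ← smul_mul_assoc, ← add_mul, add_assoc, ← add_smul, hab, zero_smul,
        add_zero, mul_assoc]
    rw [← Module.End.mul_apply, conj, Module.End.mul_apply, hx]
    rfl

variable (R) in
/-- Division by `x_i`, discarding the remainder. -/
def divVar (i : σ) : Module.End R (MvPolynomial σ R) where
  toFun p := p.divMonomial (Finsupp.single i 1)
  map_add' p q := add_divMonomial p q _
  map_smul' r p := by
    ext m
    simp [coeff_divMonomial]

variable (R G) in
/-- Multiplication by `x_i ⊗ 1 - 1 ⊗ x_i` on `S ⊗ G`. -/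
def diagVarAct (i : σ) : Module.End R (MvPolynomial σ R ⊗[R] G) :=
  leftVarAct R G i - rightVarAct R G i

variable (R G) in
/-- Division by `x_i ⊗ 1 - 1 ⊗ x_i` on `S ⊗ G`, discarding a remainder: the conjugate of the
division by `x_i ⊗ 1` under the shear taking `x_i ⊗ 1 - 1 ⊗ x_i` to `x_i ⊗ 1`. -/
def divDiag (i : σ) : Module.End R (MvPolynomial σ R ⊗[R] G) :=
  shear R G (-1) * (divVar R i).rTensor G * shear R G 1

theorem divVar_mul_mulLeft_X (i : σ) : divVar R i * LinearMap.mulLeft R (X i) = 1 :=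
  LinearMap.ext fun p => X_mul_divMonomial i p

theorem commute_divVar_mulLeft_X {i j : σ} (hij : i ≠ j) :
    Commute (divVar R i) (LinearMap.mulLeft R (X j)) := by
  classical
  refine LinearMap.ext fun p => ?_
  ext m
  change coeff m ((X j * p).divMonomial _) = coeff m (X j * p.divMonomial _)
  have mem_support : j ∈ (Finsupp.single i 1 + m).support ↔ j ∈ m.support := by simp [hij]
  simp only [coeff_divMonomial, coeff_X_mul', mem_support]
  by_cases hj : j ∈ m.support
  · have single_le : Finsupp.single j 1 ≤ m :=
      Finsupp.single_le_iff.2 (Nat.one_le_iff_ne_zero.2 (Finsupp.mem_support_iff.1 hj))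
    rw [if_pos hj, if_pos hj, add_tsub_assoc_of_le single_le]
  · rw [if_neg hj, if_neg hj]

theorem divVar_one (i : σ) : divVar R i 1 = 0 := by
  classical
  ext m
  change coeff m (divMonomial 1 _) = 0
  rw [coeff_divMonomial, coeff_one, if_neg]
  intro h
  have apply_i : 0 = 1 + m i := by simpa using DFunLike.congr_fun h i
  omega

theorem diagVarAct_tmul (i : σ) (s : MvPolynomial σ R) (c : G) :
    diagVarAct R G i (s ⊗ₜ c) = (X i * s) ⊗ₜ c - s ⊗ₜ ((X i : MvPolynomial σ R) • c) := rfl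

theorem commute_diagVarAct_lTensor {i : σ} {v : Module.End R G} (hv : Commute (varAct R G i) v) :
    Commute (diagVarAct R G i) (v.lTensor (MvPolynomial σ R)) :=
  (commute_leftVarAct_lTensor i v).sub_left (commute_rightVarAct_lTensor hv)

theorem commute_diagVarAct (i j : σ) : Commute (diagVarAct R G i) (diagVarAct R G j) :=
  Commute.sub_right
    ((commute_leftVarAct i j).sub_left (commute_leftVarAct_lTensor j (varAct R G i)).symm)
    (commute_diagVarAct_lTensor (commute_varAct i j))

theorem shear_mul_diagVarAct (i : σ) :
    shear R G 1 * diagVarAct R G i = leftVarAct R G i * shear R G 1 := by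
  have comm : shear R G 1 * rightVarAct R G i = rightVarAct R G i * shear R G 1 :=
    commute_shear_lTensor 1 fun j => commute_varAct j i
  rw [diagVarAct, mul_sub, shear_mul_leftVarAct, comm, one_smul, add_mul, add_sub_cancel_right]

theorem diagVarAct_mul_shear (i : σ) :
    diagVarAct R G i * shear R G (-1) = shear R G (-1) * leftVarAct R G i := by
  rw [diagVarAct, shear_mul_leftVarAct, neg_one_smul, ← sub_eq_add_neg]

theorem divDiag_mul_diagVarAct (i : σ) : divDiag R G i * diagVarAct R G i = 1 := by
  have div_mul : (divVar R i).rTensor G * leftVarAct R G i = 1 := by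
    rw [leftVarAct, ← LinearMap.rTensor_mul, divVar_mul_mulLeft_X]
    exact LinearMap.rTensor_id G _
  rw [divDiag, mul_assoc, shear_mul_diagVarAct, mul_assoc, ← mul_assoc _ (leftVarAct R G i),
    div_mul, one_mul, shear_mul_shear (neg_add_cancel 1)]

theorem commute_divDiag_diagVarAct {i j : σ} (hij : i ≠ j) :
    Commute (divDiag R G i) (diagVarAct R G j) := by
  have comm : (divVar R i).rTensor G * leftVarAct R G j =
      leftVarAct R G j * (divVar R i).rTensor G :=
    (commute_divVar_mulLeft_X hij).map (Module.End.rTensorAlgHom R (MvPolynomial σ R) G)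
  calc divDiag R G i * diagVarAct R G j
      = shear R G (-1) * ((divVar R i).rTensor G * leftVarAct R G j) * shear R G 1 := by
        rw [divDiag, mul_assoc, shear_mul_diagVarAct]
        simp only [mul_assoc]
    _ = diagVarAct R G j * divDiag R G i := by
        rw [comm, ← mul_assoc, ← diagVarAct_mul_shear, divDiag]
        simp only [mul_assoc]

theorem commute_divDiag_lTensor (i : σ) {v : Module.End R G}
    (hv : ∀ j : σ, Commute (varAct R G j) v) :
    Commute (divDiag R G i) (v.lTensor (MvPolynomial σ R)) :=
  Commute.mul_left (Commute.mul_left (commute_shear_lTensor _ hv)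
    ((LinearMap.rTensor_comp_lTensor _ _ _).trans (LinearMap.lTensor_comp_rTensor _ _ _).symm))
    (commute_shear_lTensor _ hv)

theorem divDiag_one_tmul (i : σ) (c : G) :
    divDiag R G i ((1 : MvPolynomial σ R) ⊗ₜ c) = 0 := by
  rw [divDiag, Module.End.mul_apply, shear_one_tmul, Module.End.mul_apply,
    LinearMap.rTensor_tmul, divVar_one, TensorProduct.zero_tmul, map_zero]

theorem prod_one_sub_mul_eq_zero {B κ : Type*} [Ring B] {y q : κ → B}
    (hy : ∀ i j, Commute (y i) (y j)) (hq : ∀ i, q i * y i = 1)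
    (hqy : ∀ i j, i ≠ j → Commute (q i) (y j)) {l : List κ} {i : κ} (hi : i ∈ l) :
    (l.map fun i => 1 - y i * q i).prod * y i = 0 := by
  induction l with
  | nil => simp at hi
  | cons j l ih =>
    rw [List.map_cons, List.prod_cons, mul_assoc]
    by_cases hil : i ∈ l
    · rw [ih hil, mul_zero]
    · obtain rfl : i = j := by simpa [hil] using hi
      have comm : Commute (y i) (l.map fun i => 1 - y i * q i).prod := by
        refine Commute.list_prod_right _ _ fun _ hb => ?_
        obtain ⟨j, hj, rfl⟩ := List.mem_map.1 hb
        have j_ne_i : j ≠ i := fun h => hil (h ▸ hj)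
        exact (Commute.one_right _).sub_right ((hy i j).mul_right (hqy j i j_ne_i).symm)
      rw [← comm.eq, ← mul_assoc, sub_mul, mul_assoc, hq, one_mul, mul_one, sub_self, zero_mul]

theorem prod_one_sub_diagVarAct_one_tmul (l : List σ) (c : G) :
    (l.map fun i => 1 - diagVarAct R G i * divDiag R G i).prod (1 ⊗ₜ c) = 1 ⊗ₜ c := by
  induction l with
  | nil => rfl
  | cons i l ih =>
    rw [List.map_cons, List.prod_cons, Module.End.mul_apply, ih, LinearMap.sub_apply,
      Module.End.mul_apply, divDiag_one_tmul, map_zero, sub_zero, Module.End.one_apply]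

theorem prod_one_sub_diagVarAct_tmul {l : List σ} (hl : ∀ i, i ∈ l) (s : MvPolynomial σ R) (c : G) :
    (l.map fun i => 1 - diagVarAct R G i * divDiag R G i).prod (s ⊗ₜ c) = 1 ⊗ₜ (s • c) := by
  suffices ∀ c : G, (l.map fun i => 1 - diagVarAct R G i * divDiag R G i).prod (s ⊗ₜ c) =
    1 ⊗ₜ (s • c) from this c
  induction s using MvPolynomial.induction_on with
  | C a =>
    intro c
    rw [C_eq_smul_one, ← TensorProduct.smul_tmul', map_smul, prod_one_sub_diagVarAct_one_tmul,
      smul_assoc, one_smul, TensorProduct.tmul_smul]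
  | add p q hp hq =>
    intro c
    rw [TensorProduct.add_tmul, map_add, hp, hq, add_smul, TensorProduct.tmul_add]
  | mul_X p i hp =>
    intro c
    have mul_diagVarAct := LinearMap.congr_fun (prod_one_sub_mul_eq_zero (y := diagVarAct R G)
      (q := divDiag R G) commute_diagVarAct divDiag_mul_diagVarAct
      (fun _ _ => commute_divDiag_diagVarAct) (hl i)) (p ⊗ₜ c)
    rw [Module.End.mul_apply, diagVarAct_tmul, map_sub, LinearMap.zero_apply, sub_eq_zero,
      hp] at mul_diagVarAct
    rw [mul_comm, mul_diagVarAct, mul_comm, mul_smul]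

end Shear

section ExteriorDual

variable {k : Type uk} [Field k] {n : ℕ} {A : Type uA} [AddCommGroup A] {w : Fin (n + 1) → A}

theorem extVar_mul_of_mem {d : A × ℤ} (i : Fin (n + 1)) {y : Ext k n}
    (hy : y ∈ extGr (k := k) w d) :
    extVar k n i * y = (d.2.negOnePow : ℤ) • (y * extVar k n i) := by
  induction hy using Submodule.span_induction with
  | mem y hy =>
    obtain ⟨v, rfl, rfl⟩ := hy
    induction v with
    | nil => simp
    | cons j v ih =>
      rw [List.map_cons, List.prod_cons, ← mul_assoc, extVar_anticomm, neg_mul, mul_assoc, ih,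
        List.map_cons, List.sum_cons, Prod.snd_add, Int.negOnePow_add, mul_smul_comm, mul_assoc]
      simp
  | zero => rw [mul_zero, zero_mul, smul_zero]
  | add x y _ _ hx hy => rw [mul_add, hx, hy, add_mul, smul_add]
  | smul a x _ hx => rw [mul_smul_comm, hx, smul_mul_assoc, smul_comm]

variable (k n) in
/-- The contraction of `E` with the `i`-th coordinate functional, from the right. -/
def contractVar (i : Fin (n + 1)) : Module.End k (Ext k n) :=
  CliffordAlgebra.contractRight.flip (LinearMap.proj i : (Fin (n + 1) → k) →ₗ[k] k)

theorem contractVar_one (i : Fin (n + 1)) : contractVar k n i 1 = 0 :=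
  CliffordAlgebra.contractRight_one _ _

theorem contractVar_mul_extVar (i j : Fin (n + 1)) (y : Ext k n) :
    contractVar k n i (y * extVar k n j) =
      (if i = j then y else 0) - contractVar k n i y * extVar k n j := by
  refine (CliffordAlgebra.contractRight_mul_ι (Q := (0 : QuadraticForm k (Fin (n + 1) → k)))
    (LinearMap.proj i : (Fin (n + 1) → k) →ₗ[k] k) (Pi.single j 1) y).trans ?_
  congr 1
  rw [LinearMap.proj_apply, Pi.single_apply, ite_smul, one_smul, zero_smul]

variable (k n) in
/-- Wedging with `e_i` on `ω_E`, up to sign: the negative of the transpose of the contraction of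
`E` with the `i`-th coordinate functional. -/
def omegaWedge (i : Fin (n + 1)) : Module.End k (Omega k n) :=
  -Module.Dual.transpose (R := k) (contractVar k n i)

theorem omegaWedge_apply (i : Fin (n + 1)) (f : Omega k n) (y : Ext k n) :
    omegaWedge k n i f y = -f (contractVar k n i y) := rfl

variable (k n) in
/-- The functional on `E` that takes the degree zero part. -/
def augmentation : Omega k n :=
  (ExteriorAlgebra.algebraMapInv (R := k) (M := Fin (n + 1) → k)).toLinearMap

theorem augmentation_one : augmentation k n 1 = 1 := map_one ExteriorAlgebra.algebraMapInv

theorem augmentation_mul_extVar (y : Ext k n) (i : Fin (n + 1)) :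
    augmentation k n (y * extVar k n i) = 0 := by
  change ExteriorAlgebra.algebraMapInv (y * extVar k n i) = 0
  rw [map_mul, extVar]
  simp [ExteriorAlgebra.algebraMapInv]

theorem omega_ext {f g : Omega k n} (one : f 1 = g 1)
    (mul_extVar : ∀ y i, f (y * extVar k n i) = g (y * extVar k n i)) : f = g := by
  refine LinearMap.ext fun y => ?_
  induction y using CliffordAlgebra.right_induction with
  | algebraMap r => rw [Algebra.algebraMap_eq_smul_one, map_smul, map_smul, one]
  | add x y hx hy => rw [map_add, map_add, hx, hy]
  | mul_ι v y _ =>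
    have ι_eq_sum : CliffordAlgebra.ι (0 : QuadraticForm k (Fin (n + 1) → k)) v =
        ∑ i, v i • extVar k n i := by
      conv_lhs => rw [pi_eq_sum_univ' v]
      rw [map_sum]
      exact Finset.sum_congr rfl fun i _ => map_smul _ _ _
    simp only [ι_eq_sum, Finset.mul_sum, mul_smul_comm, map_sum, map_smul, mul_extVar]

variable [DecidableEq A]

theorem omegaLeft_apply (i : Fin (n + 1)) (f : Omega k n) (y : Ext k n) :
    omegaLeft w i f y = -f (y * extVar k n i) := by
  suffices omegaLeft w i = -Module.Dual.transpose (R := k) (LinearMap.mulRight k (extVar k n i))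
    from LinearMap.congr_fun (LinearMap.congr_fun this f) y
  refine linearMap_ext_grading (isInternal_omegaGr (k := k) w) fun d f hf =>
    linearMap_ext_grading (isInternal_extGr (k := k) w) fun d' y hy => ?_
  rw [omegaLeft_of_mem i hf]
  change (d.2.negOnePow : ℤ) • f (extVar k n i * y) = -f (y * extVar k n i)
  rw [extVar_mul_of_mem i hy, map_zsmul]
  by_cases hd : d' + (-w i, -1) = -d
  · have degree : d.2 + d'.2 = 1 := by
      have := congrArg Prod.snd hd
      simp only [Prod.snd_add, Prod.snd_neg] at this
      lia
    rw [smul_smul, ← Units.val_mul, ← Int.negOnePow_add, degree, Int.negOnePow_one,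
      Units.val_neg, Units.val_one, neg_one_zsmul]
  · rw [hf _ hd _ (SetLike.GradedMul.mul_mem (A := extGr (k := k) w) hy (extVar_mem_extGr w i)),
      smul_zero, smul_zero, neg_zero]

theorem omegaLeft_augmentation (i : Fin (n + 1)) : omegaLeft w i (augmentation k n) = 0 := by
  refine LinearMap.ext fun y => ?_
  rw [omegaLeft_apply, augmentation_mul_extVar, neg_zero, LinearMap.zero_apply]

theorem omegaLeft_mul_omegaWedge_add (i j : Fin (n + 1)) :
    omegaLeft w j * omegaWedge k n i + omegaWedge k n i * omegaLeft w j =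
      if i = j then 1 else 0 := by
  refine LinearMap.ext fun f => LinearMap.ext fun y => ?_
  rw [LinearMap.add_apply, Module.End.mul_apply, Module.End.mul_apply, LinearMap.add_apply,
    omegaLeft_apply, omegaWedge_apply, omegaWedge_apply, omegaLeft_apply, contractVar_mul_extVar,
    map_sub]
  split_ifs <;> simp

theorem omegaLeft_mul_omegaWedge_apply (i : Fin (n + 1)) (f : Omega k n) (y : Ext k n) :
    (omegaLeft w i * omegaWedge k n i : Module.End k (Omega k n)) f y =
      f (contractVar k n i (y * extVar k n i)) := by
  rw [Module.End.mul_apply, omegaLeft_apply, omegaWedge_apply, neg_neg]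

theorem prod_omegaLeft_mul_omegaWedge_apply_one (l : List (Fin (n + 1))) (f : Omega k n) :
    (l.map fun i => (omegaLeft w i * omegaWedge k n i : Module.End k (Omega k n))).prod f 1 =
      f 1 := by
  induction l with
  | nil => rfl
  | cons i l ih =>
    rw [List.map_cons, List.prod_cons, Module.End.mul_apply, omegaLeft_mul_omegaWedge_apply,
      contractVar_mul_extVar, if_pos rfl, contractVar_one, zero_mul, sub_zero, ih]

theorem prod_omegaLeft_mul_omegaWedge_apply_mul_extVar {l : List (Fin (n + 1))} {i : Fin (n + 1)}
    (hi : i ∈ l) (f : Omega k n) (y : Ext k n) :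
    (l.map fun i => (omegaLeft w i * omegaWedge k n i : Module.End k (Omega k n))).prod f
      (y * extVar k n i) = 0 := by
  induction l generalizing y with
  | nil => simp at hi
  | cons j l ih =>
    rw [List.map_cons, List.prod_cons, Module.End.mul_apply, omegaLeft_mul_omegaWedge_apply]
    by_cases hij : i = j
    · rw [hij, mul_assoc, extVar_sq, mul_zero, map_zero, map_zero]
    · rw [mul_assoc, extVar_anticomm, mul_neg, map_neg, ← mul_assoc, contractVar_mul_extVar,
        if_neg (Ne.symm hij), zero_sub, neg_neg]
      exact ih (List.mem_of_ne_of_mem hij hi) _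

theorem prod_omegaLeft_mul_omegaWedge {l : List (Fin (n + 1))} (hl : ∀ i, i ∈ l) (f : Omega k n) :
    (l.map fun i => (omegaLeft w i * omegaWedge k n i : Module.End k (Omega k n))).prod f =
      f 1 • augmentation k n := by
  refine omega_ext ?_ fun y i => ?_
  · rw [prod_omegaLeft_mul_omegaWedge_apply_one, LinearMap.smul_apply, augmentation_one,
      smul_eq_mul, mul_one]
  · rw [prod_omegaLeft_mul_omegaWedge_apply_mul_extVar (hl i), LinearMap.smul_apply,
      augmentation_mul_extVar, smul_zero]

end ExteriorDual

section KoszulHomotopy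

theorem exists_sub_prod_eq_apply {R M κ : Type*} [Semiring R] [AddCommGroup M] [Module R M]
    {d : Module.End R M} {s p : κ → Module.End R M} (hd : d * d = 0)
    (hs : ∀ i, d * s i + s i * d = 1 - p i) (l : List κ) {x : M} (hx : d x = 0) :
    d ((l.map p).prod x) = 0 ∧ ∃ z, x - (l.map p).prod x = d z := by
  induction l with
  | nil => exact ⟨hx, 0, by rw [List.map_nil, List.prod_nil, Module.End.one_apply, sub_self,
      map_zero]⟩
  | cons i l ih =>
    rw [List.map_cons, List.prod_cons, Module.End.mul_apply]
    set x' := (l.map p).prod x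
    obtain ⟨d_x', z, hz⟩ := ih
    have homologous : d (s i x') = x' - p i x' := by
      simpa [d_x'] using LinearMap.congr_fun (hs i) x'
    refine ⟨?_, z + s i x', by rw [map_add, ← hz, homologous, sub_add_sub_cancel]⟩
    rw [← sub_sub_cancel x' (p i x'), ← homologous, map_sub, d_x', ← Module.End.mul_apply, hd,
      LinearMap.zero_apply, sub_zero]

variable {R : Type*} [CommRing R] {κ W V : Type*} [AddCommGroup W] [Module R W]
  [AddCommGroup V] [Module R V]

theorem map_list_prod_tensor (f : κ → Module.End R W) (g : κ → Module.End R V) (l : List κ) :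
    (l.map fun i => (TensorProduct.map (f i) (g i) : Module.End R (W ⊗[R] V))).prod =
      TensorProduct.map (l.map f).prod (l.map g).prod := by
  induction l with
  | nil => exact TensorProduct.map_one.symm
  | cons i l ih => rw [List.map_cons, List.prod_cons, ih, ← TensorProduct.map_mul]; rfl

/-- Operators `q_i` dividing by the coefficients `y_i` of the differential `∑ y_i σ ⊗ l_i - δ ⊗ 1`
on `W ⊗ V`, and operators `c_i` conjugate to the `l_i`. They contract the differential one
coefficient at a time. -/
structure IsKoszulDivision (y q : κ → Module.End R W) (σ δ : Module.End R W)
    (l c : κ → Module.End R V) : Prop where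
  q_mul_y (i : κ) : q i * y i = 1
  commute_q_y {i j : κ} : i ≠ j → Commute (q i) (y j)
  σ_mul_σ : σ * σ = 1
  commute_y_σ (i : κ) : Commute (y i) σ
  commute_q_σ (i : κ) : Commute (q i) σ
  commute_q_δ (i : κ) : Commute (q i) δ
  δ_mul_σ : δ * σ = -(σ * δ)
  l_mul_c_add_self (i : κ) : l i * c i + c i * l i = 1
  l_mul_c_add_of_ne {i j : κ} : i ≠ j → l j * c i + c i * l j = 0

variable {y q : κ → Module.End R W} {σ δ : Module.End R W}
  {l c : κ → Module.End R V}

theorem IsKoszulDivision.map_y_mul_q_add_self (H : IsKoszulDivision y q σ δ l c) (i : κ) :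
    TensorProduct.map (y i * q i) (l i * c i) + TensorProduct.map (q i * y i) (c i * l i) =
      1 - TensorProduct.map (1 - y i * q i) (l i * c i) := by
  have map_one_sub : TensorProduct.map (1 - y i * q i) (l i * c i) =
      TensorProduct.map 1 (l i * c i) - TensorProduct.map (y i * q i) (l i * c i) := by
    rw [eq_sub_iff_add_eq, ← TensorProduct.map_add_left, sub_add_cancel]
  rw [H.q_mul_y, map_one_sub, ← TensorProduct.map_one (R := R) (M := W) (N := V),
    ← H.l_mul_c_add_self i, TensorProduct.map_add_right]
  abel

theorem IsKoszulDivision.map_y_mul_q_add_of_ne (H : IsKoszulDivision y q σ δ l c) {i j : κ}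
    (hij : i ≠ j) :
    TensorProduct.map (y j * q i) (l j * c i) + TensorProduct.map (q i * y j) (c i * l j) = 0 := by
  rw [H.commute_q_y hij, ← TensorProduct.map_add_right, H.l_mul_c_add_of_ne hij,
    TensorProduct.map_zero_right]

variable [Fintype κ]

variable (y σ δ l) in
/-- The differential `∑ y_i σ ⊗ l_i - δ ⊗ 1` on `W ⊗ V`. It is a Koszul differential with
coefficients `y_i`, twisted by the differential `δ` of `W`; the involution `σ` records the signs. -/
def koszulDiff : Module.End R (W ⊗[R] V) :=
  ∑ i, TensorProduct.map (y i * σ) (l i) - TensorProduct.map δ 1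

variable (y σ δ l) in
theorem koszulDiff_tmul (x : W) (f : V) :
    koszulDiff y σ δ l (x ⊗ₜ f) = ∑ i, y i (σ x) ⊗ₜ[R] l i f - δ x ⊗ₜ f := by
  simp [koszulDiff, LinearMap.sum_apply]

variable (y σ δ) in
theorem koszulDiff_tmul_of_eq_zero (x : W) {f : V} (hf : ∀ i, l i f = 0) :
    koszulDiff y σ δ l (x ⊗ₜ f) = (-δ x) ⊗ₜ f := by
  simp [koszulDiff_tmul, hf, TensorProduct.neg_tmul]

theorem assoc_koszulDiff {T U : Type*} [AddCommGroup T] [Module R T] [AddCommGroup U] [Module R U]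
    {y : κ → Module.End R (T ⊗[R] U)} {a : κ → Module.End R T} {b : κ → Module.End R U}
    (hy : ∀ i s c, y i (s ⊗ₜ c) = a i s ⊗ₜ c - s ⊗ₜ b i c) (σ δ : Module.End R U)
    (l : κ → Module.End R V) (s : T) (c : U) (f : V) :
    TensorProduct.assoc R T U V (koszulDiff y (σ.lTensor T) (δ.lTensor T) l ((s ⊗ₜ c) ⊗ₜ f)) =
      ∑ i, a i s ⊗ₜ (σ c ⊗ₜ l i f) + -(s ⊗ₜ (∑ i, b i (σ c) ⊗ₜ l i f + δ c ⊗ₜ f)) := by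
  simp only [koszulDiff_tmul, LinearMap.lTensor_tmul, hy, TensorProduct.sub_tmul, map_sub, map_sum,
    TensorProduct.assoc_tmul, Finset.sum_sub_distrib, TensorProduct.tmul_add,
    TensorProduct.tmul_sum]
  abel

theorem IsKoszulDivision.koszulDiff_mul_add (H : IsKoszulDivision y q σ δ l c) (i : κ) :
    koszulDiff y σ δ l * TensorProduct.map (q i * σ) (c i) +
      TensorProduct.map (q i * σ) (c i) * koszulDiff y σ δ l =
      1 - TensorProduct.map (1 - y i * q i) (l i * c i) := by
  have cancel_σ {a b : Module.End R W} (hb : Commute b σ) : a * σ * (b * σ) = a * b := by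
    rw [mul_assoc, hb.eq, ← mul_assoc σ, H.σ_mul_σ, one_mul]
  have δ_anticomm : TensorProduct.map (δ * (q i * σ)) (c i) +
      TensorProduct.map (q i * σ * δ) (c i) = 0 := by
    rw [← TensorProduct.map_add_left, ← mul_assoc, ← (H.commute_q_δ i).eq, mul_assoc, H.δ_mul_σ,
      mul_neg, mul_assoc, neg_add_cancel, TensorProduct.map_zero_left]
  calc
    _ = ∑ j, (TensorProduct.map (y j * q i) (l j * c i) +
          TensorProduct.map (q i * y j) (c i * l j)) -
        (TensorProduct.map (δ * (q i * σ)) (c i) + TensorProduct.map (q i * σ * δ) (c i)) := by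
      rw [koszulDiff, sub_mul, mul_sub, Finset.sum_mul, Finset.mul_sum, Finset.sum_add_distrib]
      simp only [← TensorProduct.map_mul, cancel_σ (H.commute_q_σ i),
        fun j => cancel_σ (a := q i) (H.commute_y_σ j), one_mul, mul_one]
      abel
    _ = _ := by
      rw [δ_anticomm, sub_zero, Fintype.sum_eq_single i fun j hj => H.map_y_mul_q_add_of_ne hj.symm,
        H.map_y_mul_q_add_self]

theorem IsKoszulDivision.exists_sub_map_prod_eq (H : IsKoszulDivision y q σ δ l c)
    (sq : koszulDiff y σ δ l * koszulDiff y σ δ l = 0) (L : List κ) {x : W ⊗[R] V}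
    (hx : koszulDiff y σ δ l x = 0) :
    ∃ z, x - TensorProduct.map (L.map fun i => 1 - y i * q i).prod
      (L.map fun i => l i * c i).prod x = koszulDiff y σ δ l z := by
  rw [← map_list_prod_tensor]
  exact (exists_sub_prod_eq_apply sq H.koszulDiff_mul_add L hx).2

end KoszulHomotopy

section Counit

open MvPolynomial

variable {k : Type uk} [Field k] {n : ℕ} {A : Type uA} [AddCommGroup A] [DecidableEq A]
variable {w : Fin (n + 1) → A}

theorem GrMod.sign_of_mem (M : GrMod.{u} k w) {a : A} {j : ℤ} {m : M} (hm : m ∈ M.gr (a, j)) :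
    M.sign m = (j.negOnePow : ℤ) • m :=
  signOp_of_mem _ _ hm

theorem GrMod.sign_mem (M : GrMod.{u} k w) {a : A} {j : ℤ} {m : M} (hm : m ∈ M.gr (a, j)) :
    M.sign m ∈ M.gr (a, j) := by
  rw [M.sign_of_mem hm]
  exact zsmul_mem hm _

theorem GrMod.sign_mul_sign (M : GrMod.{u} k w) : (M.sign * M.sign : Module.End k M) = 1 := by
  refine linearMap_ext_grading M.isInternal fun ⟨a, j⟩ m hm => ?_
  rw [Module.End.mul_apply, M.sign_of_mem hm, map_zsmul, M.sign_of_mem hm, smul_smul,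
    ← Units.val_mul, Int.units_mul_self, Units.val_one, one_smul, Module.End.one_apply]

theorem GrMod.sign_sign (M : GrMod.{u} k w) (m : M) : M.sign (M.sign m) = m :=
  LinearMap.congr_fun M.sign_mul_sign m

theorem GrMod.commute_varAct_sign (M : GrMod.{u} k w) (i : Fin (n + 1)) :
    Commute (varAct k M i) M.sign := by
  refine linearMap_ext_grading M.isInternal fun ⟨a, j⟩ m hm => ?_
  rw [Module.End.mul_apply, Module.End.mul_apply, M.sign_of_mem hm, map_zsmul]
  exact (M.sign_of_mem (M.X_smul_mem i hm)).symm

theorem GrMod.sign_smul (M : GrMod.{u} k w) (p : Poly k n) (m : M) :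
    M.sign (p • m) = p • M.sign m := by
  induction p using MvPolynomial.induction_on generalizing m with
  | C a => rw [← algebraMap_eq, algebraMap_smul, algebraMap_smul, map_smul]
  | add p q hp hq => rw [add_smul, map_add, hp, hq, add_smul]
  | mul_X p i hp =>
    rw [mul_smul, mul_smul, hp]
    exact congrArg (p • ·) (LinearMap.congr_fun (M.commute_varAct_sign i) m).symm

theorem Cpx.d_mul_sign (C : Cpx.{u} k w) :
    C.d.restrictScalars k * C.toGrMod.sign = -(C.toGrMod.sign * C.d.restrictScalars k) := by
  refine linearMap_ext_grading C.toGrMod.isInternal fun ⟨a, j⟩ m hm => ?_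
  have d_mem := C.isDifferential.homogeneous a j m hm
  simp only [Module.End.mul_apply, LinearMap.neg_apply, LinearMap.restrictScalars_apply]
  rw [C.toGrMod.sign_of_mem hm, C.toGrMod.sign_of_mem d_mem, map_zsmul, Int.negOnePow_add]
  simp

theorem Cpx.d_sign (C : Cpx.{u} k w) (m : C.toGrMod) :
    C.d (C.toGrMod.sign m) = -C.toGrMod.sign (C.d m) :=
  LinearMap.congr_fun C.d_mul_sign m

variable (G : Cpx.{u} k w)

theorem R_leftVar_tmul (i : Fin (n + 1)) (c : G.toGrMod) (f : Omega k n) :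
    (R G).leftVar i (c ⊗ₜ[k] f) = G.toGrMod.sign c ⊗ₜ[k] omegaLeft w i f := by
  suffices (R G).leftVar i = TensorProduct.map G.toGrMod.sign (omegaLeft w i) from
    LinearMap.congr_fun this _
  refine tensor_ext G.toGrMod fun ⟨a, j⟩ c hc d f hf => ?_
  have tmul_mem : c ⊗ₜ[k] f ∈ (R G).gr ((a, j) + d) := tmul_mem_tensorGr _ hc hf rfl
  rw [(R G).leftVar_of_mem i tmul_mem, TensorProduct.map_tmul, G.toGrMod.sign_of_mem hc,
    omegaLeft_of_mem i hf, Prod.snd_add, Int.negOnePow_add]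
  change _ • RAct G.toGrMod _ _ = _
  rw [RAct_tmul, TensorProduct.tmul_smul, ← TensorProduct.smul_tmul', smul_smul, mul_comm,
    Units.val_mul]

/-- The identification of `(S ⊗ G) ⊗ ω_E` with `L(R(G))`. -/
def LREquiv : (Poly k n ⊗[k] G.toGrMod.carrier) ⊗[k] Omega k n ≃ₗ[k] (L (R G)).toGrMod :=
  TensorProduct.assoc k (Poly k n) G.toGrMod.carrier (Omega k n)

theorem LREquiv_tmul (s : Poly k n) (c : G.toGrMod) (f : Omega k n) :
    LREquiv G ((s ⊗ₜ[k] c) ⊗ₜ[k] f) = s ⊗ₜ[k] (c ⊗ₜ[k] f) := rfl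

/-- The differential of `L(R(G))`, transported to `(S ⊗ G) ⊗ ω_E`. There it is the Koszul
differential of the `x_i ⊗ 1 - 1 ⊗ x_i` on `S ⊗ G`, twisted by the differential of `G`. -/
def dLR : Module.End k ((Poly k n ⊗[k] G.toGrMod.carrier) ⊗[k] Omega k n) :=
  koszulDiff (diagVarAct k G.toGrMod.carrier) (G.toGrMod.sign.lTensor (Poly k n))
    ((G.d.restrictScalars k).lTensor (Poly k n)) (fun i => omegaLeft w i)

theorem LREquiv_dLR_tmul (s : Poly k n) (c : G.toGrMod) (f : Omega k n) :
    LREquiv G (dLR G ((s ⊗ₜ[k] c) ⊗ₜ[k] f)) =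
      ∑ i, (X i * s) ⊗ₜ[k] (G.toGrMod.sign c ⊗ₜ[k] omegaLeft w i f) +
      -(s ⊗ₜ[k] (∑ i, ((X i : Poly k n) • G.toGrMod.sign c) ⊗ₜ[k] omegaLeft w i f +
        G.d c ⊗ₜ[k] f)) :=
  assoc_koszulDiff (b := varAct k G.toGrMod.carrier)
    (a := fun i => LinearMap.mulLeft k (X i : Poly k n)) diagVarAct_tmul
    G.toGrMod.sign (G.d.restrictScalars k) (fun i => omegaLeft w i) s c f

theorem LREquiv_dLR (x) : LREquiv G (dLR G x) = (L (R G)).d (LREquiv G x) := by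
  suffices (LREquiv G).toLinearMap ∘ₗ dLR G =
      (L (R G)).d.restrictScalars k ∘ₗ (LREquiv G).toLinearMap from LinearMap.congr_fun this x
  refine TensorProduct.ext' fun x f => ?_
  refine LinearMap.congr_fun (f := (LREquiv G).toLinearMap ∘ₗ dLR G ∘ₗ
      (TensorProduct.mk k _ (Omega k n)).flip f)
    (g := (L (R G)).d.restrictScalars k ∘ₗ (LREquiv G).toLinearMap ∘ₗ
      (TensorProduct.mk k _ (Omega k n)).flip f)
    (TensorProduct.ext (LinearMap.ext fun s =>
      linearMap_ext_grading G.toGrMod.isInternal fun ⟨a, j⟩ c hc => ?_)) x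
  change LREquiv G (dLR G ((s ⊗ₜ[k] c) ⊗ₜ[k] f)) = dPrime (R G) (s ⊗ₜ[k] (c ⊗ₜ[k] f)) +
    dInternal (R G) (s ⊗ₜ[k] (c ⊗ₜ[k] f))
  have R_d_tmul : (R G).d (c ⊗ₜ[k] f) = _ := dR_tmul G hc f
  rw [LREquiv_dLR_tmul, dPrime_tmul, dInternal_tmul, R_d_tmul]
  refine congrArg₂ (· + ·) (Finset.sum_congr rfl fun i _ => by rw [R_leftVar_tmul]) ?_
  simp only [G.toGrMod.sign_of_mem hc, Finset.smul_sum, TensorProduct.smul_tmul',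
    smul_comm (X _ : Poly k n) (j.negOnePow : ℤ) c]

theorem dLR_mul_dLR : dLR G * dLR G = 0 := by
  refine LinearMap.ext fun x => (LREquiv G).injective ?_
  rw [Module.End.mul_apply, LREquiv_dLR, LREquiv_dLR, (L (R G)).isDifferential.sq,
    LinearMap.zero_apply, map_zero]

/-- The counit `L(R(G)) → G`, which sends `s ⊗ c ⊗ f` to `(-1) ^ j f(1) s c` for `c ∈ G_j`. -/
def counit : (L (R G)).toGrMod →ₗ[Poly k n] G.toGrMod :=
  LinearMap.liftBaseChange (Poly k n) ((TensorProduct.rid k G.toGrMod.carrier).toLinearMap ∘ₗ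
    TensorProduct.map G.toGrMod.sign (LinearMap.applyₗ (1 : Ext k n)))

theorem counit_tmul (s : Poly k n) (c : G.toGrMod) (f : Omega k n) :
    counit G (s ⊗ₜ[k] (c ⊗ₜ[k] f)) = s • f 1 • G.toGrMod.sign c := rfl

theorem counit_isHomogeneousMap :
    IsHomogeneousMap (M := (L (R G)).toGrMod) (N := G.toGrMod) (counit G) 0 := by
  intro a j m hm
  rw [add_zero]
  refine tensorGr_le (P := (G.toGrMod.gr (a, j)).comap ((counit G).restrictScalars k)) ?_ hm
  rintro b ⟨a', j'⟩ hd s hs x hx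
  obtain ⟨rfl, rfl⟩ := Prod.mk.inj hd
  refine tensorGr_le (P := (G.toGrMod.gr (b + a', j')).comap
    (((counit G).restrictScalars k) ∘ₗ TensorProduct.mk k (Poly k n) (R G) s)) ?_ hx
  rintro d d' hdd' c hc f hf
  change counit G (s ⊗ₜ[k] (c ⊗ₜ[k] f)) ∈ G.toGrMod.gr (b + a', j')
  rw [counit_tmul]
  by_cases hd' : d' = 0
  · obtain rfl : d = (a', j') := by rw [← hdd', hd', add_zero]
    exact G.toGrMod.smul_mem _ _ _ s hs _ (Submodule.smul_mem _ _ (G.toGrMod.sign_mem hc))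
  · have apply_one : f 1 = 0 := hf 0 (fun h => hd' (by rw [← neg_neg d', ← h, neg_zero])) 1
      (SetLike.GradedOne.one_mem (A := extGr (k := k) w))
    rw [apply_one, zero_smul, smul_zero]
    exact zero_mem _

theorem counit_LREquiv_dLR_tmul (s : Poly k n) (c : G.toGrMod) (f : Omega k n) :
    counit G (LREquiv G (dLR G ((s ⊗ₜ[k] c) ⊗ₜ[k] f))) =
      G.d (counit G (LREquiv G ((s ⊗ₜ[k] c) ⊗ₜ[k] f))) := by
  have diagonal_cancels (i : Fin (n + 1)) :
      counit G ((X i * s) ⊗ₜ[k] (G.toGrMod.sign c ⊗ₜ[k] omegaLeft w i f)) =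
        counit G (s ⊗ₜ[k] (((X i : Poly k n) • G.toGrMod.sign c) ⊗ₜ[k] omegaLeft w i f)) := by
    rw [counit_tmul, counit_tmul, G.toGrMod.sign_smul, mul_comm, mul_smul, smul_comm (X i)]
  rw [LREquiv_dLR_tmul, TensorProduct.tmul_add, TensorProduct.tmul_sum, neg_add, ← add_assoc,
    map_add, map_add, map_neg, map_neg, map_sum, map_sum, LREquiv_tmul,
    Finset.sum_congr rfl fun i _ => diagonal_cancels i, add_neg_cancel, zero_add, counit_tmul,
    counit_tmul, map_smul, LinearMap.map_smul_of_tower, G.d_sign, smul_neg, smul_neg]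

theorem counit_d (x : (L (R G)).toGrMod) : counit G ((L (R G)).d x) = G.d (counit G x) := by
  obtain ⟨x, rfl⟩ := (LREquiv G).surjective x
  rw [← LREquiv_dLR]
  exact LinearMap.congr_fun (f := (counit G).restrictScalars k ∘ₗ (LREquiv G).toLinearMap ∘ₗ dLR G)
    (g := G.d.restrictScalars k ∘ₗ (counit G).restrictScalars k ∘ₗ (LREquiv G).toLinearMap)
    (TensorProduct.ext_threefold (counit_LREquiv_dLR_tmul G)) x

/-- The inclusion `c ↦ (-1) ^ j 1 ⊗ c ⊗ 1^*` of `G` into `L(R(G))`, a section of the counit. It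
commutes with the differentials but is linear over the field only. -/
def counitSection : G.toGrMod →ₗ[k] (Poly k n ⊗[k] G.toGrMod.carrier) ⊗[k] Omega k n :=
  (TensorProduct.mk k _ (Omega k n)).flip (augmentation k n) ∘ₗ
    TensorProduct.mk k (Poly k n) G.toGrMod.carrier 1 ∘ₗ G.toGrMod.sign

theorem counitSection_apply (c : G.toGrMod) :
    counitSection G c = ((1 : Poly k n) ⊗ₜ[k] G.toGrMod.sign c) ⊗ₜ[k] augmentation k n := rfl

theorem counit_counitSection (c : G.toGrMod) : counit G (LREquiv G (counitSection G c)) = c := by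
  rw [counitSection_apply, LREquiv_tmul, counit_tmul, augmentation_one, one_smul, one_smul,
    G.toGrMod.sign_sign]

theorem dLR_counitSection (c : G.toGrMod) :
    dLR G (counitSection G c) = counitSection G (G.d c) := by
  rw [counitSection_apply, dLR, koszulDiff_tmul_of_eq_zero _ _ _ _ omegaLeft_augmentation,
    LinearMap.lTensor_tmul, LinearMap.restrictScalars_apply, G.d_sign, TensorProduct.tmul_neg,
    neg_neg, counitSection_apply]

theorem map_prod_eq_counitSection_counit {l : List (Fin (n + 1))} (hl : ∀ i, i ∈ l) (x) :
    TensorProduct.map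
        (l.map fun i => 1 - diagVarAct k G.toGrMod.carrier i * divDiag k _ i).prod
        (l.map fun i => (omegaLeft w i * omegaWedge k n i : Module.End k (Omega k n))).prod x =
      counitSection G (counit G (LREquiv G x)) := by
  refine LinearMap.congr_fun (g := counitSection G ∘ₗ (counit G).restrictScalars k ∘ₗ
    (LREquiv G).toLinearMap) (TensorProduct.ext_threefold fun s c f => ?_) x
  change _ = counitSection G (counit G (LREquiv G ((s ⊗ₜ[k] c) ⊗ₜ[k] f)))
  rw [TensorProduct.map_tmul, prod_one_sub_diagVarAct_tmul hl, prod_omegaLeft_mul_omegaWedge hl,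
    LREquiv_tmul, counit_tmul, counitSection_apply, G.toGrMod.sign_smul, map_smul,
    G.toGrMod.sign_sign, smul_comm s, ← TensorProduct.smul_tmul (f 1),
    ← TensorProduct.tmul_smul (f 1)]

theorem isKoszulDivision_diagVarAct :
    IsKoszulDivision (diagVarAct k G.toGrMod.carrier) (divDiag k _)
      (G.toGrMod.sign.lTensor (Poly k n)) ((G.d.restrictScalars k).lTensor (Poly k n))
      (fun i => omegaLeft w i) (omegaWedge k n) where
  q_mul_y := divDiag_mul_diagVarAct
  commute_q_y := commute_divDiag_diagVarAct
  σ_mul_σ := by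
    rw [← LinearMap.lTensor_mul, G.toGrMod.sign_mul_sign]
    exact LinearMap.lTensor_id _ _
  commute_y_σ i := commute_diagVarAct_lTensor (G.toGrMod.commute_varAct_sign i)
  commute_q_σ i := commute_divDiag_lTensor i G.toGrMod.commute_varAct_sign
  commute_q_δ i := commute_divDiag_lTensor i fun j =>
    LinearMap.ext fun c => (map_smul G.d (X j : Poly k n) c).symm
  δ_mul_σ := by
    rw [← LinearMap.lTensor_mul, ← LinearMap.lTensor_mul, G.d_mul_sign, LinearMap.lTensor_neg]
  l_mul_c_add_self i := (omegaLeft_mul_omegaWedge_add i i).trans (if_pos rfl)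
  l_mul_c_add_of_ne hij := (omegaLeft_mul_omegaWedge_add _ _).trans (if_neg hij)

theorem exists_sub_counitSection_eq_dLR {x} (hx : dLR G x = 0) :
    ∃ z, x - counitSection G (counit G (LREquiv G x)) = dLR G z := by
  rw [← map_prod_eq_counitSection_counit G List.mem_finRange]
  exact (isKoszulDivision_diagVarAct G).exists_sub_map_prod_eq (dLR_mul_dLR G) _ hx

theorem counit_isQuasiIso : IsQuasiIso (C := L (R G)) (C' := G) (counit G) where
  homogeneous := counit_isHomogeneousMap G
  comm := counit_d G
  injective := by
    rintro x hx ⟨g, hg⟩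
    obtain ⟨x, rfl⟩ := (LREquiv G).surjective x
    rw [← LREquiv_dLR, LinearEquiv.map_eq_zero_iff] at hx
    obtain ⟨z, hz⟩ := exists_sub_counitSection_eq_dLR G hx
    refine ⟨LREquiv G (z + counitSection G g), ?_⟩
    rw [← LREquiv_dLR, map_add, dLR_counitSection, hg, ← hz, sub_add_cancel]
  surjective := by
    intro g hg
    refine ⟨LREquiv G (counitSection G g), ?_, 0, ?_⟩
    · rw [← LREquiv_dLR, dLR_counitSection, hg, map_zero, map_zero]
    · rw [counit_counitSection, sub_self, map_zero]

end Counit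

section HomogeneousMaps

universe u₁ u₂ u₃

variable {k : Type uk} [Field k] {n : ℕ} {A : Type uA} [AddCommGroup A] [DecidableEq A]
variable {w : Fin (n + 1) → A} {M : GrMod.{u₁} k w} {N : GrMod.{u₂} k w} {P : GrMod.{u₃} k w}
variable {r s : ℤ}

theorem IsHomogeneousMap.comp {g : N →ₗ[Poly k n] P} {f : M →ₗ[Poly k n] N}
    (hg : IsHomogeneousMap g s) (hf : IsHomogeneousMap f r) :
    IsHomogeneousMap (g ∘ₗ f) (r + s) := by
  intro a j m hm
  rw [← add_assoc]
  exact hg _ _ _ (hf a j m hm)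

theorem IsHomogeneousMap.zsmul {f : M →ₗ[Poly k n] N} (hf : IsHomogeneousMap f r) (z : ℤ) :
    IsHomogeneousMap (z • f) r :=
  fun a j m hm => zsmul_mem (hf a j m hm) z

end HomogeneousMaps

section HomogeneousBases

variable {k : Type uk} [Field k] {n : ℕ} {A : Type uA} [AddCommGroup A] [DecidableEq A]
variable {w : Fin (n + 1) → A}

theorem exists_homogeneousBasis_of_isInternal {κ : Type*} [DecidableEq κ] {V : Type u}
    [AddCommGroup V] [Module k V] {gr : κ → Submodule k V} (h : DirectSum.IsInternal gr) :
    ∃ (I : Type u) (b : Module.Basis I k V), ∀ i, ∃ d, b i ∈ gr d := by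
  let b := h.collectedBasis fun d => Module.Basis.ofVectorSpace k (gr d)
  refine ⟨Set.range b, b.reindexRange, ?_⟩
  rintro ⟨_, x, rfl⟩
  refine ⟨x.1, ?_⟩
  rw [Module.Basis.reindexRange_apply]
  exact h.collectedBasis_mem _ x

theorem isHomogeneousBasis_baseChange {D : DiffMod.{u} k w} {I : Type*} {b : Module.Basis I k D}
    (hb : ∀ i, ∃ d, b i ∈ D.gr d) :
    IsHomogeneousBasis (M := LMod D) (b.baseChange (Poly k n)) := by
  intro i
  obtain ⟨d, hd⟩ := hb i
  refine ⟨d, ?_⟩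
  rw [Module.Basis.baseChange_apply]
  exact tmul_mem_tensorGr _ (MvPolynomial.isWeightedHomogeneous_one k w) hd (by simp)

theorem LMod_isGradedFree (D : DiffMod.{max uk u} k w) : (LMod D).IsGradedFree := by
  obtain ⟨I, b, hb⟩ := exists_homogeneousBasis_of_isInternal D.isInternal
  exact ⟨I, b.baseChange (Poly k n), isHomogeneousBasis_baseChange hb⟩

theorem hasLinearEntries_baseChange {D D₁ D₂ : DiffMod.{max uk u} k w} {I J : Type (max uk u)}
    (b : Module.Basis I k D₁) (b' : Module.Basis J k D₂) (f : D →ₗ[k] D₂) (g : D₁ →ₗ[k] D) :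
    HasLinearEntries (P := LMod D₁) (Q := LMod D₂) (b.baseChange (Poly k n))
      (b'.baseChange (Poly k n))
      (f.baseChange (Poly k n) ∘ₗ dPrime D ∘ₗ g.baseChange (Poly k n)) := by
  intro i j
  have apply_basis : (f.baseChange (Poly k n) ∘ₗ dPrime D ∘ₗ g.baseChange (Poly k n))
      (b.baseChange (Poly k n) i) =
      ∑ s, (MvPolynomial.X s : Poly k n) ⊗ₜ[k] f (D.leftVar s (g (b i))) := by
    simp only [LinearMap.comp_apply, Module.Basis.baseChange_apply, LinearMap.baseChange_tmul,
      dPrime_tmul, map_sum, mul_one]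
  rw [apply_basis, map_sum, Finsupp.finsetSum_apply]
  refine Submodule.sum_mem _ fun s _ => ?_
  rw [Module.Basis.baseChange_repr_tmul]
  exact Submodule.smul_mem _ _ (Submodule.subset_span ⟨s, rfl⟩)

theorem dPrime_isStronglyLinear (D : DiffMod.{max uk u} k w) :
    IsStronglyLinear (P := LMod D) (Q := LMod D) (dPrime D) := by
  obtain ⟨I, b, hb⟩ := exists_homogeneousBasis_of_isInternal D.isInternal
  refine ⟨⟨-1, dPrime_homogeneous D⟩, I, I, b.baseChange (Poly k n), b.baseChange (Poly k n),
    isHomogeneousBasis_baseChange hb, isHomogeneousBasis_baseChange hb, ?_⟩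
  have linear_entries := hasLinearEntries_baseChange b b (LinearMap.id : D →ₗ[k] D) LinearMap.id
  rwa [LinearMap.baseChange_id, LinearMap.id_comp, LinearMap.comp_id] at linear_entries

end HomogeneousBases

section GradedSums

universe v

variable {k : Type uk} [Field k] {n : ℕ} {A : Type uA} [AddCommGroup A] [DecidableEq A]
variable {w : Fin (n + 1) → A}

/-- The graded module `P(d₀)`, whose component of degree `d` is the component of `P` of degree
`d + d₀`. -/
abbrev GrMod.shift (P : GrMod.{u} k w) (d₀ : A × ℤ) : GrMod.{u} k w where
  carrier := P
  gr d := P.gr (d + d₀)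
  isInternal := by
    refine isInternal_of_proj (fun d => component P.isInternal (d + d₀))
      (fun _ _ => component_of_mem _) (fun _ _ hd _ => component_of_mem_ne _ ?_) fun m => ?_
    · simpa using hd
    · have iSup_shift : ⨆ d, P.gr (d + d₀) = ⨆ d, P.gr d := (Equiv.addRight d₀).iSup_comp
      rw [iSup_shift, P.isInternal.submodule_iSup_eq_top]
      exact Submodule.mem_top
  smul_mem b a j p hp m hm := by
    have smul_mem := P.smul_mem b (a + d₀.1) (j + d₀.2) p hp m hm
    rwa [← add_assoc] at smul_mem

/-- The direct sum of two graded modules. -/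
abbrev GrMod.prod (P Q : GrMod.{u} k w) : GrMod.{u} k w where
  carrier := P × Q
  gr d := (P.gr d).prod (Q.gr d)
  isInternal := by
    refine isInternal_of_proj
      (fun d => (component P.isInternal d).prodMap (component Q.isInternal d)) ?_ ?_ ?_
    · rintro d ⟨x, y⟩ ⟨hx, hy⟩
      exact Prod.ext (component_of_mem _ hx) (component_of_mem _ hy)
    · rintro d d' hd ⟨x, y⟩ ⟨hx, hy⟩
      exact Prod.ext (component_of_mem_ne _ hd hx) (component_of_mem_ne _ hd hy)
    · rintro ⟨x, y⟩
      have inl_mem : ⊤ ≤ (⨆ d, (P.gr d).prod (Q.gr d)).comap (LinearMap.inl k P Q) :=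
        P.isInternal.submodule_iSup_eq_top.ge.trans <| iSup_le fun d m hm =>
          Submodule.mem_iSup_of_mem d ⟨hm, zero_mem _⟩
      have inr_mem : ⊤ ≤ (⨆ d, (P.gr d).prod (Q.gr d)).comap (LinearMap.inr k P Q) :=
        Q.isInternal.submodule_iSup_eq_top.ge.trans <| iSup_le fun d m hm =>
          Submodule.mem_iSup_of_mem d ⟨zero_mem _, hm⟩
      rw [← Prod.fst_add_snd (x, y)]
      exact add_mem (inl_mem (Submodule.mem_top (R := k) (x := x)) : (x, (0 : Q)) ∈ _)
        (inr_mem (Submodule.mem_top (R := k) (x := y)) : ((0 : P), y) ∈ _)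
  smul_mem b a j p hp := by
    rintro ⟨x, y⟩ ⟨hx, hy⟩
    exact ⟨P.smul_mem b a j p hp x hx, Q.smul_mem b a j p hp y hy⟩

theorem single_mem_pi {κ : Type*} [DecidableEq κ] {V : κ → Type*} [∀ i, AddCommGroup (V i)]
    [∀ i, Module k (V i)] (p : ∀ i, Submodule k (V i)) {i : κ} {m : V i} (hm : m ∈ p i) :
    Pi.single i m ∈ Submodule.pi Set.univ p := by
  intro l _
  obtain rfl | hl := eq_or_ne l i
  · rwa [Pi.single_eq_same]
  · rw [Pi.single_eq_of_ne hl]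
    exact zero_mem _

/-- The direct sum of a finite family of graded modules. -/
abbrev GrMod.pi {κ : Type v} [Finite κ] (P : κ → GrMod.{u} k w) : GrMod.{max v u} k w where
  carrier := ∀ i, P i
  gr d := Submodule.pi Set.univ fun i => (P i).gr d
  isInternal := by
    classical
    have := Fintype.ofFinite κ
    refine isInternal_of_proj
      (fun d => LinearMap.pi fun i => component (P i).isInternal d ∘ₗ LinearMap.proj i) ?_ ?_ ?_
    · exact fun d x hx => funext fun i => component_of_mem _ (hx i trivial)
    · exact fun d d' hd x hx => funext fun i => component_of_mem_ne _ hd (hx i trivial)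
    · intro x
      have single_mem (i : κ) : ⊤ ≤ (⨆ d, Submodule.pi Set.univ fun i => (P i).gr d).comap
          (LinearMap.single k (fun i => P i) i) :=
        (P i).isInternal.submodule_iSup_eq_top.ge.trans <| iSup_le fun d m hm =>
          Submodule.mem_iSup_of_mem d (single_mem_pi (fun i => (P i).gr d) hm)
      rw [← Finset.univ_sum_single x]
      exact Submodule.sum_mem _ fun i _ => single_mem i Submodule.mem_top
  smul_mem b a j p hp x hx i _ := (P i).smul_mem b a j p hp _ (hx i trivial)

section Bases

variable {P Q : GrMod.{u} k w} {I : Type u} {J : Type v}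

theorem IsHomogeneousBasis.shift {b : Module.Basis I (Poly k n) P} (hb : IsHomogeneousBasis b)
    (d₀ : A × ℤ) : IsHomogeneousBasis (M := P.shift d₀) b := fun i =>
  (hb i).elim fun d hd => ⟨d - d₀, by simpa using hd⟩

theorem IsHomogeneousBasis.prod {b : Module.Basis I (Poly k n) P}
    {b' : Module.Basis J (Poly k n) Q} (hb : IsHomogeneousBasis b) (hb' : IsHomogeneousBasis b') :
    IsHomogeneousBasis (M := P.prod Q) (b.prod b') := by
  rintro (i | j)
  · obtain ⟨d, hd⟩ := hb i
    exact ⟨d, by simpa using hd⟩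
  · obtain ⟨d, hd⟩ := hb' j
    exact ⟨d, by simpa using hd⟩

theorem IsHomogeneousBasis.pi {κ : Type v} [Fintype κ] {P : κ → GrMod.{u} k w} {I : κ → Type*}
    {b : ∀ i, Module.Basis (I i) (Poly k n) (P i)} (hb : ∀ i, IsHomogeneousBasis (b i)) :
    IsHomogeneousBasis (M := GrMod.pi P) (Pi.basis b) := by
  classical
  rintro ⟨i, l⟩
  obtain ⟨d, hd⟩ := hb i l
  refine ⟨d, ?_⟩
  rw [Pi.basis_apply]
  exact single_mem_pi (fun i => (P i).gr d) hd

theorem IsHomogeneousBasis.map {b : Module.Basis I (Poly k n) P} (hb : IsHomogeneousBasis b)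
    {e : P ≃ₗ[Poly k n] Q} {r : ℤ} (he : IsHomogeneousMap (e : P →ₗ[Poly k n] Q) r) :
    IsHomogeneousBasis (b.map e) := by
  intro i
  obtain ⟨⟨a, j⟩, hd⟩ := hb i
  exact ⟨(a, j + r), he a j _ hd⟩

theorem GrMod.IsGradedFree.shift (hP : P.IsGradedFree) (d₀ : A × ℤ) :
    (P.shift d₀).IsGradedFree := by
  obtain ⟨I, b, hb⟩ := hP
  exact ⟨I, b, hb.shift d₀⟩

theorem GrMod.IsGradedFree.pi {κ : Type v} [Finite κ] {P : κ → GrMod.{u} k w}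
    (hP : ∀ i, (P i).IsGradedFree) : (GrMod.pi P).IsGradedFree := by
  have := Fintype.ofFinite κ
  choose I b hb using hP
  exact ⟨Σ i, I i, Pi.basis b, IsHomogeneousBasis.pi hb⟩

end Bases

end GradedSums

section StronglyLinear

variable {k : Type uk} [Field k] {n : ℕ} {A : Type uA} [AddCommGroup A] [DecidableEq A]
variable {w : Fin (n + 1) → A} {P P' Q Q' T : GrMod.{u} k w}

theorem X_mul_ite_mem_span_X (s : Fin (n + 1)) (c : Prop) [Decidable c] :
    (MvPolynomial.X s * (if c then 1 else 0) : Poly k n) ∈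
      Submodule.span k (Set.range (MvPolynomial.X : Fin (n + 1) → Poly k n)) := by
  split_ifs
  · rw [mul_one]
    exact Submodule.subset_span ⟨s, rfl⟩
  · rw [mul_zero]
    exact zero_mem _

/-- The map `P → ⨁ P(deg x_s)` given by `y ↦ (x_s y)_s`. -/
def mulVars (P : GrMod.{u} k w) : P →ₗ[Poly k n] GrMod.pi fun s => P.shift (w s, 0) :=
  LinearMap.pi fun s => (MvPolynomial.X s : Poly k n) • LinearMap.id

theorem mulVars_isStronglyLinear (hP : P.IsGradedFree) : IsStronglyLinear (mulVars P) := by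
  classical
  obtain ⟨I, b, hb⟩ := hP
  refine ⟨⟨0, fun a j m hm s _ => ?_⟩, I, Σ _ : Fin (n + 1), I, b, Pi.basis fun _ => b, hb,
    IsHomogeneousBasis.pi fun s => hb.shift (w s, 0), ?_⟩
  · change (MvPolynomial.X s : Poly k n) • m ∈ P.gr (a + w s, j + 0 + 0)
    simpa only [add_comm, add_zero] using P.X_smul_mem s hm
  · rintro i ⟨s, l⟩
    have entry : (Pi.basis fun _ : Fin (n + 1) => b).repr (mulVars P (b i)) ⟨s, l⟩ =
        MvPolynomial.X s * (if i = l then 1 else 0) := by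
      rw [Pi.basis_repr]
      change b.repr ((MvPolynomial.X s : Poly k n) • b i) l = _
      rw [map_smul, Module.Basis.repr_self, Finsupp.smul_apply, Finsupp.single_apply, smul_eq_mul]
    exact entry ▸ X_mul_ite_mem_span_X s (i = l)

/-- The map `⨁ P(-deg x_s) → P` given by `(y_s)_s ↦ ∑ x_s y_s`. -/
def sumVars (P : GrMod.{u} k w) : (GrMod.pi fun s => P.shift (-w s, 0)) →ₗ[Poly k n] P :=
  ∑ s, (MvPolynomial.X s : Poly k n) • LinearMap.proj s

theorem sumVars_apply (P : GrMod.{u} k w) (y : Fin (n + 1) → P) :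
    sumVars P y = ∑ s, (MvPolynomial.X s : Poly k n) • y s := by
  simp [sumVars, LinearMap.sum_apply]

theorem sumVars_single [DecidableEq (Fin (n + 1))] (s : Fin (n + 1)) (y : P) :
    sumVars P (Pi.single s y : Fin (n + 1) → P) = (MvPolynomial.X s : Poly k n) • y := by
  rw [sumVars_apply, Finset.sum_eq_single s, Pi.single_eq_same]
  · intro l _ hl
    rw [Pi.single_eq_of_ne hl, smul_zero]
  · exact fun hs => absurd (Finset.mem_univ s) hs

theorem sumVars_isStronglyLinear (hP : P.IsGradedFree) : IsStronglyLinear (sumVars P) := by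
  classical
  obtain ⟨I, b, hb⟩ := hP
  refine ⟨⟨0, fun a j m hm => ?_⟩, Σ _ : Fin (n + 1), I, I, Pi.basis fun _ => b, b,
    IsHomogeneousBasis.pi fun s => hb.shift (-w s, 0), hb, ?_⟩
  · rw [sumVars_apply]
    refine Submodule.sum_mem _ fun s _ => ?_
    simpa using P.X_smul_mem s (hm s trivial)
  · rintro ⟨s, i⟩ l
    have entry : b.repr (sumVars P ((Pi.basis fun _ : Fin (n + 1) => b) ⟨s, i⟩)) l =
        MvPolynomial.X s * (if i = l then 1 else 0) := by
      rw [Pi.basis_apply, sumVars_single, map_smul, Module.Basis.repr_self, Finsupp.smul_apply,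
        Finsupp.single_apply, smul_eq_mul]
    exact entry ▸ X_mul_ite_mem_span_X s (i = l)

namespace IsStronglyLinear

theorem source_isGradedFree {f : P →ₗ[Poly k n] Q} (hf : IsStronglyLinear f) : P.IsGradedFree := by
  obtain ⟨-, I, -, b, -, hb, -⟩ := hf
  exact ⟨I, b, hb⟩

theorem shift_source {f : P →ₗ[Poly k n] Q} (hf : IsStronglyLinear f) (r : ℤ) :
    IsStronglyLinear (P := P.shift (0, r)) f := by
  obtain ⟨⟨t, ht⟩, I, J, b, b', hb, hb', hbb'⟩ := hf
  refine ⟨⟨r + t, fun a j m hm => ?_⟩, I, J, b, b', hb.shift (0, r), hb', hbb'⟩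
  simpa [add_assoc] using ht _ _ m hm

theorem inl_comp {f : P →ₗ[Poly k n] Q} (hf : IsStronglyLinear f) (hQ' : Q'.IsGradedFree) :
    IsStronglyLinear (Q := Q.prod Q') (LinearMap.inl (Poly k n) Q Q' ∘ₗ f) := by
  obtain ⟨⟨t, ht⟩, I, J, b, b', hb, hb', hbb'⟩ := hf
  obtain ⟨K, c, hc⟩ := hQ'
  refine ⟨⟨t, fun a j m hm => ⟨ht a j m hm, zero_mem _⟩⟩, I, J ⊕ K, b, b'.prod c, hb,
    hb'.prod hc, ?_⟩
  rintro i (l | l)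
  · rw [Module.Basis.prod_repr_inl]
    exact hbb' i l
  · simp

theorem comp_snd (hQ : Q.IsGradedFree) {g : Q' →ₗ[Poly k n] T} (hg : IsStronglyLinear g) :
    IsStronglyLinear (P := Q.prod Q') (g ∘ₗ LinearMap.snd (Poly k n) Q Q') := by
  obtain ⟨⟨t, ht⟩, J, K, b', c, hb', hc, hbc⟩ := hg
  obtain ⟨I, b, hb⟩ := hQ
  refine ⟨⟨t, fun a j m hm => ht a j _ hm.2⟩, I ⊕ J, K, b.prod b', c, hb.prod hb', hc, ?_⟩
  rintro (i | i) l
  · simp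
  · simpa using hbc i l

theorem comp_equiv {f : P →ₗ[Poly k n] Q} (hf : IsStronglyLinear f) {e : P' ≃ₗ[Poly k n] P}
    {r s : ℤ} (he : IsHomogeneousMap (e : P' →ₗ[Poly k n] P) r)
    (he' : IsHomogeneousMap (e.symm : P →ₗ[Poly k n] P') s) :
    IsStronglyLinear (f ∘ₗ (e : P' →ₗ[Poly k n] P)) := by
  obtain ⟨⟨t, ht⟩, I, J, b, b', hb, hb', hbb'⟩ := hf
  refine ⟨⟨r + t, ht.comp he⟩, I, J, b.map e.symm, b', hb.map he', hb', fun i j => ?_⟩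
  simpa using hbb' i j

theorem comp_coprod_id (hQ : Q.IsGradedFree) {C : Q →ₗ[Poly k n] Q'} (hC : IsHomogeneousMap C 0)
    {g : Q' →ₗ[Poly k n] T} (hg : IsStronglyLinear g) :
    IsStronglyLinear (P := Q.prod Q') (g ∘ₗ LinearMap.coprod C LinearMap.id) := by
  let shear : (Q × Q') ≃ₗ[Poly k n] Q × Q' := LinearEquiv.skewProd (.refl _ _) (.refl _ _) C
  have hC' {a : A} {j : ℤ} {m : Q} (hm : m ∈ Q.gr (a, j)) : C m ∈ Q'.gr (a, j) := by
    simpa using hC a j m hm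
  have shear_homogeneous : IsHomogeneousMap (M := Q.prod Q') (N := Q.prod Q')
      (shear : (Q × Q') →ₗ[Poly k n] Q × Q') 0 := by
    rintro a j ⟨x, y⟩ ⟨hx, hy⟩
    rw [add_zero]
    exact ⟨hx, add_mem hy (hC' hx)⟩
  have shear_symm_homogeneous : IsHomogeneousMap (M := Q.prod Q') (N := Q.prod Q')
      (shear.symm : (Q × Q') →ₗ[Poly k n] Q × Q') 0 := by
    rintro a j ⟨x, y⟩ ⟨hx, hy⟩
    rw [add_zero]
    exact ⟨hx, sub_mem hy (hC' hx)⟩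
  have coprod_eq : LinearMap.coprod C LinearMap.id =
      LinearMap.snd (Poly k n) Q Q' ∘ₗ (shear : (Q × Q') →ₗ[Poly k n] Q × Q') :=
    LinearMap.ext fun x => add_comm _ _
  rw [coprod_eq, ← LinearMap.comp_assoc]
  exact (hg.comp_snd hQ).comp_equiv shear_homogeneous shear_symm_homogeneous

end IsStronglyLinear

namespace IsStronglyLinearComp

variable {i : ℕ}

theorem inl_comp {f : P →ₗ[Poly k n] Q} (hf : IsStronglyLinearComp i f) (hQ' : Q'.IsGradedFree) :
    IsStronglyLinearComp i (Q := Q.prod Q') (LinearMap.inl (Poly k n) Q Q' ∘ₗ f) := by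
  cases hf with
  | single f hf => exact .single _ (hf.inl_comp hQ')
  | comp f₁ f₂ h₁ h₂ => exact .comp f₁ _ h₁ (h₂.inl_comp hQ')

-- The map `C` need not be linear in the variables: it is absorbed into the choice of a basis of
-- `Q ⊕ Q'`, through which `g ∘ C ∘ f` factors as `(g ∘ (C, id)) ∘ (f, 0)`.
theorem comp_comp {f : P →ₗ[Poly k n] Q} (hf : IsStronglyLinearComp i f) (hQ : Q.IsGradedFree)
    {C : Q →ₗ[Poly k n] Q'} {r : ℤ} (hC : IsHomogeneousMap C r) {g : Q' →ₗ[Poly k n] T}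
    (hg : IsStronglyLinear g) : IsStronglyLinearComp (i + 1) (g ∘ₗ C ∘ₗ f) := by
  have hg' := hg.shift_source r
  have hC' : IsHomogeneousMap (N := Q'.shift (0, r)) C 0 := fun a j m hm => by
    simpa using hC a j m hm
  have factorization : g ∘ₗ C ∘ₗ f =
      (g ∘ₗ LinearMap.coprod C LinearMap.id) ∘ₗ LinearMap.inl (Poly k n) Q Q' ∘ₗ f := by
    ext x
    simp
  rw [factorization]
  exact .comp _ _ (hf.inl_comp hg'.source_isGradedFree) (hg'.comp_coprod_id hQ hC')

end IsStronglyLinearComp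

end StronglyLinear

section LinearTerms

variable {k : Type uk} [Field k] {n : ℕ} {A : Type uA} [AddCommGroup A] [DecidableEq A]
variable {w : Fin (n + 1) → A}

section Factorizations

universe v

variable (D : DiffMod.{u} k w) {M : GrMod.{v} k w} {r : ℤ}

theorem baseChange_leftVar_mem (s : Fin (n + 1)) {a : A} {j : ℤ} {x : LMod D}
    (hx : x ∈ (LMod D).gr (a, j)) :
    (D.leftVar s).baseChange (Poly k n) x ∈ (LMod D).gr (a - w s, j - 1) := by
  refine tensorGr_le (P := ((LMod D).gr (a - w s, j - 1)).comap
    (((D.leftVar s).baseChange (Poly k n)).restrictScalars k)) ?_ hx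
  rintro b ⟨a', j'⟩ hd p hp y hy
  obtain ⟨rfl, rfl⟩ := Prod.mk.inj hd
  exact tmul_mem_tensorGr _ hp (D.leftVar_mem s hy) (by simp [add_sub_assoc])

theorem dPrime_apply (x : LMod D) : dPrime D x =
    ∑ s, (MvPolynomial.X s : Poly k n) • (D.leftVar s).baseChange (Poly k n) x := by
  simp only [dPrime, LinearMap.sum_apply, LinearMap.smul_apply]

/-- The map `(y_s)_s ↦ ∑ e_s (g y_s)`: the part of `∂' ∘ g` that is left after the
multiplications by the variables. -/
def sumLeftVars (g : M →ₗ[Poly k n] LMod D) :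
    (GrMod.pi fun s => M.shift (w s, 0)) →ₗ[Poly k n] LMod D :=
  ∑ s, (D.leftVar s).baseChange (Poly k n) ∘ₗ g ∘ₗ LinearMap.proj s

theorem sumLeftVars_comp_mulVars (g : M →ₗ[Poly k n] LMod D) :
    sumLeftVars D g ∘ₗ mulVars M = dPrime D ∘ₗ g := by
  refine LinearMap.ext fun y => ?_
  rw [LinearMap.comp_apply, LinearMap.comp_apply, dPrime_apply, sumLeftVars, LinearMap.sum_apply]
  refine Finset.sum_congr rfl fun s _ => ?_
  change (D.leftVar s).baseChange (Poly k n) (g ((MvPolynomial.X s : Poly k n) • y)) = _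
  rw [map_smul, map_smul]

theorem sumLeftVars_homogeneous {g : M →ₗ[Poly k n] LMod D} (hg : IsHomogeneousMap g r) :
    IsHomogeneousMap (sumLeftVars D g) (r - 1) := by
  intro a j y hy
  rw [sumLeftVars, LinearMap.sum_apply]
  refine Submodule.sum_mem _ fun s _ => ?_
  have leftVar_g_mem := baseChange_leftVar_mem D s (hg _ _ _ (hy s trivial))
  rwa [add_sub_cancel_right, add_zero, add_sub_assoc] at leftVar_g_mem

/-- The map `x ↦ (f (e_s x))_s`: the part of `f ∘ ∂'` that is left before the multiplications by
the variables. -/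
def piLeftVars (f : LMod D →ₗ[Poly k n] M) :
    LMod D →ₗ[Poly k n] GrMod.pi fun s => M.shift (-w s, 0) :=
  LinearMap.pi fun s => f ∘ₗ (D.leftVar s).baseChange (Poly k n)

theorem sumVars_comp_piLeftVars (f : LMod D →ₗ[Poly k n] M) :
    sumVars M ∘ₗ piLeftVars D f = f ∘ₗ dPrime D := by
  refine LinearMap.ext fun x => ?_
  rw [LinearMap.comp_apply, sumVars_apply, LinearMap.comp_apply, dPrime_apply, map_sum]
  exact Finset.sum_congr rfl fun s _ => (map_smul f _ _).symm

theorem piLeftVars_homogeneous {f : LMod D →ₗ[Poly k n] M} (hf : IsHomogeneousMap f r) :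
    IsHomogeneousMap (piLeftVars D f) (-1 + r) := by
  intro a j x hx s _
  have f_leftVar_mem := hf _ _ _ (baseChange_leftVar_mem D s hx)
  rw [sub_eq_add_neg, sub_eq_add_neg, add_assoc] at f_leftVar_mem
  rwa [← add_zero (j + (-1 + r))] at f_leftVar_mem

end Factorizations

namespace Contraction

theorem delta_one_eq {D : DiffMod.{u} k w} (c : Contraction (Lbar D) (Lbar (H D))) :
    c.delta 1 = c.π ∘ₗ dPrime D ∘ₗ c.ι :=
  one_smul ℤ _

theorem delta_add_two {D : DiffMod.{u} k w} (c : Contraction (Lbar D) (Lbar (H D))) (m : ℕ) :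
    c.delta (m + 2) = ((-1 : ℤ) ^ (m + 1) • c.π) ∘ₗ dPrime D ∘ₗ c.h ∘ₗ
      ((dPrime D ∘ₗ c.h) ^ m : Module.End (Poly k n) (LMod D)) ∘ₗ dPrime D ∘ₗ c.ι := by
  rw [delta, Nat.add_succ_sub_one, pow_succ' (dPrime D ∘ₗ c.h)]
  rfl

variable {D : DiffMod.{max uk u} k w}

theorem exists_factorization (c : Contraction (Lbar D) (Lbar (H D))) (m : ℕ) :
    ∃ (Q : GrMod.{max uk u} k w) (g : LMod (H D) →ₗ[Poly k n] Q) (C : Q →ₗ[Poly k n] LMod D)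
      (r : ℤ), Q.IsGradedFree ∧ IsStronglyLinearComp (m + 1) g ∧ IsHomogeneousMap C r ∧
      C ∘ₗ g = c.h ∘ₗ ((dPrime D ∘ₗ c.h) ^ m : Module.End (Poly k n) (LMod D)) ∘ₗ
        dPrime D ∘ₗ c.ι := by
  induction m with
  | zero =>
    refine ⟨_, mulVars _, c.h ∘ₗ sumLeftVars D c.ι, _,
      .pi fun s => (LMod_isGradedFree (H D)).shift (w s, 0),
      .single _ (mulVars_isStronglyLinear (LMod_isGradedFree (H D))),
      c.h_homogeneous.comp (sumLeftVars_homogeneous D c.ι_homogeneous), ?_⟩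
    rw [LinearMap.comp_assoc, sumLeftVars_comp_mulVars]
    rfl
  | succ m ih =>
    obtain ⟨Q, g, C, r, hQ, hg, hC, hCg⟩ := ih
    refine ⟨LMod D, dPrime D ∘ₗ C ∘ₗ g, c.h, 1, LMod_isGradedFree D,
      hg.comp_comp hQ hC (dPrime_isStronglyLinear D), c.h_homogeneous, ?_⟩
    rw [hCg, pow_succ']
    rfl

theorem delta_isStronglyLinearComp (c : Contraction (Lbar D) (Lbar (H D)))
    (hc : c.IsCanonical) (i : ℕ) (hi : 1 ≤ i) :
    IsStronglyLinearComp (P := LMod (H D)) (Q := LMod (H D)) i (c.delta i) := by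
  obtain _ | _ | m := i
  · exact absurd hi (Nat.not_lt_zero 0)
  · rw [zero_add, hc.delta_one]
    exact .single _ (dPrime_isStronglyLinear (H D))
  · obtain ⟨Q, g, C, r, hQ, hg, hC, hCg⟩ := c.exists_factorization m
    let f := (-1 : ℤ) ^ (m + 1) • c.π
    have f_homogeneous : IsHomogeneousMap f 0 := c.π_homogeneous.zsmul _
    have factorization : c.delta (m + 2) = sumVars (LMod (H D)) ∘ₗ (piLeftVars D f ∘ₗ C) ∘ₗ g := by
      rw [c.delta_add_two, ← hCg, ← LinearMap.comp_assoc, ← sumVars_comp_piLeftVars]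
      rfl
    rw [factorization]
    exact hg.comp_comp hQ ((piLeftVars_homogeneous D f_homogeneous).comp hC)
      (sumVars_isStronglyLinear (LMod_isGradedFree (H D)))

theorem isLinearChain_pow {c : Contraction (Lbar D) (Lbar (H D))}
    {ι₀ : H D →ₗ[k] D} {h₀ : D →ₗ[k] D} (hι : c.ι = ι₀.baseChange (Poly k n))
    (hh : c.h = h₀.baseChange (Poly k n)) {I J : Type (max uk u)} {b : Module.Basis I k (H D)}
    {b' : Module.Basis J k D} (hb : ∀ i, ∃ d, b i ∈ (H D).gr d) (hb' : ∀ j, ∃ d, b' j ∈ D.gr d)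
    (m : ℕ) :
    IsLinearChain (P := LMod (H D)) (Q := LMod D) (m + 1)
      (b.baseChange (Poly k n)) (b'.baseChange (Poly k n))
      (((dPrime D ∘ₗ c.h) ^ m : Module.End (Poly k n) (LMod D)) ∘ₗ dPrime D ∘ₗ c.ι) := by
  induction m with
  | zero =>
    refine .single _ _ _ (isHomogeneousBasis_baseChange hb) (isHomogeneousBasis_baseChange hb')
      ⟨_, (dPrime_homogeneous D).comp c.ι_homogeneous⟩ ?_
    have linear_entries := hasLinearEntries_baseChange b b' (LinearMap.id : D →ₗ[k] D) ι₀
    rwa [LinearMap.baseChange_id, LinearMap.id_comp, ← hι] at linear_entries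
  | succ m ih =>
    have linear_entries := hasLinearEntries_baseChange b' b' (LinearMap.id : D →ₗ[k] D) h₀
    rw [LinearMap.baseChange_id, LinearMap.id_comp, ← hh] at linear_entries
    have chain := IsLinearChain.comp _ _ _ _ _ ih (isHomogeneousBasis_baseChange hb')
      ⟨_, (dPrime_homogeneous D).comp c.h_homogeneous⟩ linear_entries
    rw [pow_succ']
    exact chain

theorem delta_isLinearChain (c : Contraction (Lbar D) (Lbar (H D)))
    (hc : c.IsExtended) : ∃ (I : Type (max uk u)) (b : Module.Basis I (Poly k n) (LMod (H D))),
      ∀ i, 1 ≤ i → IsLinearChain (P := LMod (H D)) (Q := LMod (H D)) i b b (c.delta i) := by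
  obtain ⟨π₀, ι₀, h₀, hπ, hι, hh⟩ := hc
  obtain ⟨I, b, hb⟩ := exists_homogeneousBasis_of_isInternal (H D).isInternal
  obtain ⟨J, b', hb'⟩ := exists_homogeneousBasis_of_isInternal D.isInternal
  refine ⟨I, b.baseChange (Poly k n), fun i hi => ?_⟩
  obtain _ | _ | m := i
  · exact absurd hi (Nat.not_lt_zero 0)
  · have linear_entries := hasLinearEntries_baseChange b b π₀ ι₀
    rw [← hι, ← hπ] at linear_entries
    rw [zero_add, c.delta_one_eq]
    exact .single _ _ _ (isHomogeneousBasis_baseChange hb) (isHomogeneousBasis_baseChange hb)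
      ⟨_, c.π_homogeneous.comp ((dPrime_homogeneous D).comp c.ι_homogeneous)⟩ linear_entries
  · have baseChange_zsmul : ((-1 : ℤ) ^ (m + 1) • π₀).baseChange (Poly k n) =
        (-1 : ℤ) ^ (m + 1) • c.π := by
      rw [hπ]
      exact map_zsmul (LinearMap.baseChangeHom k (Poly k n) D (H D)) _ _
    have linear_entries := hasLinearEntries_baseChange b' b ((-1 : ℤ) ^ (m + 1) • π₀) h₀
    rw [baseChange_zsmul, ← hh] at linear_entries
    have chain := IsLinearChain.comp _ _ _ _ _ (isLinearChain_pow hι hh hb hb' m)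
      (isHomogeneousBasis_baseChange hb)
      ⟨_, (c.π_homogeneous.zsmul _).comp ((dPrime_homogeneous D).comp c.h_homogeneous)⟩
      linear_entries
    rw [c.delta_add_two]
    exact chain

end Contraction

end LinearTerms

section QuasiIso

universe u₁ u₂ u₃

variable {k : Type uk} [Field k] {n : ℕ} {A : Type uA} [AddCommGroup A] [DecidableEq A]
variable {w : Fin (n + 1) → A}

/-- The projection of `M` onto the term `M_j`. -/
def GrMod.termProj (M : GrMod.{u} k w) (j : ℤ) : M →ₗ[k] M :=
  DirectSum.toModule k (A × ℤ) M (fun d => if d.2 = j then (M.gr d).subtype else 0) ∘ₗ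
    (decomp M.isInternal).toLinearMap

theorem GrMod.termProj_of_mem (M : GrMod.{u} k w) (j : ℤ) {d : A × ℤ} {m : M} (hm : m ∈ M.gr d) :
    M.termProj j m = if d.2 = j then m else 0 := by
  rw [GrMod.termProj, LinearMap.comp_apply, LinearEquiv.coe_coe, decomp_of_mem _ hm,
    DirectSum.toModule_lof]
  split_ifs <;> rfl

theorem GrMod.termProj_mem (M : GrMod.{u} k w) (j : ℤ) (m : M) : M.termProj j m ∈ M.term j := by
  refine grading_induction M.isInternal (P := fun m => M.termProj j m ∈ M.term j) ?_ ?_ ?_ m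
  · rw [map_zero]
    exact zero_mem _
  · intro x y hx hy
    rw [map_add]
    exact add_mem hx hy
  · rintro ⟨a, j'⟩ m hm
    rw [M.termProj_of_mem j hm]
    split_ifs with hj
    · obtain rfl : j' = j := hj
      exact Submodule.mem_iSup_of_mem (p := fun a => M.gr (a, j')) a hm
    · exact zero_mem _

theorem GrMod.termProj_of_mem_term (M : GrMod.{u} k w) {j : ℤ} {m : M} (hm : m ∈ M.term j) :
    M.termProj j m = m := by
  refine Submodule.iSup_induction _ (motive := fun m => M.termProj j m = m) hm ?_ ?_ ?_
  · intro a m hm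
    rw [M.termProj_of_mem j hm, if_pos rfl]
  · rw [map_zero]
  · intro x y hx hy
    rw [map_add, hx, hy]

theorem Cpx.termProj_d (C : Cpx.{u} k w) (j : ℤ) (m : C.toGrMod) :
    C.toGrMod.termProj j (C.d m) = C.d (C.toGrMod.termProj (j + 1) m) := by
  suffices C.toGrMod.termProj j ∘ₗ C.d.restrictScalars k =
      C.d.restrictScalars k ∘ₗ C.toGrMod.termProj (j + 1) from LinearMap.congr_fun this m
  refine linearMap_ext_grading C.toGrMod.isInternal ?_
  rintro ⟨a, j'⟩ m hm
  have d_mem := C.isDifferential.homogeneous a j' m hm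
  simp only [LinearMap.comp_apply, LinearMap.restrictScalars_apply]
  rw [C.toGrMod.termProj_of_mem _ d_mem, C.toGrMod.termProj_of_mem _ hm, apply_ite C.d, map_zero]
  exact if_congr ⟨eq_add_of_add_neg_eq, add_neg_eq_of_eq_add⟩ rfl rfl

theorem IsHomogeneousMap.mem_term {M : GrMod.{u₁} k w} {N : GrMod.{u₂} k w}
    {f : M →ₗ[Poly k n] N} {r : ℤ} (hf : IsHomogeneousMap f r) {j : ℤ} {m : M}
    (hm : m ∈ M.term j) : f m ∈ N.term (j + r) := by
  refine (iSup_le fun a x hx => ?_ : M.term j ≤ (N.term (j + r)).comap (f.restrictScalars k)) hm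
  exact Submodule.mem_iSup_of_mem (p := fun a => N.gr (a, j + r)) a (hf a j x hx)

namespace IsQuasiIso

theorem homologicallyBoundedBelow {C : Cpx.{u₁} k w} {C' : Cpx.{u₂} k w}
    {φ : C.toGrMod →ₗ[Poly k n] C'.toGrMod} (hφ : IsQuasiIso φ)
    (h : C'.HomologicallyBoundedBelow) : C.HomologicallyBoundedBelow := by
  obtain ⟨m, hm⟩ := h
  refine ⟨m, fun j hj x hx hdx => ?_⟩
  have φx_mem := hφ.homogeneous.mem_term hx
  rw [add_zero] at φx_mem
  obtain ⟨y, -, hy⟩ := hm j hj (φ x) φx_mem (by rw [← hφ.comm, hdx, map_zero])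
  obtain ⟨z, hz⟩ := hφ.injective x hdx ⟨y, hy⟩
  refine ⟨C.toGrMod.termProj (j + 1) z, C.toGrMod.termProj_mem _ _, ?_⟩
  rw [← C.termProj_d, hz, C.toGrMod.termProj_of_mem_term hx]

theorem comp {C : Cpx.{u₁} k w} {C' : Cpx.{u₂} k w} {C'' : Cpx.{u₃} k w}
    {φ : C.toGrMod →ₗ[Poly k n] C'.toGrMod} {ψ : C'.toGrMod →ₗ[Poly k n] C''.toGrMod}
    (hψ : IsQuasiIso ψ) (hφ : IsQuasiIso φ) : IsQuasiIso (ψ ∘ₗ φ) where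
  homogeneous := hψ.homogeneous.comp hφ.homogeneous
  comm x := by rw [LinearMap.comp_apply, LinearMap.comp_apply, hφ.comm, hψ.comm]
  injective x hx h := hφ.injective x hx
    (hψ.injective (φ x) (by rw [← hφ.comm, hx, map_zero]) h)
  surjective z hz := by
    obtain ⟨y, hy, hyz⟩ := hψ.surjective z hz
    obtain ⟨x, hx, v, hv⟩ := hφ.surjective y hy
    have sub_eq : z - (ψ ∘ₗ φ) x = (z - ψ y) + C''.d (ψ v) := by
      rw [← hψ.comm, hv, map_sub, LinearMap.comp_apply]
      abel
    exact ⟨x, hx, sub_eq ▸ add_mem hyz ⟨_, rfl⟩⟩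

end IsQuasiIso

end QuasiIso

section Resolution

variable {k : Type uk} [Field k] {n : ℕ} {A : Type uA} [AddCommGroup A] [DecidableEq A]
variable {w : Fin (n + 1) → A} {D : DiffMod.{u} k w}

theorem map_dPrime_mem_smul_top {M : Type*} [AddCommGroup M] [Module (Poly k n) M]
    (g : LMod D →ₗ[Poly k n] M) (x : LMod D) :
    g (dPrime D x) ∈ Ideal.span (Set.range (MvPolynomial.X : Fin (n + 1) → Poly k n)) •
      (⊤ : Submodule (Poly k n) M) := by
  rw [dPrime_apply, map_sum]
  refine Submodule.sum_mem _ fun s _ => ?_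
  rw [map_smul]
  exact Submodule.smul_mem_smul (Ideal.subset_span ⟨s, rfl⟩) Submodule.mem_top

theorem L_d (D : DiffMod.{u} k w) : (L D).d = dInternal D + dPrime D :=
  add_comm _ _

namespace Contraction

variable {c : Contraction (Lbar D) (Lbar (H D))}

theorem delta_succ (c : Contraction (Lbar D) (Lbar (H D))) (i : ℕ) :
    c.delta (i + 1) =
      c.π ∘ₗ ((-(dPrime D * c.h)) ^ i : Module.End (Poly k n) (LMod D)) ∘ₗ dPrime D ∘ₗ c.ι := by
  refine LinearMap.ext fun x => ?_
  have neg_pow := neg_pow_apply (R := Poly k n) (M := LMod D) (dPrime D * c.h) i (dPrime D (c.ι x))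
  exact ((congrArg c.π neg_pow).trans (map_zsmul c.π _ _)).symm

variable (hn : IsLocallyNilpotent (dPrime D * c.h : Module.End (Poly k n) (LMod D)))

/-- The operator `(1 + ∂' h)⁻¹ ∂' = ∑ (-1) ^ i (∂' h) ^ i ∂'` of the homological perturbation
lemma. -/
def transfer : LMod D →ₗ[Poly k n] LMod D :=
  geomSeries (-(dPrime D * c.h)) hn.neg ∘ₗ dPrime D

theorem isPerturbation :
    IsPerturbation (dInternal D) (dPrime D) c.h (transfer hn) (dInternal (H D)) c.π c.ι where
  perturbed_sq x := by
    have dPrime_sq := LinearMap.congr_fun (dPrime_dPrime D) x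
    have dPrime_d := LinearMap.congr_fun (dPrime_dInternal D) x
    simp only [LinearMap.comp_apply, LinearMap.zero_apply, LinearMap.add_apply]
      at dPrime_sq dPrime_d
    rw [dPrime_sq, zero_add]
    exact (add_comm _ _).trans dPrime_d
  d'_d' := LinearMap.congr_fun (dInternal_dInternal (H D))
  π_d := c.π_comm
  ι_d' := c.ι_comm
  π_ι := c.π_ι
  homotopy := c.homotopy
  π_h := c.π_h
  h_ι := c.h_ι
  h_h := c.h_h
  T_add_t_h_T x := geomSeries_neg_add_apply hn (dPrime D x)
  T_add_T_h_t x := geomSeries_neg_apply_add hn (dPrime D x)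

theorem transfer_homogeneous :
    IsHomogeneousMap (M := LMod D) (N := LMod D) (transfer hn) (-1) := by
  intro a j x hx
  refine geomSeries_mem hn.neg (p := ((LMod D).gr (a, j + -1)).toAddSubmonoid) (fun y hy => ?_)
    (dPrime_homogeneous D a j x hx)
  have dPrime_h_mem := dPrime_homogeneous D _ _ _ (c.h_homogeneous _ _ _ hy)
  rw [add_neg_cancel_right] at dPrime_h_mem
  exact ((LMod D).gr (a, j + -1)).neg_mem dPrime_h_mem

include hn in
theorem exists_delta_eq_zero (x : LMod (H D)) : ∃ m : ℕ,
    ((-(dPrime D * c.h)) ^ m : Module.End (Poly k n) (LMod D)) (dPrime D (c.ι x)) = 0 ∧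
      ∀ i, m < i → c.delta i x = 0 := by
  obtain ⟨m, hm⟩ := hn.neg (dPrime D (c.ι x))
  refine ⟨m, hm, fun i hi => ?_⟩
  obtain ⟨i, rfl⟩ := Nat.exists_eq_succ_of_ne_zero (Nat.ne_zero_of_lt hi)
  rw [Nat.succ_eq_add_one, delta_succ, LinearMap.comp_apply, LinearMap.comp_apply,
    LinearMap.comp_apply, Module.End.pow_map_zero_of_le (Nat.le_of_lt_succ hi) hm, map_zero]

include hn in
theorem finite_delta_ne_zero (x : LMod (H D)) : {i | c.delta i x ≠ 0}.Finite := by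
  obtain ⟨m, -, delta_eq_zero⟩ := exists_delta_eq_zero hn x
  exact (Set.finite_Iic m).subset fun i hi => not_lt.1 fun hmi => hi (delta_eq_zero i hmi)

/-- The differential of the minimal free resolution: the transfer of the differential of `L(D)`
to `L(H(D))` along the contraction. -/
def resDiff : LMod (H D) →ₗ[Poly k n] LMod (H D) :=
  dInternal (H D) + c.π ∘ₗ transfer hn ∘ₗ c.ι

theorem resDiff_eq : resDiff hn = c.π ∘ₗ transfer hn ∘ₗ c.ι := by
  rw [resDiff, dInternal_H, zero_add]

theorem resDiff_apply (hc : c.IsCanonical) (x : LMod (H D)) :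
    resDiff hn x = (L (H D)).d x + ∑ᶠ i : ℕ, c.delta (i + 2) x := by
  obtain ⟨m, hm, delta_eq_zero⟩ := exists_delta_eq_zero hn x
  have L_d_eq_delta_one : (L (H D)).d = c.delta 1 := by
    rw [L_d, dInternal_H, zero_add, hc.delta_one]
  have finsum_eq : ∑ᶠ i : ℕ, c.delta (i + 2) x = ∑ i ∈ Finset.range m, c.delta (i + 1 + 1) x := by
    refine finsum_eq_sum_of_support_subset _ fun i hi => ?_
    rw [Finset.coe_range, Set.mem_Iio]
    by_contra! hmi
    exact hi (delta_eq_zero _ (by omega))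
  have resDiff_eq_sum : resDiff hn x = ∑ i ∈ Finset.range (m + 1), c.delta (i + 1) x := by
    rw [resDiff_eq, LinearMap.comp_apply, LinearMap.comp_apply, transfer, LinearMap.comp_apply,
      geomSeries_apply_eq_sum hn.neg (Module.End.pow_map_zero_of_le m.le_succ hm),
      LinearMap.sum_apply, map_sum]
    exact Finset.sum_congr rfl fun i _ => (LinearMap.congr_fun (c.delta_succ i) x).symm
  rw [L_d_eq_delta_one, finsum_eq, resDiff_eq_sum, Finset.sum_range_succ', add_comm]

theorem resDiff_homogeneous :
    IsHomogeneousMap (M := LMod (H D)) (N := LMod (H D)) (resDiff hn) (-1) := by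
  intro a j x hx
  have π_transfer_ι_mem :=
    c.π_homogeneous _ _ _ (transfer_homogeneous hn _ _ _ (c.ι_homogeneous a j x hx))
  rw [add_zero, add_zero] at π_transfer_ι_mem
  rwa [resDiff_eq]

theorem resDiff_isDifferential : IsDifferential (LMod (H D)) (resDiff hn) where
  homogeneous := resDiff_homogeneous hn
  sq := (isPerturbation hn).perturbedDiff_sq

/-- The complex `F`: the module underlying `L(H(D))` with the transferred differential. -/
abbrev resolution : Cpx k w :=
  ⟨LMod (H D), resDiff hn, resDiff_isDifferential hn⟩

theorem resolution_isMinimal : (resolution hn).IsMinimal := by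
  intro x
  have resDiff_x : resDiff hn x = (c.π ∘ₗ geomSeries _ hn.neg) (dPrime D (c.ι x)) :=
    LinearMap.congr_fun (resDiff_eq hn) x
  exact resDiff_x ▸ map_dPrime_mem_smul_top (c.π ∘ₗ geomSeries _ hn.neg) (c.ι x)

/-- The quasi-isomorphism `F → L(D)`: the inclusion `ι` of the contraction, corrected by the
perturbation. -/
def resInclusion : LMod (H D) →ₗ[Poly k n] LMod D :=
  c.ι - c.h ∘ₗ transfer hn ∘ₗ c.ι

theorem resInclusion_homogeneous :
    IsHomogeneousMap (M := LMod (H D)) (N := LMod D) (resInclusion hn) 0 := by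
  intro a j x hx
  have h_transfer_ι_mem :=
    c.h_homogeneous _ _ _ (transfer_homogeneous hn _ _ _ (c.ι_homogeneous a j x hx))
  rw [neg_add_cancel_right] at h_transfer_ι_mem
  exact sub_mem (c.ι_homogeneous a j x hx) h_transfer_ι_mem

theorem resInclusion_isQuasiIso :
    IsQuasiIso (C := resolution hn) (C' := L D) (resInclusion hn) where
  homogeneous := resInclusion_homogeneous hn
  comm x := by
    rw [L_d]
    exact (isPerturbation hn).perturbedInclusion_comm x
  injective := by
    rintro x - ⟨y, hy⟩
    rw [L_d] at hy
    have projection_comm := (isPerturbation hn).perturbedProjection_comm y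
    rw [hy] at projection_comm
    exact ⟨_, projection_comm.symm.trans
      ((isPerturbation hn).perturbedProjection_perturbedInclusion x)⟩
  surjective := by
    intro y hy
    rw [L_d] at hy ⊢
    have projection_comm := (isPerturbation hn).perturbedProjection_comm y
    have homotopy := (isPerturbation hn).perturbedHomotopy y
    rw [hy, map_zero] at projection_comm homotopy
    rw [add_zero] at homotopy
    exact ⟨_, projection_comm.symm, _, homotopy.symm⟩

end Contraction

end Resolution

end

end MultigradedBGG

theorem mainTheorem2 {k : Type*} [Field k] {A : Type*} [AddCommGroup A] [DecidableEq A] {n : ℕ}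
    (w : Fin (n + 1) → A) (hw : ∃ θ : A →+ ℤ, IsPositive w θ)
    (G : Cpx k w) (hG : G.HomologicallyBoundedBelow) (hG' : G.toGrMod.TermsBoundedBelow)
    (c : Contraction (Lbar (R G)) (Lbar (H (R G)))) (hc : c.IsCanonical) :
    -- the sum of the `δ_i` is locally finite
    (∀ x, {i | c.delta i x ≠ 0}.Finite) ∧
    -- the perturbed complex is a minimal free resolution of `G`
    (∃ (dF : LMod (H (R G)) →ₗ[Poly k n] LMod (H (R G)))
        (hdF : IsDifferential (LMod (H (R G))) dF),
      (∀ x, dF x = (L (H (R G))).d x + ∑ᶠ i : ℕ, c.delta (i + 2) x) ∧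
      IsMinimalFreeResolution ⟨LMod (H (R G)), dF, hdF⟩ G) ∧
    -- its terms vanish in low homological degrees, and are uniformly bounded below in `A`-degrees,
    -- when those of `G` are
    (∀ m : ℤ, (∀ j < m, G.toGrMod.term j = ⊥) → ∀ j < m, (LMod (H (R G))).term j = ⊥) ∧
    (∀ θ : A →+ ℤ, IsPositive w θ → ∀ N : ℤ, (∀ a j, θ a < N → G.toGrMod.gr (a, j) = ⊥) →
      ∀ a j, θ a < N → (LMod (H (R G))).gr (a, j) = ⊥) ∧
    -- each `δ_i` is an `i`-fold composition of strongly linear maps, and even one with respect to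
    -- fixed bases when the contraction is extended from `k`
    (∀ i, 1 ≤ i → IsStronglyLinearComp i (c.delta i)) ∧
    (c.IsExtended → ∃ (I : Type _) (b : Module.Basis I (Poly k n) (LMod (H (R G)))),
      ∀ i, 1 ≤ i → IsLinearChain i b b (c.delta i)) := by
  obtain ⟨θ, hθ, G_isBoundedBelow⟩ := hG'
  have hD := IsBoundedBelow.R hθ G_isBoundedBelow
  have hn := isLocallyNilpotent_dPrime_mul hθ hD c.h_homogeneous
  have quasiIso := (counit_isQuasiIso G).comp (Contraction.resInclusion_isQuasiIso hn)
  have resolution_isResolution : IsMinimalFreeResolution (Contraction.resolution hn) G :=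
    { free := LMod_isGradedFree (H (R G))
      minimal := Contraction.resolution_isMinimal hn
      homologicallyBoundedBelow := quasiIso.homologicallyBoundedBelow hG
      termsBoundedBelow := ⟨θ, hθ, IsBoundedBelow.LMod hθ (IsBoundedBelow.H hD)⟩
      quasiIso := ⟨_, quasiIso⟩ }
  exact ⟨Contraction.finite_delta_ne_zero hn,
    ⟨Contraction.resDiff hn, Contraction.resDiff_isDifferential hn,
      Contraction.resDiff_apply hn hc, resolution_isResolution⟩,
    fun _ hm _ hj => LMod_H_R_term_eq_bot G hm hj,
    fun _ hθ' _ hN a j ha => LMod_H_R_gr_eq_bot G hθ' hN ha j,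
    c.delta_isStronglyLinearComp hc,
    c.delta_isLinearChain⟩
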